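/- **Setting.** Let $B$ be a regular magnetic field on $\mathbb R^d$: a closed 2-form $B=\frac12\sum_{j,k}B_{jk}\,dx_j\wedge dx_k$, $B_{jk}=-B_{kj}$, whose components are smooth and bounded together with all their derivatives. Let $A_k(x)=\sum_j\int_0^1 s\,x_jB_{jk}(sx)\,ds$ be its vector potential in the transversal gauge and $\varphi(x,y)=\int_{[y,x]}A$ the integral of $A$ along the segment from $y$ to $x$. Write $\mathscr S,\mathscr S'$ for Schwartz functions and tempered distributions, and $\mathcal B(V,W)$ for the continuous linear operators $V\to W$; spaces of continuous operators (in particular $\mathscr S'$) carry the topology of uniform convergence on bounded sets. For $\Phi\in\mathscr S(\mathbb R^{4d})$ put $$(K^A\Phi)(x_L,x_R,y_L,y_R)=\frac1{(2\pi)^{2d}}\int e^{i[\xi_L\cdot(x_L-y_L)-\xi_R\cdot(x_R-y_R)]}\,e^{i[\varphi(x_L,y_L)-\varphi(x_R,y_R)]}\,\Phi\Big(\tfrac{x_L+y_L}2,\xi_L,\tfrac{x_R+y_R}2,\xi_R\Big)d\xi_L\,d\xi_R ,$$ and extend $K^A$ to $\mathscr S'(\mathbb R^{4d})$ by transposition.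 Let $\mathfrak{int}:\mathscr S'(\mathbb R^{2d})\to\mathcal B(\mathscr S(\mathbb R^d),\mathscr S'(\mathbb R^d))$, $\langle\mathfrak{int}(k)f,g\rangle=\langle k,g\otimes f\rangle$, be the kernel map, and $\mathfrak{Int}:\mathscr S'(\mathbb R^{4d})\to\mathcal B(\mathscr S(\mathbb R^{2d}),\mathscr S'(\mathbb R^{2d}))$ the same map on $\mathbb R^{2d}$. The map $\mathfrak{int}$ is bijective, and it identifies $\mathscr S(\mathbb R^{2d})$ with the smoothing operators $\mathcal B(\mathscr S'(\mathbb R^d),\mathscr S(\mathbb R^d))$. For $\Phi\in\mathscr S'(\mathbb R^{4d})$ define $$\mathfrak{Op}^A(\Phi)=\mathfrak{int}\circ\mathfrak{Int}(K^A\Phi)\circ\mathfrak{int}^{-1}:\ \mathcal B(\mathscr S',\mathscr S)\to\mathcal B(\mathscr S,\mathscr S').$$ If $\Phi\in\mathscr S(\mathbb R^{4d})$, then $\mathfrak{Op}^A(\Phi)$ extends to a map $\mathcal B(\mathscr S,\mathscr S')\to\mathcal B(\mathscr S',\mathscr S)$: the kernel of $\mathfrak{Op}^A(\Phi)R$ is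 $X\mapsto\langle\mathfrak{int}^{-1}(R),(K^A\Phi)(X,\cdot)\rangle$. The *magnetic super Weyl product* $\Phi\,\#^B\,\Psi$ of $\Phi,\Psi\in\mathscr S'(\mathbb R^{4d})$ is the $\Theta\in\mathscr S'(\mathbb R^{4d})$ with $$\mathfrak{Op}^A(\Theta)=\mathfrak{Op}^A(\Phi)\,\mathfrak{Op}^A(\Psi).$$ It is used when the composition on the right makes sense on smoothing operators: either because $\mathfrak{Op}^A(\Psi)$ maps smoothing operators to smoothing operators (this includes $\Psi\in\mathscr S$), or because $\Phi\in\mathscr S(\mathbb R^{4d})$. The *magnetic super Moyal algebra* $\mathscr M^B(\mathbb R^{4d})$ consists of the $\Phi\in\mathscr S'(\mathbb R^{4d})$ such that $\Phi\,\#^B\,\Psi$ and $\Psi\,\#^B\,\Phi$ belong to $\mathscr S(\mathbb R^{4d})$ for every $\Psi\in\mathscr S(\mathbb R^{4d})$. A *tempered weight* on $\mathbb R^{4d}$ is a positive function $M$ for which there are $a,C>0$ with $M(X+Y)\le C\,M(X)\langle Y\rangle^a$ for all $X,Y\in\mathbb R^{4d}$, where $\langle Y\rangle=(1+|Y|^2)^{1/2}$.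 $S_0(M)$ is the Fréchet space of the smooth $\Phi:\mathbb R^{4d}\to\mathbb C$ with $\sup_X M(X)^{-1}|\partial^\gamma\Phi(X)|<\infty$ for all multi-indices $\gamma$, topologized by these seminorms. Its elements are regarded as tempered distributions, and $S_0(\infty)=\bigcup_M S_0(M)$ over all tempered weights $M$. **Proposition.** $S_0(\infty)\subseteq\mathscr M^B(\mathbb R^{4d})$. Furthermore, for any two tempered weights $M_1,M_2$ on $\mathbb R^{4d}$ and all $\Phi\in S_0(M_1)$, $\Psi\in S_0(M_2)$, the operator $\mathfrak{Op}^A(\Psi)$ maps smoothing operators to smoothing operators, the product $\Phi\,\#^B\,\Psi$ exists, is unique and belongs to $S_0(M_1M_2)$, and the bilinear map $$S_0(M_1)\times S_0(M_2)\ni(\Phi,\Psi)\mapsto\Phi\,\#^B\,\Psi\in S_0(M_1M_2)$$ is continuous. -/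

import Mathlib

open MeasureTheory SchwartzMap
open scoped ContDiff

noncomputable section
set_option linter.unusedSectionVars false

namespace MagneticSuper

section PI
variable {E : Type} [NormedAddCommGroup E] [NormedSpace ℝ E]

theorem hasFDerivAt_segmentIntegral {F : Type} [NormedAddCommGroup F] [NormedSpace ℝ F]
    {G : ℝ × E → F} (hG : G.HasTemperateGrowth) (x₀ : E) :
    HasFDerivAt (fun x => ∫ s in (0:ℝ)..1, G (s, x))
      (∫ s in (0:ℝ)..1, (fderiv ℝ G (s, x₀)).comp (ContinuousLinearMap.inr ℝ ℝ E)) x₀ := by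
  have hd : Differentiable ℝ G := hG.1.differentiable (by simp)
  have hfc : Continuous (fderiv ℝ G) := hG.1.continuous_fderiv (by simp)
  have hFx (x : E) : Continuous fun s : ℝ => G (s, x) :=
    hG.1.continuous.comp (by fun_prop)
  have hF'x (x : E) : Continuous fun s : ℝ =>
      (fderiv ℝ G (s, x)).comp (ContinuousLinearMap.inr ℝ ℝ E) := by
    have h1 : Continuous fun s : ℝ => fderiv ℝ G (s, x) := hfc.comp (by fun_prop)
    exact h1.clm_comp continuous_const
  obtain ⟨k, C, h⟩ := hG.2 1
  have hC : 0 ≤ C := by simpa using (norm_nonneg _).trans (h 0)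
  have hb : ∀ s ∈ Set.uIoc (0:ℝ) 1, ∀ x ∈ Metric.ball x₀ 1,
      ‖(fderiv ℝ G (s, x)).comp (ContinuousLinearMap.inr ℝ ℝ E)‖ ≤ C * (1 + (1 + (‖x₀‖ + 1))) ^ k := by
    intro s hs x hx
    rw [Set.uIoc_of_le zero_le_one] at hs
    have hx' : ‖x‖ ≤ ‖x₀‖ + 1 := by
      have := norm_le_norm_add_norm_sub' x x₀
      rw [mem_ball_iff_norm] at hx
      linarith
    have hs' : ‖s‖ ≤ 1 := by rw [Real.norm_of_nonneg hs.1.le]; exact hs.2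
    have h1 : ‖fderiv ℝ G (s, x)‖ ≤ C * (1 + ‖((s, x) : ℝ × E)‖) ^ k := by
      have := h (s, x)
      rwa [← zero_add 1, ← norm_iteratedFDeriv_fderiv, norm_iteratedFDeriv_zero] at this
    have h2 : ‖((s, x) : ℝ × E)‖ ≤ 1 + (‖x₀‖ + 1) := by
      rw [Prod.norm_mk]
      exact max_le (by linarith [norm_nonneg x₀]) (by linarith)
    calc _ ≤ ‖fderiv ℝ G (s, x)‖ * ‖ContinuousLinearMap.inr ℝ ℝ E‖ :=
          ContinuousLinearMap.opNorm_comp_le _ _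
      _ ≤ ‖fderiv ℝ G (s, x)‖ * 1 := by
          gcongr; exact ContinuousLinearMap.norm_inr_le_one ℝ ℝ E
      _ ≤ C * (1 + ‖((s, x) : ℝ × E)‖) ^ k := by simpa using h1
      _ ≤ _ := by gcongr
  refine (intervalIntegral.hasFDerivAt_integral_of_dominated_of_fderiv_le
    (F := fun x s => G (s, x))
    (F' := fun x s => (fderiv ℝ G (s, x)).comp (ContinuousLinearMap.inr ℝ ℝ E))
    (bound := fun _ => C * (1 + (1 + (‖x₀‖ + 1))) ^ k)
    (Metric.ball_mem_nhds x₀ one_pos) ?_ ?_ ?_ ?_ ?_ ?_)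
  · exact .of_forall fun x => (hFx x).aestronglyMeasurable
  · exact (hFx x₀).intervalIntegrable _ _
  · exact (hF'x x₀).aestronglyMeasurable
  · exact .of_forall fun s hs x hx => hb s hs x hx
  · exact intervalIntegrable_const
  · refine .of_forall fun s _ x _ => ?_
    exact (hd (s, x)).hasFDerivAt.comp x (hasFDerivAt_prodMk_right s x)

theorem HasTemperateGrowth.segmentIntegral {F : Type} [NormedAddCommGroup F] [NormedSpace ℝ F]
    {G : ℝ × E → F} (hG : G.HasTemperateGrowth) :
    (fun x => ∫ s in (0:ℝ)..1, G (s, x)).HasTemperateGrowth := by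
  have key : ∀ n : ℕ, ∀ (F : Type) [NormedAddCommGroup F] [NormedSpace ℝ F] (G : ℝ × E → F),
      G.HasTemperateGrowth → ContDiff ℝ n (fun x => ∫ s in (0:ℝ)..1, G (s, x)) ∧
      ∃ (k : ℕ) (C : ℝ), ∀ x,
        ‖iteratedFDeriv ℝ n (fun x => ∫ s in (0:ℝ)..1, G (s, x)) x‖ ≤ C * (1 + ‖x‖) ^ k := by
    intro n
    induction n with
    | zero =>
      intro F _ _ G hG
      refine ⟨contDiff_zero.2 ?_, ?_⟩
      · exact continuous_iff_continuousAt.2 fun x =>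
          (hasFDerivAt_segmentIntegral hG x).continuousAt
      · obtain ⟨k, C, h⟩ := hG.2 0
        have hC : 0 ≤ C := by simpa using (norm_nonneg _).trans (h 0)
        refine ⟨k, C * 2 ^ k, fun x => ?_⟩
        rw [norm_iteratedFDeriv_zero]
        have : ∀ s ∈ Set.uIoc (0:ℝ) 1, ‖G (s, x)‖ ≤ C * 2 ^ k * (1 + ‖x‖) ^ k := by
          intro s hs
          rw [Set.uIoc_of_le zero_le_one] at hs
          have hs' : ‖s‖ ≤ 1 := by rw [Real.norm_of_nonneg hs.1.le]; exact hs.2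
          have h1 := h (s, x)
          rw [norm_iteratedFDeriv_zero] at h1
          refine h1.trans ?_
          rw [mul_assoc, ← mul_pow]
          gcongr
          rw [Prod.norm_mk]
          have := norm_nonneg x
          rcases max_cases ‖s‖ ‖x‖ with h | h <;> linarith
        simpa using intervalIntegral.norm_integral_le_of_norm_le_const this
    | succ n ih =>
      intro F _ _ G hG
      have hG' : (fun p => (fderiv ℝ G p).comp (ContinuousLinearMap.inr ℝ ℝ E)).HasTemperateGrowth := by
        have h1 : (fderiv ℝ G).HasTemperateGrowth :=
          ⟨hG.1.fderiv_right (by simp), fun m => by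
            obtain ⟨k, C, h⟩ := hG.2 (m + 1)
            exact ⟨k, C, fun x => by rw [norm_iteratedFDeriv_fderiv]; exact h x⟩⟩
        exact ((ContinuousLinearMap.compL ℝ E (ℝ × E) F).flip
          (ContinuousLinearMap.inr ℝ ℝ E)).hasTemperateGrowth.comp h1
      obtain ⟨h1, k, C, h2⟩ := ih _ _ hG'
      have hfd : fderiv ℝ (fun x => ∫ s in (0:ℝ)..1, G (s, x)) =
          fun x => ∫ s in (0:ℝ)..1, (fderiv ℝ G (s, x)).comp (ContinuousLinearMap.inr ℝ ℝ E) :=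
        funext fun x => (hasFDerivAt_segmentIntegral hG x).fderiv
      refine ⟨?_, k, C, fun x => ?_⟩
      · push_cast
        refine contDiff_succ_iff_fderiv.2 ⟨fun x =>
          (hasFDerivAt_segmentIntegral hG x).differentiableAt, by simp, ?_⟩
        rw [hfd]; exact h1
      · rw [← norm_iteratedFDeriv_fderiv, hfd]; exact h2 x
  exact ⟨contDiff_infty.2 fun n => (key n F G hG).1, fun n => (key n F G hG).2⟩
end PI

theorem hasTemperateGrowth_expI :
    (fun t : ℝ => Complex.exp (t * Complex.I)).HasTemperateGrowth := by
  have hfd : ∀ n : ℕ, ∀ t : ℝ, iteratedDeriv n (fun t : ℝ => Complex.exp (t * Complex.I)) t =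
      Complex.I ^ n * Complex.exp (t * Complex.I) := by
    intro n
    induction n with
    | zero => simp
    | succ n ih =>
      intro t
      rw [iteratedDeriv_succ, funext ih]
      have h1 : HasDerivAt (fun t : ℝ => (t : ℂ) * Complex.I) Complex.I t := by
        simpa using (Complex.ofRealCLM.hasDerivAt (x := t)).mul_const Complex.I
      have := (h1.cexp.const_mul (Complex.I ^ n)).deriv
      rw [this]; ring
  refine ⟨?_, fun n => ⟨0, 1, fun t => ?_⟩⟩
  · exact (Complex.ofRealCLM.contDiff.mul contDiff_const).cexp
  · rw [norm_iteratedFDeriv_eq_norm_iteratedDeriv, hfd]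
    simp [Complex.norm_exp_ofReal_mul_I]

section Model

/-- Configuration space `ℝ^d`. -/
abbrev Conf (d : ℕ) : Type := EuclideanSpace ℝ (Fin d)
/-- Phase space `ℝ^{2d}`, with points `X = (x, ξ)`. -/
abbrev Phase (d : ℕ) : Type := Conf d × Conf d
/-- The space `ℝ^{4d}`. As the space of the super symbols, its points are
`(X_L, X_R) = ((x_L, ξ_L), (x_R, ξ_R))`; as the space of the super integral kernels, its points are
`(x, y) = ((x_L, x_R), (y_L, y_R))`. -/
abbrev SuperPhase (d : ℕ) : Type := Phase d × Phase d

/-- A regular magnetic field: a closed `2`-form `B = ½ ∑ B_{jk} dx_j ∧ dx_k` on `ℝ^d` whose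
components are smooth and bounded together with all their derivatives. -/
structure MagneticField (d : ℕ) where
  /-- the components `B_{jk}` -/
  comp : Fin d → Fin d → Conf d → ℝ
  antisymm : ∀ j k x, comp j k x = -comp k j x
  smooth : ∀ j k, ContDiff ℝ ∞ (comp j k)
  bounded : ∀ j k (n : ℕ), ∃ C : ℝ, ∀ x, ‖iteratedFDeriv ℝ n (comp j k) x‖ ≤ C
  /-- `dB = 0`, that is `∂_i B_{jk} + ∂_j B_{ki} + ∂_k B_{ij} = 0` -/
  closed : ∀ i j k x,
    fderiv ℝ (comp j k) x (EuclideanSpace.single i 1) +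
      fderiv ℝ (comp k i) x (EuclideanSpace.single j 1) +
      fderiv ℝ (comp i j) x (EuclideanSpace.single k 1) = 0

variable {d : ℕ}

/-- The vector potential of `B` in the transversal gauge,
`A_k(x) = ∑_j ∫_0^1 s x_j B_{jk}(s x) ds`. -/
def vectorPotential (B : MagneticField d) (k : Fin d) (x : Conf d) : ℝ :=
  ∑ j, ∫ s in (0:ℝ)..1, s * x j * B.comp j k (s • x)

/-- The circulation `φ(x, y) = ∫_{[y, x]} A` of the vector potential along the segment from `y`
to `x`. -/
def circulation (B : MagneticField d) (x y : Conf d) : ℝ :=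
  ∫ s in (0:ℝ)..1, ∑ k, vectorPotential B k (y + s • (x - y)) * (x k - y k)

/-- The phase `exp (i (φ(x_L, y_L) - φ(x_R, y_R)))` at the point `((x_L, x_R), (y_L, y_R))`. -/
def superPhaseFactor (B : MagneticField d) (p : SuperPhase d) : ℂ :=
  Complex.exp (((circulation B p.1.1 p.2.1 - circulation B p.1.2 p.2.2 : ℝ) : ℂ) * Complex.I)

theorem MagneticField.hasTemperateGrowth (B : MagneticField d) (j k : Fin d) :
    (B.comp j k).HasTemperateGrowth :=
  ⟨B.smooth j k, fun n => by
    obtain ⟨C, h⟩ := B.bounded j k n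
    exact ⟨0, C, fun x => by simpa using h x⟩⟩

theorem vectorPotential_hasTemperateGrowth (B : MagneticField d) (k : Fin d) :
    (vectorPotential B k).HasTemperateGrowth := by
  have : vectorPotential B k = fun x => ∑ j, ∫ s in (0:ℝ)..1, s * x j * B.comp j k (s • x) := rfl
  rw [this]
  refine Function.HasTemperateGrowth.sum fun j _ => ?_
  refine HasTemperateGrowth.segmentIntegral (G := fun p : ℝ × Conf d =>
    p.1 * p.2 j * B.comp j k (p.1 • p.2)) ?_
  have h1 : (fun p : ℝ × Conf d => p.1).HasTemperateGrowth :=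
    (ContinuousLinearMap.fst ℝ ℝ (Conf d)).hasTemperateGrowth
  have h2 : (fun p : ℝ × Conf d => p.2).HasTemperateGrowth :=
    (ContinuousLinearMap.snd ℝ ℝ (Conf d)).hasTemperateGrowth
  have h3 : (fun p : ℝ × Conf d => p.2 j).HasTemperateGrowth :=
    ((EuclideanSpace.proj (𝕜 := ℝ) j).comp
      (ContinuousLinearMap.snd ℝ ℝ (Conf d))).hasTemperateGrowth
  exact (h1.mul h3).mul ((B.hasTemperateGrowth j k).comp (h1.smul h2))

theorem circulation_hasTemperateGrowth (B : MagneticField d) :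
    (fun p : Conf d × Conf d => circulation B p.1 p.2).HasTemperateGrowth := by
  refine HasTemperateGrowth.segmentIntegral (E := Conf d × Conf d)
    (G := fun p : ℝ × (Conf d × Conf d) =>
      ∑ k, vectorPotential B k (p.2.2 + p.1 • (p.2.1 - p.2.2)) * (p.2.1 k - p.2.2 k)) ?_
  have h1 : (fun p : ℝ × (Conf d × Conf d) => p.1).HasTemperateGrowth :=
    (ContinuousLinearMap.fst ℝ ℝ (Conf d × Conf d)).hasTemperateGrowth
  have h2 : (fun p : ℝ × (Conf d × Conf d) => p.2.1).HasTemperateGrowth :=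
    ((ContinuousLinearMap.fst ℝ _ _).comp
      (ContinuousLinearMap.snd ℝ ℝ (Conf d × Conf d))).hasTemperateGrowth
  have h3 : (fun p : ℝ × (Conf d × Conf d) => p.2.2).HasTemperateGrowth :=
    ((ContinuousLinearMap.snd ℝ _ _).comp
      (ContinuousLinearMap.snd ℝ ℝ (Conf d × Conf d))).hasTemperateGrowth
  refine Function.HasTemperateGrowth.sum fun k _ => ?_
  have hp : (fun x : Conf d => x k).HasTemperateGrowth :=
    (EuclideanSpace.proj (𝕜 := ℝ) k).hasTemperateGrowth
  exact ((vectorPotential_hasTemperateGrowth B k).comp (h3.add (h1.smul (h2.sub h3)))).mul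
    ((hp.comp h2).sub (hp.comp h3))

/-- The pair of left positions `(x_L, y_L)` of a point `((x_L, x_R), (y_L, y_R))`. -/
def leftPair (d : ℕ) : SuperPhase d →L[ℝ] Conf d × Conf d :=
  (ContinuousLinearMap.fst ℝ (Conf d) (Conf d)).prodMap
    (ContinuousLinearMap.fst ℝ (Conf d) (Conf d))

/-- The pair of right positions `(x_R, y_R)` of a point `((x_L, x_R), (y_L, y_R))`. -/
def rightPair (d : ℕ) : SuperPhase d →L[ℝ] Conf d × Conf d :=
  (ContinuousLinearMap.snd ℝ (Conf d) (Conf d)).prodMap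
    (ContinuousLinearMap.snd ℝ (Conf d) (Conf d))

theorem superPhaseFactor_hasTemperateGrowth (B : MagneticField d) :
    (superPhaseFactor B).HasTemperateGrowth := by
  have h := circulation_hasTemperateGrowth B
  have hL := h.comp (leftPair d).hasTemperateGrowth
  have hR := h.comp (rightPair d).hasTemperateGrowth
  have hLR := hL.sub hR
  have := hasTemperateGrowth_expI.comp hLR
  exact this
end Model

section Tensor
variable {V W : Type} [NormedAddCommGroup V] [NormedSpace ℝ V]
  [NormedAddCommGroup W] [NormedSpace ℝ W]

theorem tensor_decay (g : 𝓢(V, ℂ)) (f : 𝓢(W, ℂ)) (k n : ℕ) (p : V × W) :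
    ‖p‖ ^ k * ‖iteratedFDeriv ℝ n (fun p : V × W => g p.1 * f p.2) p‖ ≤
      2 ^ n * (2 ^ k * (Finset.Iic (k, n)).sup (schwartzSeminormFamily ℂ V ℂ) g) *
        (2 ^ k * (Finset.Iic (k, n)).sup (schwartzSeminormFamily ℂ W ℂ) f) := by
  have hg : ContDiff ℝ n (fun p : V × W => g p.1) := (g.smooth n).comp contDiff_fst
  have hf : ContDiff ℝ n (fun p : V × W => f p.2) := (f.smooth n).comp contDiff_snd
  have h1 : ∀ i ≤ n, ‖iteratedFDeriv ℝ i (fun p : V × W => g p.1) p‖ ≤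
      ‖iteratedFDeriv ℝ i g p.1‖ := by
    intro i _
    have := (ContinuousLinearMap.fst ℝ V W).iteratedFDeriv_comp_right (g.smooth i) p
      (i := i) le_rfl
    change ‖iteratedFDeriv ℝ i (g ∘ ContinuousLinearMap.fst ℝ V W) p‖ ≤ _
    rw [this]
    refine (ContinuousMultilinearMap.norm_compContinuousLinearMap_le _ _).trans ?_
    refine mul_le_of_le_one_right (norm_nonneg _) ?_
    exact Finset.prod_le_one (fun _ _ => norm_nonneg _)
      fun _ _ => ContinuousLinearMap.norm_fst_le ℝ V W
  have h2 : ∀ i ≤ n, ‖iteratedFDeriv ℝ i (fun p : V × W => f p.2) p‖ ≤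
      ‖iteratedFDeriv ℝ i f p.2‖ := by
    intro i _
    have := (ContinuousLinearMap.snd ℝ V W).iteratedFDeriv_comp_right (f.smooth i) p
      (i := i) le_rfl
    change ‖iteratedFDeriv ℝ i (f ∘ ContinuousLinearMap.snd ℝ V W) p‖ ≤ _
    rw [this]
    refine (ContinuousMultilinearMap.norm_compContinuousLinearMap_le _ _).trans ?_
    refine mul_le_of_le_one_right (norm_nonneg _) ?_
    exact Finset.prod_le_one (fun _ _ => norm_nonneg _)
      fun _ _ => ContinuousLinearMap.norm_snd_le ℝ V W
  have hp : ‖p‖ ^ k ≤ (1 + ‖p.1‖) ^ k * (1 + ‖p.2‖) ^ k := by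
    rw [← mul_pow]
    gcongr
    have h1 := norm_nonneg p.1
    have h2 := norm_nonneg p.2
    have := mul_nonneg h1 h2
    rw [Prod.norm_def]
    rcases max_cases ‖p.1‖ ‖p.2‖ with h | h <;> nlinarith
  have hsum := norm_iteratedFDeriv_mul_le hg hf p (n := n) le_rfl
  calc ‖p‖ ^ k * ‖iteratedFDeriv ℝ n (fun p : V × W => g p.1 * f p.2) p‖
      ≤ ((1 + ‖p.1‖) ^ k * (1 + ‖p.2‖) ^ k) * ∑ i ∈ Finset.range (n + 1), (n.choose i : ℝ) *
        ‖iteratedFDeriv ℝ i (fun p : V × W => g p.1) p‖ *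
          ‖iteratedFDeriv ℝ (n - i) (fun p : V × W => f p.2) p‖ := by gcongr
    _ = ∑ i ∈ Finset.range (n + 1), (n.choose i : ℝ) *
        ((1 + ‖p.1‖) ^ k * ‖iteratedFDeriv ℝ i (fun p : V × W => g p.1) p‖) *
          ((1 + ‖p.2‖) ^ k * ‖iteratedFDeriv ℝ (n - i) (fun p : V × W => f p.2) p‖) := by
        rw [Finset.mul_sum]
        refine Finset.sum_congr rfl fun i _ => by ring
    _ ≤ ∑ i ∈ Finset.range (n + 1), (n.choose i : ℝ) *
        (2 ^ k * (Finset.Iic (k, n)).sup (schwartzSeminormFamily ℂ V ℂ) g) *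
          (2 ^ k * (Finset.Iic (k, n)).sup (schwartzSeminormFamily ℂ W ℂ) f) := by
        refine Finset.sum_le_sum fun i hi => ?_
        have hi' : i ≤ n := Nat.lt_succ_iff.1 (Finset.mem_range.1 hi)
        have a1 := one_add_le_sup_seminorm_apply (𝕜 := ℂ) (m := (k, n)) le_rfl hi' g p.1
        have a2 := one_add_le_sup_seminorm_apply (𝕜 := ℂ) (m := (k, n)) le_rfl
          (Nat.sub_le n i) f p.2
        have b1 := (mul_le_mul_of_nonneg_left (h1 i hi')
          (by positivity : 0 ≤ (1 + ‖p.1‖) ^ k)).trans a1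
        have b2 := (mul_le_mul_of_nonneg_left (h2 (n - i) (Nat.sub_le n i))
          (by positivity : 0 ≤ (1 + ‖p.2‖) ^ k)).trans a2
        have c1 := (by positivity : 0 ≤ (1 + ‖p.1‖) ^ k *
          ‖iteratedFDeriv ℝ i (fun p : V × W => g p.1) p‖)
        have c2 := (by positivity : 0 ≤ (1 + ‖p.2‖) ^ k *
          ‖iteratedFDeriv ℝ (n - i) (fun p : V × W => f p.2) p‖)
        exact mul_le_mul (mul_le_mul_of_nonneg_left b1 (by positivity)) b2 c2
          (mul_nonneg (by positivity) (c1.trans b1))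
    _ = _ := by
        rw [← Finset.sum_mul, ← Finset.sum_mul]
        congr 2
        exact_mod_cast Nat.sum_range_choose n

/-- The tensor product `(g ⊗ f)(x, y) = g(x) f(y)` of two Schwartz functions. -/
def tensor (g : 𝓢(V, ℂ)) (f : 𝓢(W, ℂ)) : 𝓢(V × W, ℂ) where
  toFun p := g p.1 * f p.2
  smooth' := ((g.smooth ⊤).comp contDiff_fst).mul ((f.smooth ⊤).comp contDiff_snd)
  decay' k n := ⟨_, fun p => tensor_decay g f k n p⟩

@[simp] theorem tensor_apply (g : 𝓢(V, ℂ)) (f : 𝓢(W, ℂ)) (p : V × W) :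
    tensor g f p = g p.1 * f p.2 := rfl

/-- The tensor product is linear and continuous in the left factor. -/
def tensorLeft (f : 𝓢(W, ℂ)) : 𝓢(V, ℂ) →L[ℂ] 𝓢(V × W, ℂ) :=
  mkCLM (fun g p => g p.1 * f p.2) (fun _ _ _ => by simp [add_mul])
    (fun _ _ _ => by simp [mul_assoc]) (fun g => (tensor g f).smooth ⊤) fun m =>
    ⟨Finset.Iic m, 2 ^ m.2 * 2 ^ m.1 *
      (2 ^ m.1 * (Finset.Iic m).sup (schwartzSeminormFamily ℂ W ℂ) f), by positivity,
      fun g p => (tensor_decay g f m.1 m.2 p).trans (le_of_eq (by ring))⟩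

@[simp] theorem tensorLeft_apply (g : 𝓢(V, ℂ)) (f : 𝓢(W, ℂ)) :
    tensorLeft f g = tensor g f := rfl

theorem continuous_tensor : Continuous fun p : 𝓢(W, ℂ) × 𝓢(V, ℂ) => tensor p.2 p.1 := by
  have hV := schwartz_withSeminorms ℂ V ℂ
  have hW := schwartz_withSeminorms ℂ W ℂ
  rw [continuous_iff_continuousAt]
  rintro ⟨f₀, g₀⟩
  refine ((schwartz_withSeminorms ℂ (V × W) ℂ).tendsto_nhds _ _).2 fun m ε hε => ?_
  set P := (Finset.Iic m).sup (schwartzSeminormFamily ℂ V ℂ) with hP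
  set Q := (Finset.Iic m).sup (schwartzSeminormFamily ℂ W ℂ) with hQ
  have hPc : Continuous P :=
    Finset.sup_induction (p := fun q : Seminorm ℂ _ => Continuous q) continuous_const
      (fun _ ha _ hb => ha.sup hb) fun i _ => hV.continuous_seminorm i
  have hQc : Continuous Q :=
    Finset.sup_induction (p := fun q : Seminorm ℂ _ => Continuous q) continuous_const
      (fun _ ha _ hb => ha.sup hb) fun i _ => hW.continuous_seminorm i
  have hb : ∀ (g : 𝓢(V, ℂ)) (f : 𝓢(W, ℂ)), schwartzSeminormFamily ℂ (V × W) ℂ m (tensor g f) ≤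
      2 ^ m.2 * (2 ^ m.1 * P g) * (2 ^ m.1 * Q f) := fun g f =>
    SchwartzMap.seminorm_le_bound ℂ m.1 m.2 _ (by positivity) fun p => tensor_decay g f m.1 m.2 p
  let F : 𝓢(W, ℂ) × 𝓢(V, ℂ) → ℝ := fun p =>
    2 ^ m.2 * (2 ^ m.1 * P (p.2 - g₀)) * (2 ^ m.1 * Q (p.1 - f₀)) +
    2 ^ m.2 * (2 ^ m.1 * P g₀) * (2 ^ m.1 * Q (p.1 - f₀)) +
    2 ^ m.2 * (2 ^ m.1 * P (p.2 - g₀)) * (2 ^ m.1 * Q f₀)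
  have hF : Continuous F := by
    have h1 : Continuous fun p : 𝓢(W, ℂ) × 𝓢(V, ℂ) => P (p.2 - g₀) :=
      hPc.comp (continuous_snd.sub continuous_const)
    have h2 : Continuous fun p : 𝓢(W, ℂ) × 𝓢(V, ℂ) => Q (p.1 - f₀) :=
      hQc.comp (continuous_fst.sub continuous_const)
    fun_prop
  have hF0 : F (f₀, g₀) < ε := by simpa [F] using hε
  filter_upwards [hF.continuousAt.eventually_lt_const hF0] with p hp
  refine lt_of_le_of_lt ?_ hp
  have hdec : tensor p.2 p.1 - tensor g₀ f₀ = tensor (p.2 - g₀) (p.1 - f₀) +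
      tensor g₀ (p.1 - f₀) + tensor (p.2 - g₀) f₀ := by
    ext q
    simp only [tensor_apply, add_apply, sub_apply]
    ring
  rw [hdec]
  refine (map_add_le_add _ _ _).trans (add_le_add ((map_add_le_add _ _ _).trans
    (add_le_add (hb _ _) (hb _ _))) (hb _ _))

/-- The space of tempered distributions, with its strong topology (uniform convergence on
bounded sets). -/
abbrev Dist (V : Type) [NormedAddCommGroup V] [NormedSpace ℝ V] : Type :=
  𝓢(V, ℂ) →L[ℂ] ℂ

/-- The operator `S → S'` with distributional kernel `k`: `⟨kernelMap k f, g⟩ = ⟨k, g ⊗ f⟩`.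
For `V = W = ℝ^d` this is the map `int` from kernels to operators, for `V = W = ℝ^{2d}` the map
`Int` from super kernels to operators on kernels. -/
def kernelMap (k : Dist (V × W)) : 𝓢(W, ℂ) →L[ℂ] Dist V :=
  let L : 𝓢(W, ℂ) →ₗ[ℂ] Dist V :=
    { toFun := fun f => k.comp (tensorLeft f)
      map_add' := fun f g => by
        ext h
        have : tensor h (f + g) = tensor h f + tensor h g := by ext p; simp [mul_add]
        simp [this]
      map_smul' := fun c f => by
        ext h
        have : tensor h (c • f) = c • tensor h f := by
          ext p
          simp only [tensor_apply, smul_apply, smul_eq_mul]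
          ring
        simp [this] }
  { L with
    cont := ContinuousLinearMap.continuous_of_continuous_uncurry L
      (k.continuous.comp continuous_tensor) }

@[simp] theorem kernelMap_apply (k : Dist (V × W)) (f : 𝓢(W, ℂ)) (g : 𝓢(V, ℂ)) :
    kernelMap k f g = k (tensor g f) := rfl

section Embedding
variable [MeasureSpace V] [BorelSpace V] [FiniteDimensional ℝ V]
  [(volume : Measure V).HasTemperateGrowth]

/-- The canonical embedding of Schwartz functions into tempered distributions,
`⟨toDist f, g⟩ = ∫ f g`. -/
def toDist : 𝓢(V, ℂ) →L[ℂ] Dist V :=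
  let L : 𝓢(V, ℂ) →ₗ[ℂ] Dist V :=
    { toFun := fun f => (integralCLM ℂ (volume : Measure V)).comp
        (SchwartzMap.pairing (ContinuousLinearMap.mul ℂ ℂ) f)
      map_add' := fun f g => by ext h; simp
      map_smul' := fun c f => by ext h; simp }
  { L with
    cont := ContinuousLinearMap.continuous_of_continuous_uncurry L (by
      have h1 : Continuous fun p : 𝓢(V, ℂ) × 𝓢(V, ℂ) =>
          inner ℂ ((SchwartzMap.postcompCLM (𝕜 := ℝ)
            (Complex.conjCLE : ℂ →L[ℝ] ℂ) p.1).toLp 2 (volume : Measure V))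
            (p.2.toLp 2 (volume : Measure V)) := by
        refine Continuous.inner ?_ (continuous_toLp.comp continuous_snd)
        exact continuous_toLp.comp ((SchwartzMap.postcompCLM (𝕜 := ℝ)
          (Complex.conjCLE : ℂ →L[ℝ] ℂ)).continuous.comp continuous_fst)
      refine h1.congr fun p => ?_
      refine (inner_toL2_toL2_eq _ _ _).trans ?_
      change _ = ∫ x, p.1 x * p.2 x
      refine integral_congr_ae (.of_forall fun x => ?_)
      simp [mul_comm]) }

theorem toDist_apply (f g : 𝓢(V, ℂ)) : toDist f g = ∫ x, f x * g x := rfl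
end Embedding
end Tensor

section PartialFourier
variable {V W : Type} [NormedAddCommGroup V] [NormedSpace ℝ V]
  [NormedAddCommGroup W] [NormedSpace ℝ W] [FiniteDimensional ℝ W]
  [MeasureSpace W] [BorelSpace W] [(volume : Measure W).IsAddHaarMeasure]

/-- The partial Fourier integral `(z, η) ↦ ∫ e^{i β(η, w)} f(z, w) dw`. -/
def oscIntegral {F : Type} [NormedAddCommGroup F] [NormedSpace ℂ F]
    (β : W →L[ℝ] W →L[ℝ] ℝ) (f : V × W → F) (p : V × W) : F :=
  ∫ w, Complex.exp ((β p.2 w : ℂ) * Complex.I) • f (p.1, w)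

theorem norm_slice_le {F : Type} [NormedAddCommGroup F] [NormedSpace ℂ F]
    (f : 𝓢(V × W, F)) (k : ℕ) (z : V) (w : W) :
    ‖z‖ ^ k * ‖f (z, w)‖ ≤
      2 ^ (k + (volume : Measure W).integrablePower) *
        (Finset.Iic (k + (volume : Measure W).integrablePower, 0)).sup
          (schwartzSeminormFamily ℝ (V × W) F) f *
        (1 + ‖w‖) ^ (-((volume : Measure W).integrablePower : ℝ)) := by
  set N := (volume : Measure W).integrablePower
  have h := one_add_le_sup_seminorm_apply (𝕜 := ℝ) (m := (k + N, 0)) le_rfl le_rfl f (z, w)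
  rw [norm_iteratedFDeriv_zero, pow_add] at h
  have hz : ‖z‖ ≤ 1 + ‖(z, w)‖ := (norm_fst_le (z, w)).trans (by simp)
  have hw : 1 + ‖w‖ ≤ 1 + ‖(z, w)‖ := by gcongr; exact norm_snd_le (z, w)
  rw [Real.rpow_neg (by positivity), Real.rpow_natCast, ← div_eq_mul_inv,
    le_div_iff₀ (by positivity)]
  refine le_trans ?_ h
  calc ‖z‖ ^ k * ‖f (z, w)‖ * (1 + ‖w‖) ^ N = ‖z‖ ^ k * (1 + ‖w‖) ^ N * ‖f (z, w)‖ := by ring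
    _ ≤ _ := by gcongr

theorem norm_slice_le' {F : Type} [NormedAddCommGroup F] [NormedSpace ℂ F]
    (f : 𝓢(V × W, F)) : ∃ C : ℝ, ∀ z w,
    ‖f (z, w)‖ ≤ C * (1 + ‖w‖) ^ (-((volume : Measure W).integrablePower : ℝ)) :=
  ⟨_, fun z w => by simpa only [pow_zero, one_mul] using norm_slice_le f 0 z w⟩

theorem integrable_slice {F : Type} [NormedAddCommGroup F] [NormedSpace ℂ F]
    (f : 𝓢(V × W, F)) (z : V) : Integrable fun w => f (z, w) := by
  obtain ⟨C, hC⟩ := norm_slice_le' f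
  refine Integrable.mono' ((Measure.integrable_pow_neg_integrablePower (volume : Measure W)).const_mul C)
    ?_ (.of_forall fun w => hC z w)
  exact (f.continuous.comp (by fun_prop : Continuous fun w : W => (z, w))).aestronglyMeasurable

variable (β : W →L[ℝ] W →L[ℝ] ℝ)

theorem integrable_osc {F : Type} [NormedAddCommGroup F] [NormedSpace ℂ F]
    (f : 𝓢(V × W, F)) (p : V × W) :
    Integrable fun w => Complex.exp ((β p.2 w : ℂ) * Complex.I) • f (p.1, w) := by
  refine Integrable.mono (integrable_slice f p.1) ?_ (.of_forall fun w => ?_)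
  · have : Continuous fun w => Complex.exp ((β p.2 w : ℂ) * Complex.I) := by fun_prop
    exact this.aestronglyMeasurable.smul (integrable_slice f p.1).aestronglyMeasurable
  · rw [norm_smul, Complex.norm_exp_ofReal_mul_I, one_mul]

/-- The operation on integrands which realises the derivative of `oscIntegral β f`. -/
def oscDeriv (F : Type) [NormedAddCommGroup F] [NormedSpace ℂ F] :
    𝓢(V × W, F) →L[ℝ] 𝓢(V × W, V × W →L[ℝ] F) :=
  (SchwartzMap.postcompCLM (𝕜 := ℝ) (ContinuousLinearMap.precomp F
      ((ContinuousLinearMap.inl ℝ V W).comp (ContinuousLinearMap.fst ℝ V W)))).comp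
    (SchwartzMap.fderivCLM ℝ (V × W) F) +
  (Complex.I • SchwartzMap.smulRightCLM ℂ F (β.flip.bilinearComp
    (ContinuousLinearMap.snd ℝ V W) (ContinuousLinearMap.snd ℝ V W))).restrictScalars ℝ

theorem oscDeriv_apply {F : Type} [NormedAddCommGroup F] [NormedSpace ℂ F]
    (f : 𝓢(V × W, F)) (p q : V × W) :
    oscDeriv β F f p q = fderiv ℝ f p (q.1, 0) + Complex.I • (β q.2 p.2 • f p) := by
  simp [oscDeriv]

theorem hasFDerivAt_oscIntegral {F : Type} [NormedAddCommGroup F] [NormedSpace ℂ F]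
    (f : 𝓢(V × W, F)) (p : V × W) :
    HasFDerivAt (oscIntegral β f) (oscIntegral β (oscDeriv β F f) p) p := by
  obtain ⟨C, hC⟩ := norm_slice_le' (oscDeriv β F f)
  have hdiff : ∀ (w : W) (q : V × W), HasFDerivAt
      (fun p : V × W => Complex.exp ((β p.2 w : ℂ) * Complex.I) • f (p.1, w))
      (Complex.exp ((β q.2 w : ℂ) * Complex.I) • oscDeriv β F f (q.1, w)) q := by
    intro w q
    have h1 : HasFDerivAt (fun q : V × W => β q.2 w)
        ((β.flip w).comp (ContinuousLinearMap.snd ℝ V W)) q :=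
      ((β.flip w).comp (ContinuousLinearMap.snd ℝ V W)).hasFDerivAt
    have h2 := ((Complex.ofRealCLM.hasFDerivAt.comp q h1).mul_const Complex.I).cexp
    have h4 : HasFDerivAt (fun q : V × W => ((q.1, w) : V × W))
        ((ContinuousLinearMap.fst ℝ V W).prod 0) q :=
      hasFDerivAt_fst.prodMk (hasFDerivAt_const w q)
    have h3 : HasFDerivAt (fun q : V × W => f (q.1, w)) _ q :=
      (f.hasFDerivAt (q.1, w)).comp q h4
    refine (h2.smul h3).congr_fderiv ?_
    refine ContinuousLinearMap.ext fun r => ?_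
    simp only [add_apply, smul_apply, oscDeriv_apply,
      ContinuousLinearMap.smulRight_apply, ContinuousLinearMap.comp_apply,
      ContinuousLinearMap.prod_apply, zero_apply,
      ContinuousLinearMap.flip_apply, ContinuousLinearMap.coe_fst', ContinuousLinearMap.coe_snd',
      Function.comp_apply, Complex.ofRealCLM_apply, smul_add]
    congr 1
    simp only [← Complex.coe_smul, smul_smul, smul_eq_mul]
  have key := hasFDerivAt_integral_of_dominated_of_fderiv_le (𝕜 := ℝ) (μ := (volume : Measure W))
    (F := fun (p : V × W) w => Complex.exp ((β p.2 w : ℂ) * Complex.I) • f (p.1, w))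
    (F' := fun (p : V × W) w => Complex.exp ((β p.2 w : ℂ) * Complex.I) • oscDeriv β F f (p.1, w))
    (bound := fun w => C * (1 + ‖w‖) ^ (-((volume : Measure W).integrablePower : ℝ)))
    (x₀ := p) (s := Set.univ) Filter.univ_mem
    (.of_forall fun q => (integrable_osc β f q).aestronglyMeasurable)
    (integrable_osc β f p)
    (integrable_osc β (oscDeriv β F f) p).aestronglyMeasurable
    (.of_forall fun w q _ => by
      rw [norm_smul, Complex.norm_exp_ofReal_mul_I, one_mul]
      exact hC q.1 w)
    ((Measure.integrable_pow_neg_integrablePower (volume : Measure W)).const_mul C)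
    (.of_forall fun w q _ => hdiff w q)
  exact key

theorem sup_comp_le {D E F G : Type} [NormedAddCommGroup D] [NormedSpace ℝ D]
    [NormedAddCommGroup E] [NormedSpace ℝ E] [NormedAddCommGroup F] [NormedSpace ℝ F]
    [NormedAddCommGroup G] [NormedSpace ℝ G] (T : 𝓢(D, F) →L[ℝ] 𝓢(E, G)) (s : Finset (ℕ × ℕ)) :
    ∃ (s' : Finset (ℕ × ℕ)) (C : ℝ), 0 ≤ C ∧ ∀ f, s.sup (schwartzSeminormFamily ℝ E G) (T f) ≤
      C * s'.sup (schwartzSeminormFamily ℝ D F) f := by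
  have hc : Continuous fun f => s.sup (schwartzSeminormFamily ℝ E G) f :=
    Finset.sup_induction (p := fun q : Seminorm ℝ _ => Continuous q) continuous_const
      (fun _ ha _ hb => ha.sup hb)
      fun i _ => (schwartz_withSeminorms ℝ E G).continuous_seminorm i
  obtain ⟨s', C, -, h⟩ := Seminorm.bound_of_continuous (schwartz_withSeminorms ℝ D F)
    (Seminorm.comp (s.sup (schwartzSeminormFamily ℝ E G)) T.toLinearMap) (hc.comp T.continuous)
  exact ⟨s', C, C.coe_nonneg, fun f => h f⟩

/-- The derivative in the integration variable. -/
def rightDeriv (V W F : Type) [NormedAddCommGroup V] [NormedSpace ℝ V]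
    [NormedAddCommGroup W] [NormedSpace ℝ W] [NormedAddCommGroup F] [NormedSpace ℂ F] :
    𝓢(V × W, F) →L[ℝ] 𝓢(V × W, W →L[ℝ] F) :=
  (SchwartzMap.postcompCLM (𝕜 := ℝ) (ContinuousLinearMap.precomp F
    (ContinuousLinearMap.inr ℝ V W))).comp (SchwartzMap.fderivCLM ℝ (V × W) F)

theorem oscIntegral_rightDeriv {F : Type} [NormedAddCommGroup F] [NormedSpace ℂ F]
    [CompleteSpace F] (f : 𝓢(V × W, F)) (p : V × W) (h : W) :
    oscIntegral β (rightDeriv V W F f) p h =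
      -((Complex.I * β p.2 h) • oscIntegral β f p) := by
  have hint := integrable_osc β (rightDeriv V W F f) p
  have h0 : oscIntegral β (rightDeriv V W F f) p h = ∫ w,
      Complex.exp ((β p.2 w : ℂ) * Complex.I) • rightDeriv V W F f (p.1, w) h := by
    rw [oscIntegral, ContinuousLinearMap.integral_apply hint]
    rfl
  have hd1 : ∀ w, HasLineDerivAt ℝ (fun w => Complex.exp ((β p.2 w : ℂ) * Complex.I))
      (Complex.exp ((β p.2 w : ℂ) * Complex.I) * (Complex.I * β p.2 h)) w h := by
    intro w
    have h1 : HasFDerivAt (fun w => β p.2 w) (β p.2) w := (β p.2).hasFDerivAt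
    have h2 := ((Complex.ofRealCLM.hasFDerivAt.comp w h1).mul_const Complex.I).cexp
    exact h2.hasLineDerivAt h
  have hd2 : ∀ w, HasLineDerivAt ℝ (fun w => f (p.1, w)) (rightDeriv V W F f (p.1, w) h) w h := by
    intro w
    have h1 : HasFDerivAt (fun w => f (p.1, w)) _ w :=
      (f.hasFDerivAt (p.1, w)).comp w (hasFDerivAt_prodMk_right p.1 w)
    exact h1.hasLineDerivAt h
  have := integral_bilinear_hasLineDerivAt_right_eq_neg_left_of_integrable
    (μ := (volume : Measure W)) (B := (ContinuousLinearMap.lsmul ℝ ℂ : ℂ →L[ℝ] F →L[ℝ] F))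
    (f := fun w => Complex.exp ((β p.2 w : ℂ) * Complex.I)) (g := fun w => f (p.1, w))
    (f' := fun w => Complex.exp ((β p.2 w : ℂ) * Complex.I) * (Complex.I * β p.2 h))
    (g' := fun w => rightDeriv V W F f (p.1, w) h) (v := h)
    (by
      have := (integrable_osc β f p).smul (Complex.I * β p.2 h)
      refine this.congr (.of_forall fun w => ?_)
      simp [smul_smul, mul_comm])
    (by
      have := hint.apply_continuousLinearMap h
      exact this)
    (integrable_osc β f p) (fun w _ => hd1 w) (fun w _ => hd2 w)
  rw [h0]
  refine this.trans ?_
  rw [oscIntegral, ← integral_smul]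
  congr 1
  refine integral_congr_ae (.of_forall fun w => ?_)
  simp [smul_smul, mul_comm]

theorem norm_mul_oscIntegral_le {F : Type} [NormedAddCommGroup F] [NormedSpace ℂ F]
    [CompleteSpace F] (hβ : ∀ η, ‖η‖ ≤ ‖β η‖) (f : 𝓢(V × W, F)) (p : V × W) :
    ‖p.2‖ * ‖oscIntegral β f p‖ ≤ ‖oscIntegral β (rightDeriv V W F f) p‖ := by
  rcases eq_or_ne ‖oscIntegral β f p‖ 0 with h | h
  · simp [h]
  have hpos : 0 < ‖oscIntegral β f p‖ := lt_of_le_of_ne (norm_nonneg _) h.symm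
  rw [← le_div_iff₀ hpos]
  refine (hβ _).trans (ContinuousLinearMap.opNorm_le_bound _ (by positivity) fun w => ?_)
  rw [div_mul_eq_mul_div, le_div_iff₀ hpos]
  have := ContinuousLinearMap.le_opNorm (oscIntegral β (rightDeriv V W F f) p) w
  rw [oscIntegral_rightDeriv] at this
  simpa [norm_smul] using this

theorem oscIntegral_bound_zero (hβ : ∀ η, ‖η‖ ≤ ‖β η‖) (k : ℕ) :
    ∀ (F : Type) [NormedAddCommGroup F] [NormedSpace ℂ F] [CompleteSpace F],
    ∃ (s : Finset (ℕ × ℕ)) (C : ℝ), 0 ≤ C ∧ ∀ (f : 𝓢(V × W, F)) (p : V × W),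
      ‖p‖ ^ k * ‖oscIntegral β f p‖ ≤ C * s.sup (schwartzSeminormFamily ℝ (V × W) F) f := by
  have hfst : ∀ k : ℕ, ∀ (F : Type) [NormedAddCommGroup F] [NormedSpace ℂ F],
    ∃ (s : Finset (ℕ × ℕ)) (C : ℝ), 0 ≤ C ∧ ∀ (f : 𝓢(V × W, F)) (p : V × W),
      ‖p.1‖ ^ k * ‖oscIntegral β f p‖ ≤ C * s.sup (schwartzSeminormFamily ℝ (V × W) F) f := by
    intro k F _ _
    set N := (volume : Measure W).integrablePower
    refine ⟨Finset.Iic (k + N, 0), 2 ^ (k + N) * ∫ w : W, (1 + ‖w‖) ^ (-(N : ℝ)),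
      by positivity, fun f p => ?_⟩
    have hi := (Measure.integrable_pow_neg_integrablePower (volume : Measure W)).const_mul
      (2 ^ (k + N) * (Finset.Iic (k + N, 0)).sup (schwartzSeminormFamily ℝ (V × W) F) f)
    calc ‖p.1‖ ^ k * ‖oscIntegral β f p‖
        = ‖∫ w, (‖p.1‖ ^ k) • Complex.exp ((β p.2 w : ℂ) * Complex.I) • f (p.1, w)‖ := by
          rw [integral_smul, norm_smul]
          simp [oscIntegral]
      _ ≤ ∫ w, 2 ^ (k + N) * (Finset.Iic (k + N, 0)).sup (schwartzSeminormFamily ℝ (V × W) F) f *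
            (1 + ‖w‖) ^ (-(N : ℝ)) := by
          refine norm_integral_le_of_norm_le hi (.of_forall fun w => ?_)
          rw [norm_smul, norm_smul, Complex.norm_exp_ofReal_mul_I, one_mul]
          simpa using norm_slice_le f k p.1 w
      _ = _ := by rw [integral_const_mul]; ring
  have hsnd : ∀ k : ℕ, ∀ (F : Type) [NormedAddCommGroup F] [NormedSpace ℂ F] [CompleteSpace F],
    ∃ (s : Finset (ℕ × ℕ)) (C : ℝ), 0 ≤ C ∧ ∀ (f : 𝓢(V × W, F)) (p : V × W),
      ‖p.2‖ ^ k * ‖oscIntegral β f p‖ ≤ C * s.sup (schwartzSeminormFamily ℝ (V × W) F) f := by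
    intro k
    induction k with
    | zero =>
      intro F _ _ _
      simpa using hfst 0 F
    | succ k ih =>
      intro F _ _ _
      obtain ⟨s, C, hC, h⟩ := ih (W →L[ℝ] F)
      obtain ⟨s', C', hC', h'⟩ := sup_comp_le (rightDeriv V W F) s
      refine ⟨s', C * C', by positivity, fun f p => ?_⟩
      calc ‖p.2‖ ^ (k + 1) * ‖oscIntegral β f p‖
          = ‖p.2‖ ^ k * (‖p.2‖ * ‖oscIntegral β f p‖) := by ring
        _ ≤ ‖p.2‖ ^ k * ‖oscIntegral β (rightDeriv V W F f) p‖ := by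
            gcongr; exact norm_mul_oscIntegral_le β hβ f p
        _ ≤ C * s.sup (schwartzSeminormFamily ℝ (V × W) (W →L[ℝ] F)) (rightDeriv V W F f) := h _ p
        _ ≤ C * (C' * s'.sup (schwartzSeminormFamily ℝ (V × W) F) f) := by gcongr; exact h' f
        _ = _ := by ring
  intro F _ _ _
  obtain ⟨s₁, C₁, hC₁, h₁⟩ := hfst k F
  obtain ⟨s₂, C₂, hC₂, h₂⟩ := hsnd k F
  refine ⟨s₁ ∪ s₂, C₁ + C₂, by positivity, fun f p => ?_⟩
  have e1 : s₁.sup (schwartzSeminormFamily ℝ (V × W) F) f ≤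
      (s₁ ∪ s₂).sup (schwartzSeminormFamily ℝ (V × W) F) f :=
    (Finset.sup_mono Finset.subset_union_left :
      s₁.sup (schwartzSeminormFamily ℝ (V × W) F) ≤
        (s₁ ∪ s₂).sup (schwartzSeminormFamily ℝ (V × W) F)) f
  have e2 : s₂.sup (schwartzSeminormFamily ℝ (V × W) F) f ≤
      (s₁ ∪ s₂).sup (schwartzSeminormFamily ℝ (V × W) F) f :=
    (Finset.sup_mono Finset.subset_union_right :
      s₂.sup (schwartzSeminormFamily ℝ (V × W) F) ≤
        (s₁ ∪ s₂).sup (schwartzSeminormFamily ℝ (V × W) F)) f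
  have hp : ‖p‖ ^ k ≤ ‖p.1‖ ^ k + ‖p.2‖ ^ k := by
    have h1 : 0 ≤ ‖p.1‖ ^ k := by positivity
    have h2 : 0 ≤ ‖p.2‖ ^ k := by positivity
    rw [Prod.norm_def]
    rcases max_cases ‖p.1‖ ‖p.2‖ with h | h <;> rw [h.1] <;> linarith
  calc ‖p‖ ^ k * ‖oscIntegral β f p‖
      ≤ (‖p.1‖ ^ k + ‖p.2‖ ^ k) * ‖oscIntegral β f p‖ := by gcongr
    _ = ‖p.1‖ ^ k * ‖oscIntegral β f p‖ + ‖p.2‖ ^ k * ‖oscIntegral β f p‖ := by ring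
    _ ≤ C₁ * (s₁ ∪ s₂).sup (schwartzSeminormFamily ℝ (V × W) F) f +
        C₂ * (s₁ ∪ s₂).sup (schwartzSeminormFamily ℝ (V × W) F) f := by
        refine add_le_add ((h₁ f p).trans ?_) ((h₂ f p).trans ?_) <;> gcongr
    _ = _ := by ring

theorem oscIntegral_bound (hβ : ∀ η, ‖η‖ ≤ ‖β η‖) (k n : ℕ) :
    ∀ (F : Type) [NormedAddCommGroup F] [NormedSpace ℂ F] [CompleteSpace F],
    (∀ f : 𝓢(V × W, F), ContDiff ℝ n (oscIntegral β f)) ∧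
    ∃ (s : Finset (ℕ × ℕ)) (C : ℝ), 0 ≤ C ∧ ∀ (f : 𝓢(V × W, F)) (p : V × W),
      ‖p‖ ^ k * ‖iteratedFDeriv ℝ n (oscIntegral β f) p‖ ≤
        C * s.sup (schwartzSeminormFamily ℝ (V × W) F) f := by
  induction n with
  | zero =>
    intro F _ _ _
    refine ⟨fun f => contDiff_zero.2 (continuous_iff_continuousAt.2 fun p =>
      (hasFDerivAt_oscIntegral β f p).continuousAt), ?_⟩
    simpa only [norm_iteratedFDeriv_zero] using oscIntegral_bound_zero β hβ k F
  | succ n ih =>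
    intro F _ _ _
    obtain ⟨h1, s, C, hC, h2⟩ := ih (V × W →L[ℝ] F)
    obtain ⟨s', C', hC', h'⟩ := sup_comp_le (oscDeriv (V := V) β F) s
    have hfd : ∀ f : 𝓢(V × W, F), fderiv ℝ (oscIntegral β f) = oscIntegral β (oscDeriv β F f) :=
      fun f => funext fun p => (hasFDerivAt_oscIntegral β f p).fderiv
    refine ⟨fun f => ?_, s', C * C', by positivity, fun f p => ?_⟩
    · push_cast
      refine contDiff_succ_iff_fderiv.2 ⟨fun p =>
        (hasFDerivAt_oscIntegral β f p).differentiableAt, by simp, ?_⟩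
      rw [hfd]; exact h1 _
    · rw [← norm_iteratedFDeriv_fderiv, hfd]
      refine (h2 _ p).trans ?_
      rw [mul_assoc]
      gcongr
      exact h' f

/-- The partial Fourier integral `(z, η) ↦ ∫ e^{i β(η, w)} f(z, w) dw`, for a nondegenerate form
`β`, as a continuous linear operator on Schwartz functions. -/
def partialFourier (hβ : ∀ η, ‖η‖ ≤ ‖β η‖) : 𝓢(V × W, ℂ) →L[ℂ] 𝓢(V × W, ℂ) :=
  mkCLM (fun f => oscIntegral β f)
    (fun f g p => by
      rw [oscIntegral, oscIntegral, oscIntegral,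
        ← integral_add (integrable_osc β f p) (integrable_osc β g p)]
      simp [mul_add])
    (fun a f p => by
      rw [oscIntegral, oscIntegral, RingHom.id_apply, ← integral_smul]
      congr 1
      ext w
      simp only [smul_apply, smul_eq_mul]
      ring)
    (fun f => contDiff_infty.2 fun n => (oscIntegral_bound (V := V) β hβ 0 n ℂ).1 f)
    (fun m => by
      obtain ⟨s, C, hC, h⟩ := (oscIntegral_bound (V := V) β hβ m.1 m.2 ℂ).2
      refine ⟨s, C, hC, fun f p => (h f p).trans (le_of_eq ?_)⟩
      rw [Seminorm.finset_sup_apply, Seminorm.finset_sup_apply]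
      rfl)

theorem partialFourier_apply (hβ : ∀ η, ‖η‖ ≤ ‖β η‖) (f : 𝓢(V × W, ℂ)) (p : V × W) :
    partialFourier β hβ f p = ∫ w, Complex.exp ((β p.2 w : ℂ) * Complex.I) * f (p.1, w) := rfl

end PartialFourier

section SuperWeylTransform
variable {d : ℕ}

instance instIsAddHaarMeasureVolumeProd {V W : Type} [NormedAddCommGroup V] [NormedSpace ℝ V]
    [MeasureSpace V] [BorelSpace V] [FiniteDimensional ℝ V]
    [(volume : Measure V).IsAddHaarMeasure] [NormedAddCommGroup W] [NormedSpace ℝ W]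
    [MeasureSpace W] [BorelSpace W] [FiniteDimensional ℝ W]
    [(volume : Measure W).IsAddHaarMeasure] :
    (volume : Measure (V × W)).IsAddHaarMeasure :=
  inferInstanceAs (((volume : Measure V).prod (volume : Measure W)).IsAddHaarMeasure)

instance : (volume : Measure (Phase d)).IsAddHaarMeasure := instIsAddHaarMeasureVolumeProd

instance : (volume : Measure (SuperPhase d)).IsAddHaarMeasure := instIsAddHaarMeasureVolumeProd

/-- The bilinear form `(ξ_L, ξ_R), (w_L, w_R) ↦ ξ_L · w_L - ξ_R · w_R`. -/
def leftRightForm (d : ℕ) : (Conf d × Conf d) →L[ℝ] (Conf d × Conf d) →L[ℝ] ℝ :=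
  (innerSL ℝ).bilinearComp (ContinuousLinearMap.fst ℝ (Conf d) (Conf d))
      (ContinuousLinearMap.fst ℝ (Conf d) (Conf d)) -
    (innerSL ℝ).bilinearComp (ContinuousLinearMap.snd ℝ (Conf d) (Conf d))
      (ContinuousLinearMap.snd ℝ (Conf d) (Conf d))

theorem leftRightForm_apply (ξ w : Conf d × Conf d) :
    leftRightForm d ξ w = inner ℝ ξ.1 w.1 - inner ℝ ξ.2 w.2 := rfl

theorem le_norm_leftRightForm (ξ : Conf d × Conf d) : ‖ξ‖ ≤ ‖leftRightForm d ξ‖ := by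
  have h1 := (leftRightForm d ξ).le_opNorm (ξ.1, 0)
  have h2 := (leftRightForm d ξ).le_opNorm (0, ξ.2)
  simp only [leftRightForm_apply, inner_zero_right, sub_zero, zero_sub, norm_neg,
    real_inner_self_eq_norm_sq, norm_pow, norm_norm, Prod.norm_mk, norm_zero] at h1 h2
  rw [max_eq_left (norm_nonneg _)] at h1
  rw [max_eq_right (norm_nonneg _)] at h2
  have key : ∀ a b : ℝ, 0 ≤ a → 0 ≤ b → a ^ 2 ≤ b * a → a ≤ b := by
    intro a b ha hb h
    rcases ha.eq_or_lt with rfl | ha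
    · exact hb
    · exact le_of_mul_le_mul_right (by rwa [← sq]) ha
  exact max_le (key _ _ (norm_nonneg _) (norm_nonneg _) h1)
    (key _ _ (norm_nonneg _) (norm_nonneg _) h2)

/-- The change of variables `(X, Y) ↦ ((X + Y) / 2, X - Y)`. -/
def midpointEquiv (V : Type) [NormedAddCommGroup V] [NormedSpace ℝ V] :
    (V × V) ≃L[ℝ] V × V :=
  ContinuousLinearEquiv.equivOfInverse
    (((1 / 2 : ℝ) • (ContinuousLinearMap.fst ℝ V V + ContinuousLinearMap.snd ℝ V V)).prod
      (ContinuousLinearMap.fst ℝ V V - ContinuousLinearMap.snd ℝ V V))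
    ((ContinuousLinearMap.fst ℝ V V + (1 / 2 : ℝ) • ContinuousLinearMap.snd ℝ V V).prod
      (ContinuousLinearMap.fst ℝ V V - (1 / 2 : ℝ) • ContinuousLinearMap.snd ℝ V V))
    (fun p => by ext1 <;> simp <;> module)
    (fun p => by ext1 <;> simp <;> module)

/-- The magnetic super Weyl transform `K^A` on Schwartz functions; `superWeylSchwartz_apply`
is the explicit formula for it. -/
def superWeylSchwartz (B : MagneticField d) :
    𝓢(SuperPhase d, ℂ) →L[ℂ] 𝓢(SuperPhase d, ℂ) :=
  (((2 * Real.pi) ^ (2 * d))⁻¹ : ℂ) •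
    (SchwartzMap.bilinLeftCLM (ContinuousLinearMap.mul ℂ ℂ)
        (superPhaseFactor_hasTemperateGrowth B)).comp
      ((SchwartzMap.compCLMOfContinuousLinearEquiv ℂ (midpointEquiv (Conf d × Conf d))).comp
        ((partialFourier (leftRightForm d) le_norm_leftRightForm).comp
          (SchwartzMap.compCLMOfContinuousLinearEquiv ℂ
            (ContinuousLinearEquiv.prodProdProdComm ℝ (Conf d) (Conf d) (Conf d) (Conf d)))))

theorem superWeylSchwartz_apply (B : MagneticField d) (Φ : 𝓢(SuperPhase d, ℂ))
    (xL xR yL yR : Conf d) :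
    superWeylSchwartz B Φ ((xL, xR), (yL, yR)) = ((2 * Real.pi) ^ (2 * d) : ℂ)⁻¹ *
      ∫ ξ : Conf d × Conf d,
        Complex.exp (((inner ℝ ξ.1 (xL - yL) - inner ℝ ξ.2 (xR - yR) : ℝ) : ℂ) * Complex.I) *
        Complex.exp (((circulation B xL yL - circulation B xR yR : ℝ) : ℂ) * Complex.I) *
        Φ (((1 / 2 : ℝ) • (xL + yL), ξ.1), ((1 / 2 : ℝ) • (xR + yR), ξ.2)) := by
  have h : superWeylSchwartz B Φ ((xL, xR), (yL, yR)) = ((2 * Real.pi) ^ (2 * d) : ℂ)⁻¹ *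
      ((∫ ξ : Conf d × Conf d,
        Complex.exp (((leftRightForm d (xL - yL, xR - yR) ξ : ℝ) : ℂ) * Complex.I) *
          Φ (((1 / 2 : ℝ) • (xL + yL), ξ.1), ((1 / 2 : ℝ) • (xR + yR), ξ.2))) *
        superPhaseFactor B ((xL, xR), (yL, yR))) := rfl
  rw [h, ← integral_mul_const]
  congr 1
  refine integral_congr_ae (.of_forall fun ξ => ?_)
  simp only [leftRightForm_apply, superPhaseFactor, real_inner_comm ξ.1, real_inner_comm ξ.2]
  ring

/-- The formal transpose of `K^A` on Schwartz functions, that is `∫ (K^A Φ) χ = ∫ Φ (K^A)ᵗ χ`.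
The substitution `x = z + w / 2`, `y = z - w / 2` in the formula for `K^A` gives the explicit
formula `superWeylTranspose_apply`. -/
def superWeylTranspose (B : MagneticField d) :
    𝓢(SuperPhase d, ℂ) →L[ℂ] 𝓢(SuperPhase d, ℂ) :=
  (((2 * Real.pi) ^ (2 * d))⁻¹ : ℂ) •
    (SchwartzMap.compCLMOfContinuousLinearEquiv ℂ
        (ContinuousLinearEquiv.prodProdProdComm ℝ (Conf d) (Conf d) (Conf d) (Conf d))).comp
      ((partialFourier (leftRightForm d) le_norm_leftRightForm).comp
        ((SchwartzMap.compCLMOfContinuousLinearEquiv ℂ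
            (midpointEquiv (Conf d × Conf d)).symm).comp
          (SchwartzMap.bilinLeftCLM (ContinuousLinearMap.mul ℂ ℂ)
            (superPhaseFactor_hasTemperateGrowth B))))

theorem superWeylTranspose_apply (B : MagneticField d) (χ : 𝓢(SuperPhase d, ℂ))
    (zL ξL zR ξR : Conf d) :
    superWeylTranspose B χ ((zL, ξL), (zR, ξR)) = ((2 * Real.pi) ^ (2 * d) : ℂ)⁻¹ *
      ∫ w : Conf d × Conf d,
        Complex.exp (((inner ℝ ξL w.1 - inner ℝ ξR w.2 : ℝ) : ℂ) * Complex.I) *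
        (χ ((zL + (1 / 2 : ℝ) • w.1, zR + (1 / 2 : ℝ) • w.2),
            (zL - (1 / 2 : ℝ) • w.1, zR - (1 / 2 : ℝ) • w.2)) *
         superPhaseFactor B ((zL + (1 / 2 : ℝ) • w.1, zR + (1 / 2 : ℝ) • w.2),
            (zL - (1 / 2 : ℝ) • w.1, zR - (1 / 2 : ℝ) • w.2))) := rfl

/-- The magnetic super Weyl transform `K^A` on tempered distributions,
`⟨K^A Φ, χ⟩ = ⟨Φ, (K^A)ᵗ χ⟩`. -/
def superWeylTransform (B : MagneticField d) :
    Dist (SuperPhase d) →L[ℂ] Dist (SuperPhase d) :=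
  ContinuousLinearMap.precomp ℂ (superWeylTranspose B)

theorem superWeylTransform_apply (B : MagneticField d) (Φ : Dist (SuperPhase d))
    (χ : 𝓢(SuperPhase d, ℂ)) :
    superWeylTransform B Φ χ = Φ (superWeylTranspose B χ) := rfl
end SuperWeylTransform

section SuperOperators
variable {d : ℕ}

/-- The operators in `B(S(ℝ^d), S'(ℝ^d))`. -/
abbrev TemperedOp (d : ℕ) : Type := 𝓢(Conf d, ℂ) →L[ℂ] Dist (Conf d)

/-- The smoothing operators `B(S'(ℝ^d), S(ℝ^d))`. -/
abbrev SmoothingOp (d : ℕ) : Type := Dist (Conf d) →L[ℂ] 𝓢(Conf d, ℂ)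

/-- A smoothing operator, restricted to `S ⊆ S'` and with values regarded in `S' ⊇ S`. -/
def SmoothingOp.toTempered (T : SmoothingOp d) : TemperedOp d :=
  toDist.comp (T.comp toDist)

/-- The inverse of `int : S'(ℝ^{2d}) → B(S(ℝ^d), S'(ℝ^d))`, which is a bijection by the kernel
theorem: the distributional kernel of an operator. -/
def operatorKernel (R : TemperedOp d) : Dist (Conf d × Conf d) :=
  Function.invFun (fun k : Dist (Conf d × Conf d) => (kernelMap k : TemperedOp d)) R

/-- The Schwartz kernel `int⁻¹(T) ∈ S(ℝ^{2d})` of a smoothing operator `T`: the operators in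
`B(S', S)` are exactly those with a kernel in `S(ℝ^{2d})`. -/
def smoothingKernel (T : SmoothingOp d) : 𝓢(Conf d × Conf d, ℂ) :=
  Function.invFun (fun t : 𝓢(Conf d × Conf d, ℂ) => (kernelMap (toDist t) : TemperedOp d))
    (SmoothingOp.toTempered T)

/-- The magnetic super Weyl quantization `Op^A(Φ) = int ∘ Int(K^A Φ) ∘ int⁻¹` of a tempered
distribution `Φ`, as a map from the smoothing operators to `B(S, S')`. -/
def superOp (B : MagneticField d) (Φ : Dist (SuperPhase d)) (T : SmoothingOp d) : TemperedOp d :=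
  kernelMap (kernelMap (superWeylTransform B Φ) (smoothingKernel T))

/-- The slice `Y ↦ κ(X, Y)` of a Schwartz function. -/
def slice {V W : Type} [NormedAddCommGroup V] [NormedSpace ℝ V] [NormedAddCommGroup W]
    [NormedSpace ℝ W] (κ : 𝓢(V × W, ℂ)) (X : V) : 𝓢(W, ℂ) :=
  SchwartzMap.compCLMOfAntilipschitz ℂ (K := 1) (g := fun Y : W => ((X, Y) : V × W))
    (by
      have h := (Function.HasTemperateGrowth.const (E := W) ((X, 0) : V × W)).add
        (ContinuousLinearMap.inr ℝ V W).hasTemperateGrowth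
      convert h using 1
      ext Y <;> simp)
    (AntilipschitzWith.of_le_mul_dist fun x y => by simp [Prod.dist_eq]) κ

theorem slice_apply {V W : Type} [NormedAddCommGroup V] [NormedSpace ℝ V] [NormedAddCommGroup W]
    [NormedSpace ℝ W] (κ : 𝓢(V × W, ℂ)) (X : V) (Y : W) : slice κ X Y = κ (X, Y) := rfl

/-- For a Schwartz function `Ψ`, the super operator `Op^A(Ψ) = int ∘ Int(K^A Ψ) ∘ int⁻¹` maps all
of `B(S, S')` into the smoothing operators. The predicate says that `Q = Op^A(Ψ) R`: the kernel of
`Q` at `X = (x_L, x_R)` is `⟨int⁻¹(R), (K^A Ψ)(X, ·)⟩`. -/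
def IsSuperOpImage (B : MagneticField d) (Ψ : 𝓢(SuperPhase d, ℂ)) (R : TemperedOp d)
    (Q : SmoothingOp d) : Prop :=
  ∀ X, smoothingKernel Q X = operatorKernel R (slice (superWeylSchwartz B Ψ) X)

/-- `Θ = Φ # Ψ` is the magnetic super Weyl product `(Op^A)⁻¹(Op^A(Φ) Op^A(Ψ))`: the super operator
`Op^A(Ψ)` maps smoothing operators to smoothing operators, so that the composition
`Op^A(Φ) Op^A(Ψ)` makes sense, and `Op^A(Θ) = Op^A(Φ) Op^A(Ψ)`. -/
def IsSuperWeylProduct (B : MagneticField d) (Φ Ψ Θ : Dist (SuperPhase d)) : Prop :=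
  ∀ T : SmoothingOp d, ∃ R : SmoothingOp d,
    superOp B Ψ T = R.toTempered ∧ superOp B Θ T = superOp B Φ R

/-- `Θ = Ψ # Φ` is the magnetic super Weyl product `(Op^A)⁻¹(Op^A(Ψ) Op^A(Φ))` of a Schwartz
function `Ψ` and a tempered distribution `Φ`; here `Op^A(Φ)` takes values in `B(S, S')`, and
`Op^A(Ψ)` maps `B(S, S')` to the smoothing operators. -/
def IsSchwartzSuperWeylProduct (B : MagneticField d) (Ψ : 𝓢(SuperPhase d, ℂ))
    (Φ Θ : Dist (SuperPhase d)) : Prop :=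
  ∀ T : SmoothingOp d, ∃ Q : SmoothingOp d,
    IsSuperOpImage B Ψ (superOp B Φ T) Q ∧ superOp B Θ T = Q.toTempered

/-- The magnetic super Moyal algebra: the tempered distributions `Φ` such that `Φ # Ψ` and `Ψ # Φ`
are Schwartz functions for every Schwartz function `Ψ`. -/
def superMoyalAlgebra (B : MagneticField d) : Set (Dist (SuperPhase d)) :=
  {Φ | ∀ Ψ : 𝓢(SuperPhase d, ℂ),
    (∃ Θ : 𝓢(SuperPhase d, ℂ), IsSuperWeylProduct B Φ (toDist Ψ) (toDist Θ)) ∧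
    (∃ Θ : 𝓢(SuperPhase d, ℂ), IsSchwartzSuperWeylProduct B Ψ Φ (toDist Θ))}

end SuperOperators

section HormanderClasses
variable {d : ℕ}

/-- The bracket `⟨v⟩ = √(1 + |v|²)` on `ℝ^{4d}`, `|v|` being the Euclidean norm. -/
def bracket (v : SuperPhase d) : ℝ :=
  √(1 + (‖v.1.1‖ ^ 2 + ‖v.1.2‖ ^ 2 + ‖v.2.1‖ ^ 2 + ‖v.2.2‖ ^ 2))

theorem bracket_pos (v : SuperPhase d) : 0 < bracket v := Real.sqrt_pos.2 (by positivity)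

theorem bracket_le (v : SuperPhase d) : bracket v ≤ 2 * (1 + ‖v‖) := by
  have h1 := (norm_fst_le v.1).trans (norm_fst_le v)
  have h2 := (norm_snd_le v.1).trans (norm_fst_le v)
  have h3 := (norm_fst_le v.2).trans (norm_snd_le v)
  have h4 := (norm_snd_le v.2).trans (norm_snd_le v)
  refine Real.sqrt_le_iff.2 ⟨by positivity, ?_⟩
  have e : ∀ a : ℝ, 0 ≤ a → a ≤ ‖v‖ → a ^ 2 ≤ ‖v‖ ^ 2 := fun a ha h => by gcongr
  have := e _ (norm_nonneg _) h1
  have := e _ (norm_nonneg _) h2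
  have := e _ (norm_nonneg _) h3
  have := e _ (norm_nonneg _) h4
  nlinarith [norm_nonneg v]

/-- A tempered weight on `ℝ^{4d}`: a positive function `M` such that
`M(X + Y) ≤ C M(X) ⟨Y⟩^a` for some `a, C > 0`. -/
structure TemperedWeight (d : ℕ) where
  /-- the function `M` -/
  toFun : SuperPhase d → ℝ
  pos : ∀ X, 0 < toFun X
  tempered : ∃ a C : ℝ, 0 < a ∧ 0 < C ∧ ∀ X Y, toFun (X + Y) ≤ C * toFun X * bracket Y ^ a

/-- The pointwise product of tempered weights. -/
def TemperedWeight.mul (M₁ M₂ : TemperedWeight d) : TemperedWeight d where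
  toFun X := M₁.toFun X * M₂.toFun X
  pos X := mul_pos (M₁.pos X) (M₂.pos X)
  tempered := by
    obtain ⟨a, C, ha, hC, h⟩ := M₁.tempered
    obtain ⟨a', C', ha', hC', h'⟩ := M₂.tempered
    refine ⟨a + a', C * C', by positivity, by positivity, fun X Y => ?_⟩
    rw [Real.rpow_add (bracket_pos Y)]
    have hb := Real.rpow_pos_of_pos (bracket_pos Y) a
    have hX := M₁.pos X
    calc M₁.toFun (X + Y) * M₂.toFun (X + Y)
        ≤ (C * M₁.toFun X * bracket Y ^ a) * (C' * M₂.toFun X * bracket Y ^ a') :=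
          mul_le_mul (h X Y) (h' X Y) (M₂.pos _).le (by positivity)
      _ = _ := by ring

theorem iteratedFDeriv_add_le {Φ Ψ : SuperPhase d → ℂ} (hΦ : ContDiff ℝ ∞ Φ)
    (hΨ : ContDiff ℝ ∞ Ψ) (n : ℕ) (X : SuperPhase d) :
    ‖iteratedFDeriv ℝ n (Φ + Ψ) X‖ ≤ ‖iteratedFDeriv ℝ n Φ X‖ + ‖iteratedFDeriv ℝ n Ψ X‖ := by
  rw [iteratedFDeriv_add_apply (hΦ.contDiffAt.of_le (by exact_mod_cast le_top))
    (hΨ.contDiffAt.of_le (by exact_mod_cast le_top))]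
  exact norm_add_le _ _

theorem iteratedFDeriv_smul_eq {Φ : SuperPhase d → ℂ} (hΦ : ContDiff ℝ ∞ Φ) (c : ℂ) (n : ℕ)
    (X : SuperPhase d) :
    ‖iteratedFDeriv ℝ n (c • Φ) X‖ = ‖c‖ * ‖iteratedFDeriv ℝ n Φ X‖ := by
  rw [iteratedFDeriv_const_smul_apply (hΦ.contDiffAt.of_le (by exact_mod_cast le_top)), norm_smul]

/-- The Hörmander super class `S_0(M)` as a space of functions: the smooth functions `Φ` such that
`M⁻¹ |∂^γ Φ|` is bounded for every multi-index `γ`. The norm of the `n`-th iterated derivative is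
equivalent to the maximum of the absolute values of the partial derivatives of order `n`. -/
def superClass (M : TemperedWeight d) : Submodule ℂ (SuperPhase d → ℂ) where
  carrier := {Φ | ContDiff ℝ ∞ Φ ∧ ∀ n : ℕ,
    BddAbove (Set.range fun X => (M.toFun X)⁻¹ * ‖iteratedFDeriv ℝ n Φ X‖)}
  zero_mem' := ⟨contDiff_const, fun n => ⟨0, by
    rintro _ ⟨X, rfl⟩
    simp [show (0 : SuperPhase d → ℂ) = fun _ => 0 from rfl]⟩⟩
  add_mem' := by
    rintro Φ Ψ ⟨hΦ, bΦ⟩ ⟨hΨ, bΨ⟩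
    refine ⟨hΦ.add hΨ, fun n => ?_⟩
    obtain ⟨C, hC⟩ := bΦ n
    obtain ⟨C', hC'⟩ := bΨ n
    refine ⟨C + C', ?_⟩
    rintro _ ⟨X, rfl⟩
    have hM := inv_pos.2 (M.pos X)
    have h1 := hC ⟨X, rfl⟩
    have h2 := hC' ⟨X, rfl⟩
    have h3 := mul_le_mul_of_nonneg_left (iteratedFDeriv_add_le hΦ hΨ n X) hM.le
    simp only [] at h1 h2 ⊢
    linarith
  smul_mem' := by
    rintro c Φ ⟨hΦ, bΦ⟩
    refine ⟨hΦ.const_smul c, fun n => ?_⟩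
    obtain ⟨C, hC⟩ := bΦ n
    refine ⟨‖c‖ * C, ?_⟩
    rintro _ ⟨X, rfl⟩
    have h1 := mul_le_mul_of_nonneg_left (hC ⟨X, rfl⟩) (norm_nonneg c)
    simp only [iteratedFDeriv_smul_eq hΦ] at h1 ⊢
    linarith

/-- `S_0(M)` as a type. -/
def SuperClass (M : TemperedWeight d) : Type := superClass M

namespace SuperClass
variable {M : TemperedWeight d}

instance : AddCommGroup (SuperClass M) := inferInstanceAs (AddCommGroup (superClass M))
instance : Module ℂ (SuperClass M) := inferInstanceAs (Module ℂ (superClass M))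

/-- The underlying function of an element of `S_0(M)`. -/
def fn (Φ : SuperClass M) : SuperPhase d → ℂ := Φ.1

theorem fn_smooth (Φ : SuperClass M) : ContDiff ℝ ∞ Φ.fn := Φ.2.1

theorem le_iSup (Φ : SuperClass M) (n : ℕ) (X : SuperPhase d) :
    (M.toFun X)⁻¹ * ‖iteratedFDeriv ℝ n Φ.fn X‖ ≤
      ⨆ X, (M.toFun X)⁻¹ * ‖iteratedFDeriv ℝ n Φ.fn X‖ :=
  _root_.le_ciSup (Φ.2.2 n) X

variable (M) in
/-- The seminorms `Φ ↦ sup_X M(X)⁻¹ ‖D^n Φ(X)‖` of `S_0(M)`. -/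
def seminorm (n : ℕ) : Seminorm ℂ (SuperClass M) :=
  Seminorm.of (fun Φ => ⨆ X, (M.toFun X)⁻¹ * ‖iteratedFDeriv ℝ n Φ.fn X‖)
    (fun Φ Ψ => by
      refine ciSup_le fun X => ?_
      have hM := inv_pos.2 (M.pos X)
      have h3 := mul_le_mul_of_nonneg_left
        (iteratedFDeriv_add_le Φ.fn_smooth Ψ.fn_smooth n X) hM.le
      have h1 := Φ.le_iSup n X
      have h2 := Ψ.le_iSup n X
      refine h3.trans ?_
      linarith)
    (fun c Φ => by
      rw [Real.mul_iSup_of_nonneg (norm_nonneg c)]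
      refine iSup_congr fun X => ?_
      change _ * ‖iteratedFDeriv ℝ n (c • Φ.fn) X‖ = _
      rw [iteratedFDeriv_smul_eq Φ.fn_smooth]
      ring)

theorem seminorm_apply (n : ℕ) (Φ : SuperClass M) :
    seminorm M n Φ = ⨆ X, (M.toFun X)⁻¹ * ‖iteratedFDeriv ℝ n Φ.fn X‖ := rfl

/-- The Fréchet topology of `S_0(M)`, given by the seminorms. -/
instance : TopologicalSpace (SuperClass M) :=
  SeminormFamily.moduleFilterBasis (𝕜 := ℂ) (seminorm M) |>.topology'

theorem withSeminorms : WithSeminorms (seminorm M) := ⟨rfl⟩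

theorem fn_hasTemperateGrowth (Φ : SuperClass M) : Φ.fn.HasTemperateGrowth := by
  refine ⟨Φ.fn_smooth, fun n => ?_⟩
  obtain ⟨a, C, ha, hC, h⟩ := M.tempered
  set b := ⨆ X, (M.toFun X)⁻¹ * ‖iteratedFDeriv ℝ n Φ.fn X‖ with hb
  refine ⟨⌈a⌉₊, b * (C * M.toFun 0 * 2 ^ ⌈a⌉₊), fun X => ?_⟩
  have h1 : ‖iteratedFDeriv ℝ n Φ.fn X‖ ≤ b * M.toFun X := by
    have := Φ.le_iSup n X
    rwa [inv_mul_le_iff₀ (M.pos X), mul_comm] at this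
  have hb0 : 0 ≤ b := Real.iSup_nonneg fun X =>
    mul_nonneg (inv_nonneg.2 (M.pos X).le) (norm_nonneg _)
  have h2 := h 0 X
  rw [zero_add] at h2
  have h3 : bracket X ^ a ≤ 2 ^ ⌈a⌉₊ * (1 + ‖X‖) ^ ⌈a⌉₊ := by
    rw [← mul_pow, ← Real.rpow_natCast]
    calc bracket X ^ a ≤ (2 * (1 + ‖X‖)) ^ a :=
          Real.rpow_le_rpow (bracket_pos X).le (bracket_le X) ha.le
      _ ≤ _ := Real.rpow_le_rpow_of_exponent_le (by nlinarith [norm_nonneg X]) (Nat.le_ceil a)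
  have h0 := M.pos 0
  calc _ ≤ b * M.toFun X := h1
    _ ≤ b * (C * M.toFun 0 * (2 ^ ⌈a⌉₊ * (1 + ‖X‖) ^ ⌈a⌉₊)) := by
        gcongr
        exact h2.trans (by gcongr)
    _ = _ := by ring

/-- An element of `S_0(M)` as a tempered distribution, `χ ↦ ∫ χ Φ`. -/
def toDist (Φ : SuperClass M) : Dist (SuperPhase d) :=
  (integralCLM ℂ (volume : Measure (SuperPhase d))).comp
    (SchwartzMap.bilinLeftCLM (ContinuousLinearMap.mul ℂ ℂ) Φ.fn_hasTemperateGrowth)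

theorem toDist_apply (Φ : SuperClass M) (χ : 𝓢(SuperPhase d, ℂ)) :
    Φ.toDist χ = ∫ X, χ X * Φ.fn X := rfl
end SuperClass

/-- `S_0(∞)`, the union of the classes `S_0(M)` over all tempered weights `M`, as a set of tempered
distributions. -/
def superClassInfty (d : ℕ) : Set (Dist (SuperPhase d)) :=
  ⋃ M : TemperedWeight d, Set.range (SuperClass.toDist (M := M))
end HormanderClasses

end MagneticSuper
end

/-!
Why the theorem is true. The composition law of the super Weyl calculus is first understood for
Schwartz symbols, abstractly: `WeylData E` is a finite-dimensional space `E` with a nondegenerate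
form `β` and a temperate phase `u`, and `weyl` sends a symbol to its magnetic Weyl kernel
`u(x, y) ∫ exp(i β(ξ, x - y)) f((x + y)/2, ξ) dξ`, up to a constant. For Schwartz symbols this is a
bijection onto Schwartz kernels, so the kernels of `f` and `g` compose to the kernel of a Schwartz
symbol `sharp f g`. The super calculus is the instance with `E` the left-right configuration space and `u` the left-right magnetic phase
(`superWeylData`).

The only trace of the magnetic field in `sharp` is the phase
`conj u(x, y) · u(x, z) · u(z, y)` of a triangle. By Stokes' theorem it is the flux of `B` through the
triangle, so that its derivatives grow at most polynomially in the *side lengths* of the triangle,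
uniformly in its position (`isTemperateFamily_trianglePhase`). It follows that if `f` and `g` are
localized at `Y` and `Y'` in phase space, then `sharp f g` at `X` decays like
`⟨X - Y⟩^(-N) ⟨X - Y'⟩^(-N)`, with constants that are Schwartz seminorms of the translates of `f` and
`g` to the origin (`exists_sharp_localized_le`).

A symbol `f` of weight `M` is a superposition `f = ∫ f_Y dY` of its localizations
`f_Y = γ(· - Y) f`, where `∫ γ = 1`, and the seminorms of `f_Y` at `Y` are `O(M(Y))`. Hence
`symbolProduct f g = ∬ sharp f_Y g_Y' dY dY'` converges absolutely, is a symbol of weight `M₁ M₂`, and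
depends continuously on `f` and `g`. By Fubini's theorem its kernel is the composition of the kernels
of `f` and `g`, in the weak sense of `integral_symbolProduct_mul`.

To see that the operator of `g` maps Schwartz kernels to Schwartz kernels, a Schwartz kernel `t` is
read off from the symbol `τ` of the rank-one kernel `t ⊗ s`: as `τ` is a symbol of every negative
weight, `symbolProduct g τ` is Schwartz, and its kernel is `(g t) ⊗ s` (`exists_image`). The same decay
shows that products with Schwartz symbols are Schwartz, which is the inclusion in the Moyal algebra.
The kernel theorem is not needed: operators with a given Schwartz kernel are constructed directly
(`kernelOp`), and uniqueness of the product reduces to the injectivity of the kernel map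
(`kernelMap_injective`), that is, to the density of tensor products among Schwartz functions.
-/

noncomputable section
set_option linter.unusedSectionVars false

namespace MagneticSuper

/-! ### Families of functions of uniformly temperate growth -/

section TemperateFamily
variable {ι : Type} {D E F G : Type} [NormedAddCommGroup D] [NormedSpace ℝ D]
  [NormedAddCommGroup E] [NormedSpace ℝ E]
  [NormedAddCommGroup F] [NormedSpace ℝ F] [NormedAddCommGroup G] [NormedSpace ℝ G]

/-- A family of smooth functions each derivative of which is polynomially bounded, uniformly over
the family. -/
def IsTemperateFamily (u : ι → E → F) : Prop :=
  (∀ i, ContDiff ℝ ∞ (u i)) ∧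
    ∀ n : ℕ, ∃ (k : ℕ) (C : ℝ), ∀ i x, ‖iteratedFDeriv ℝ n (u i) x‖ ≤ C * (1 + ‖x‖) ^ k

namespace IsTemperateFamily

theorem of_hasTemperateGrowth {f : E → F} (hf : f.HasTemperateGrowth) :
    IsTemperateFamily fun _ : ι => f :=
  ⟨fun _ => hf.1, fun n => by
    obtain ⟨k, C, h⟩ := hf.2 n
    exact ⟨k, C, fun _ => h⟩⟩

theorem hasTemperateGrowth {u : ι → E → F} (hu : IsTemperateFamily u) (i : ι) :
    (u i).HasTemperateGrowth :=
  ⟨hu.1 i, fun n => by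
    obtain ⟨k, C, h⟩ := hu.2 n
    exact ⟨k, C, h i⟩⟩

theorem norm_iteratedFDeriv_le_uniform {u : ι → E → F} (hu : IsTemperateFamily u) (n : ℕ) :
    ∃ (k : ℕ) (C : ℝ), 0 ≤ C ∧ ∀ j ≤ n, ∀ i x,
      ‖iteratedFDeriv ℝ j (u i) x‖ ≤ C * (1 + ‖x‖) ^ k := by
  induction n with
  | zero =>
    obtain ⟨k, C, h⟩ := hu.2 0
    refine ⟨k, |C|, abs_nonneg C, fun j hj i x => ?_⟩
    obtain rfl : j = 0 := by omega
    exact (h i x).trans (by gcongr; exact le_abs_self C)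
  | succ n ih =>
    obtain ⟨k, C, hC, h⟩ := ih
    obtain ⟨k', C', h'⟩ := hu.2 (n + 1)
    refine ⟨max k k', max C |C'|, le_max_of_le_left hC, fun j hj i x => ?_⟩
    rcases Nat.lt_or_ge n j with hj' | hj'
    · obtain rfl : j = n + 1 := by omega
      refine (h' i x).trans ?_
      gcongr
      · exact (le_abs_self C').trans (le_max_right _ _)
      · simp
      · exact le_max_right _ _
    · refine (h j hj' i x).trans ?_
      gcongr
      · exact le_max_left _ _
      · simp
      · exact le_max_left _ _

theorem bilinear (L : E →L[ℝ] F →L[ℝ] G) {u : ι → D → E} {v : ι → D → F}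
    (hu : IsTemperateFamily u) (hv : IsTemperateFamily v) :
    IsTemperateFamily fun i x => L (u i x) (v i x) := by
  refine ⟨fun i => L.isBoundedBilinearMap.contDiff.comp ((hu.1 i).prodMk (hv.1 i)), fun n => ?_⟩
  obtain ⟨k, C, hC, h⟩ := hu.norm_iteratedFDeriv_le_uniform n
  obtain ⟨k', C', hC', h'⟩ := hv.norm_iteratedFDeriv_le_uniform n
  refine ⟨k + k', ‖L‖ * (2 ^ n * (C * C')), fun i x => ?_⟩
  refine (L.norm_iteratedFDeriv_le_of_bilinear (hu.1 i) (hv.1 i) x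
    (mod_cast le_top : (n : WithTop ℕ∞) ≤ ∞)).trans ?_
  rw [mul_assoc ‖L‖]
  gcongr
  calc _ ≤ ∑ j ∈ Finset.range (n + 1), (n.choose j : ℝ) *
          ((C * (1 + ‖x‖) ^ k) * (C' * (1 + ‖x‖) ^ k')) := by
        refine Finset.sum_le_sum fun j hj => ?_
        rw [mul_assoc]
        gcongr
        · exact h j (by grind) i x
        · exact h' (n - j) (by grind) i x
    _ = _ := by
        rw [← Finset.sum_mul, pow_add]
        have : ∑ j ∈ Finset.range (n + 1), (n.choose j : ℝ) = 2 ^ n := by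
          exact_mod_cast Nat.sum_range_choose n
        rw [this]; ring

theorem mul {u v : ι → D → ℝ} (hu : IsTemperateFamily u) (hv : IsTemperateFamily v) :
    IsTemperateFamily fun i x => u i x * v i x :=
  bilinear (ContinuousLinearMap.mul ℝ ℝ) hu hv

theorem add {u v : ι → E → F} (hu : IsTemperateFamily u) (hv : IsTemperateFamily v) :
    IsTemperateFamily fun i x => u i x + v i x := by
  refine ⟨fun i => (hu.1 i).add (hv.1 i), fun n => ?_⟩
  obtain ⟨k, C, hC, h⟩ := hu.norm_iteratedFDeriv_le_uniform n
  obtain ⟨k', C', hC', h'⟩ := hv.norm_iteratedFDeriv_le_uniform n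
  refine ⟨k + k', C + C', fun i x => ?_⟩
  have e : iteratedFDeriv ℝ n (fun x => u i x + v i x) x =
      iteratedFDeriv ℝ n (u i) x + iteratedFDeriv ℝ n (v i) x :=
    iteratedFDeriv_add_apply ((hu.1 i).contDiffAt.of_le (mod_cast le_top))
      ((hv.1 i).contDiffAt.of_le (mod_cast le_top))
  rw [e]
  have h1 : 1 ≤ 1 + ‖x‖ := by simp
  have e1 : (1 + ‖x‖) ^ k ≤ (1 + ‖x‖) ^ (k + k') := pow_le_pow_right₀ h1 (by omega)
  have e2 : (1 + ‖x‖) ^ k' ≤ (1 + ‖x‖) ^ (k + k') := pow_le_pow_right₀ h1 (by omega)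
  calc _ ≤ C * (1 + ‖x‖) ^ k + C' * (1 + ‖x‖) ^ k' :=
        (norm_add_le _ _).trans (add_le_add (h n le_rfl i x) (h' n le_rfl i x))
    _ ≤ C * (1 + ‖x‖) ^ (k + k') + C' * (1 + ‖x‖) ^ (k + k') := by gcongr
    _ = _ := by ring

theorem sum {α : Type} (s : Finset α) {u : α → ι → E → F}
    (hu : ∀ a ∈ s, IsTemperateFamily (u a)) :
    IsTemperateFamily fun i x => ∑ a ∈ s, u a i x := by
  classical
  induction s using Finset.induction_on with
  | empty => simpa using of_hasTemperateGrowth (.const (0 : F))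
  | insert a s ha ih =>
    simp only [Finset.sum_insert ha]
    exact (hu a (by simp)).add (ih fun b hb => hu b (by simp [hb]))

theorem comp {g : ι → E → F} {f : ι → D → E} (hg : IsTemperateFamily g)
    (hf : IsTemperateFamily f) : IsTemperateFamily fun i x => g i (f i x) := by
  refine ⟨fun i => (hg.1 i).comp (hf.1 i), fun n => ?_⟩
  obtain ⟨k₁, C₁, hC₁, h₁⟩ := hf.norm_iteratedFDeriv_le_uniform n
  obtain ⟨k₂, C₂, hC₂, h₂⟩ := hg.norm_iteratedFDeriv_le_uniform n
  refine ⟨k₁ * k₂ + k₁ * n, n.factorial * (C₂ * (1 + C₁) ^ k₂) * (1 + C₁) ^ n, fun i x => ?_⟩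
  have hx : 1 ≤ 1 + ‖x‖ := by simp
  have hx1 : 1 ≤ (1 + ‖x‖) ^ k₁ := one_le_pow₀ hx
  have hg' : ∀ j ≤ n, ‖iteratedFDeriv ℝ j (g i) (f i x)‖ ≤
      C₂ * ((1 + C₁) * (1 + ‖x‖) ^ k₁) ^ k₂ := by
    intro j hj
    refine (h₂ j hj i (f i x)).trans ?_
    have := h₁ 0 (Nat.zero_le n) i x
    rw [norm_iteratedFDeriv_zero] at this
    gcongr
    linarith
  have hf' : ∀ j, 1 ≤ j → j ≤ n →
      ‖iteratedFDeriv ℝ j (f i) x‖ ≤ ((1 + C₁) * (1 + ‖x‖) ^ k₁) ^ j := by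
    intro j hj hj'
    calc _ ≤ C₁ * (1 + ‖x‖) ^ k₁ := h₁ j hj' i x
      _ ≤ (1 + C₁) * (1 + ‖x‖) ^ k₁ := by gcongr; simp
      _ ≤ _ := le_self_pow₀ (one_le_mul_of_one_le_of_one_le (by simp [hC₁]) hx1) (by omega)
  refine (norm_iteratedFDeriv_comp_le (hg.1 i) (hf.1 i)
    (mod_cast le_top : (n : WithTop ℕ∞) ≤ ∞) x hg' hf').trans (le_of_eq ?_)
  rw [mul_pow, mul_pow, pow_add, pow_mul, pow_mul]
  ring

theorem comp_clm {g : ι → E → F} (hg : IsTemperateFamily g) (L : D →L[ℝ] E) :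
    IsTemperateFamily fun i x => g i (L x) :=
  hg.comp (of_hasTemperateGrowth L.hasTemperateGrowth)

theorem reindex {κ : Type} {g : ι → E → F} (hg : IsTemperateFamily g) (e : κ → ι) :
    IsTemperateFamily fun i => g (e i) :=
  ⟨fun i => hg.1 (e i), fun n => by
    obtain ⟨k, C, h⟩ := hg.2 n
    exact ⟨k, C, fun i => h (e i)⟩⟩

/-- Integration over `s ∈ [0, 1]` of a temperate family in `(s, x)` gives a temperate family
in `x`. -/
theorem segmentIntegral {u : ι → ℝ × E → F} (hu : IsTemperateFamily u) :
    IsTemperateFamily fun i x => ∫ s in (0:ℝ)..1, u i (s, x) := by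
  refine ⟨fun i => (HasTemperateGrowth.segmentIntegral (hu.hasTemperateGrowth i)).1, fun n => ?_⟩
  suffices key : ∀ n : ℕ, ∀ (F : Type) [NormedAddCommGroup F] [NormedSpace ℝ F]
      (u : ι → ℝ × E → F), IsTemperateFamily u → ∃ (k : ℕ) (C : ℝ), ∀ i x,
        ‖iteratedFDeriv ℝ n (fun x => ∫ s in (0:ℝ)..1, u i (s, x)) x‖ ≤ C * (1 + ‖x‖) ^ k from
    key n F u hu
  intro n
  induction n with
  | zero =>
    intro F _ _ u hu
    obtain ⟨k, C, hC, h⟩ := hu.norm_iteratedFDeriv_le_uniform 0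
    refine ⟨k, C * 2 ^ k, fun i x => ?_⟩
    rw [norm_iteratedFDeriv_zero]
    have : ∀ s ∈ Set.uIoc (0:ℝ) 1, ‖u i (s, x)‖ ≤ C * 2 ^ k * (1 + ‖x‖) ^ k := by
      intro s hs
      rw [Set.uIoc_of_le zero_le_one] at hs
      have hs' : ‖s‖ ≤ 1 := by rw [Real.norm_of_nonneg hs.1.le]; exact hs.2
      have h1 := h 0 le_rfl i (s, x)
      rw [norm_iteratedFDeriv_zero] at h1
      refine h1.trans ?_
      rw [mul_assoc, ← mul_pow]
      gcongr
      rw [Prod.norm_mk]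
      have := norm_nonneg x
      rcases max_cases ‖s‖ ‖x‖ with h | h <;> linarith
    simpa using intervalIntegral.norm_integral_le_of_norm_le_const this
  | succ n ih =>
    intro F _ _ u hu
    have hu' : IsTemperateFamily fun i p =>
        (fderiv ℝ (u i) p).comp (ContinuousLinearMap.inr ℝ ℝ E) := by
      have h1 : IsTemperateFamily fun i => fderiv ℝ (u i) :=
        ⟨fun i => (hu.1 i).fderiv_right (by simp), fun m => by
          obtain ⟨k, C, h⟩ := hu.2 (m + 1)
          exact ⟨k, C, fun i x => by rw [norm_iteratedFDeriv_fderiv]; exact h i x⟩⟩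
      exact (of_hasTemperateGrowth ((ContinuousLinearMap.compL ℝ E (ℝ × E) F).flip
        (ContinuousLinearMap.inr ℝ ℝ E)).hasTemperateGrowth).comp h1
    obtain ⟨k, C, h2⟩ := ih _ _ hu'
    refine ⟨k, C, fun i x => ?_⟩
    have hfd : fderiv ℝ (fun x => ∫ s in (0:ℝ)..1, u i (s, x)) =
        fun x => ∫ s in (0:ℝ)..1, (fderiv ℝ (u i) (s, x)).comp (ContinuousLinearMap.inr ℝ ℝ E) :=
      funext fun x => (hasFDerivAt_segmentIntegral (hu.hasTemperateGrowth i) x).fderiv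
    rw [← norm_iteratedFDeriv_fderiv, hfd]
    exact h2 i x

end IsTemperateFamily
end TemperateFamily

/-! ### The flux of the magnetic field through triangles -/

section Flux
variable {d : ℕ}

/-- The translate `x ↦ B(c + x)` of a magnetic field. -/
def MagneticField.translate (B : MagneticField d) (c : Conf d) : MagneticField d where
  comp j k x := B.comp j k (c + x)
  antisymm j k x := B.antisymm j k (c + x)
  smooth j k := (B.smooth j k).comp (contDiff_const.add contDiff_id)
  bounded j k n := by
    obtain ⟨C, h⟩ := B.bounded j k n
    exact ⟨C, fun x => by rw [iteratedFDeriv_comp_add_left]; exact h _⟩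
  closed i j k x := by simpa only [fderiv_comp_add_left] using B.closed i j k (c + x)

/-- The magnetic field at a point, as a bilinear form. -/
def MagneticField.form (B : MagneticField d) (x : Conf d) : Conf d →L[ℝ] Conf d →L[ℝ] ℝ :=
  ∑ j, ∑ k, B.comp j k x •
    (EuclideanSpace.proj (𝕜 := ℝ) j : Conf d →L[ℝ] ℝ).smulRight
      (EuclideanSpace.proj (𝕜 := ℝ) k : Conf d →L[ℝ] ℝ)

theorem MagneticField.form_apply (B : MagneticField d) (x v w : Conf d) :
    B.form x v w = ∑ j, ∑ k, B.comp j k x * (v j * w k) := by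
  simp [MagneticField.form]

theorem MagneticField.form_hasTemperateGrowth (B : MagneticField d) :
    B.form.HasTemperateGrowth := by
  refine Function.HasTemperateGrowth.sum fun j _ => Function.HasTemperateGrowth.sum fun k _ => ?_
  exact (ContinuousLinearMap.hasTemperateGrowth (F := Conf d →L[ℝ] Conf d →L[ℝ] ℝ)
    (ContinuousLinearMap.toSpanSingleton ℝ ((EuclideanSpace.proj (𝕜 := ℝ) j : Conf d →L[ℝ] ℝ).smulRight
      (EuclideanSpace.proj (𝕜 := ℝ) k : Conf d →L[ℝ] ℝ)))).comp
    (B.hasTemperateGrowth j k)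

theorem MagneticField.form_antisymm (B : MagneticField d) (x v w : Conf d) :
    B.form x v w = -B.form x w v := by
  rw [B.form_apply, B.form_apply, Finset.sum_comm, ← Finset.sum_neg_distrib]
  refine Finset.sum_congr rfl fun j _ => ?_
  rw [← Finset.sum_neg_distrib]
  refine Finset.sum_congr rfl fun k _ => ?_
  rw [B.antisymm]; ring

theorem MagneticField.fderiv_form_apply (B : MagneticField d) (x u v w : Conf d) :
    fderiv ℝ B.form x u v w =
      ∑ i, ∑ j, ∑ k, u i * v j * w k * fderiv ℝ (B.comp j k) x (EuclideanSpace.single i 1) := by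
  have h1 : fderiv ℝ B.form x u v w = fderiv ℝ (fun y => B.form y v w) x u := by
    have hd : DifferentiableAt ℝ B.form x := B.form_hasTemperateGrowth.1.differentiable (by simp) x
    have h := (hd.hasFDerivAt.clm_apply (hasFDerivAt_const v x)).clm_apply (hasFDerivAt_const w x)
    rw [h.fderiv]
    simp
  have h2 : HasFDerivAt (fun y => B.form y v w)
      (∑ j, ∑ k, (v j * w k) • fderiv ℝ (B.comp j k) x) x := by
    simp only [B.form_apply]
    refine HasFDerivAt.fun_sum fun j _ => HasFDerivAt.fun_sum fun k _ => ?_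
    exact ((B.smooth j k).differentiable (by simp) x).hasFDerivAt.mul_const _
  have hu : u = ∑ i, u i • EuclideanSpace.single i (1 : ℝ) := by
    ext i
    simp [Finset.sum_apply, Pi.single_apply]
  rw [h1, h2.fderiv]
  conv_lhs => rw [hu]
  simp only [map_sum, map_smul, sum_apply, smul_apply, smul_eq_mul,
    Finset.mul_sum]
  refine Finset.sum_congr rfl fun i _ => Finset.sum_congr rfl fun j _ =>
    Finset.sum_congr rfl fun k _ => by ring

/-- The field is closed, for arbitrary vectors in place of those of the standard basis. -/
theorem MagneticField.form_closed (B : MagneticField d) (x u v w : Conf d) :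
    fderiv ℝ B.form x u v w + fderiv ℝ B.form x v w u + fderiv ℝ B.form x w u v = 0 := by
  simp only [B.fderiv_form_apply]
  have e2 : ∑ i, ∑ j, ∑ k, v i * w j * u k *
        fderiv ℝ (B.comp j k) x (EuclideanSpace.single i 1) =
      ∑ i, ∑ j, ∑ k, u i * v j * w k *
        fderiv ℝ (B.comp k i) x (EuclideanSpace.single j 1) := by
    rw [Finset.sum_congr rfl fun i _ => Finset.sum_comm, Finset.sum_comm]
    refine Finset.sum_congr rfl fun i _ => Finset.sum_congr rfl fun j _ =>
      Finset.sum_congr rfl fun k _ => by ring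
  have e3 : ∑ i, ∑ j, ∑ k, w i * u j * v k *
        fderiv ℝ (B.comp j k) x (EuclideanSpace.single i 1) =
      ∑ i, ∑ j, ∑ k, u i * v j * w k *
        fderiv ℝ (B.comp i j) x (EuclideanSpace.single k 1) := by
    rw [Finset.sum_comm]
    refine Finset.sum_congr rfl fun i _ => ?_
    rw [Finset.sum_comm]
    refine Finset.sum_congr rfl fun j _ => Finset.sum_congr rfl fun k _ => by ring
  rw [e2, e3]
  simp only [← Finset.sum_add_distrib]
  refine Finset.sum_eq_zero fun i _ => Finset.sum_eq_zero fun j _ =>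
    Finset.sum_eq_zero fun k _ => ?_
  rw [← mul_add, ← mul_add, B.closed i j k x, mul_zero]

/-- The vector potential as a `1`-form. -/
def MagneticField.potential (B : MagneticField d) (x : Conf d) : Conf d →L[ℝ] ℝ :=
  ∑ k, vectorPotential B k x • (EuclideanSpace.proj (𝕜 := ℝ) k : Conf d →L[ℝ] ℝ)

theorem MagneticField.potential_apply (B : MagneticField d) (x v : Conf d) :
    B.potential x v = ∑ k, vectorPotential B k x * v k := by
  simp [MagneticField.potential]

theorem MagneticField.potential_hasTemperateGrowth (B : MagneticField d) :
    B.potential.HasTemperateGrowth := by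
  refine Function.HasTemperateGrowth.sum fun k _ => ?_
  exact (vectorPotential_hasTemperateGrowth B k).smul (Function.HasTemperateGrowth.const _)

theorem MagneticField.potential_apply_eq_integral (B : MagneticField d) (x w : Conf d) :
    B.potential x w = ∫ s in (0:ℝ)..1, s * B.form (s • x) x w := by
  rw [B.potential_apply]
  have hc : ∀ j k, Continuous fun s : ℝ => s * x j * B.comp j k (s • x) := fun j k => by
    have := (B.smooth j k).continuous
    fun_prop
  have h : ∀ s : ℝ, s * B.form (s • x) x w =
      ∑ k, (∑ j, s * x j * B.comp j k (s • x)) * w k := by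
    intro s
    rw [B.form_apply, Finset.sum_comm, Finset.mul_sum]
    refine Finset.sum_congr rfl fun k _ => ?_
    rw [Finset.mul_sum, Finset.sum_mul]
    refine Finset.sum_congr rfl fun j _ => by ring
  simp only [h]
  rw [intervalIntegral.integral_finsetSum fun k _ => by
    refine Continuous.intervalIntegrable ?_ _ _
    exact (continuous_finsetSum _ fun j _ => hc j k).mul continuous_const]
  refine Finset.sum_congr rfl fun k _ => ?_
  rw [intervalIntegral.integral_mul_const, intervalIntegral.integral_finsetSum fun j _ =>
    (hc j k).intervalIntegrable _ _]
  rfl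

/-- The transversal gauge: the exterior derivative of the potential is the magnetic field. -/
theorem MagneticField.fderiv_potential_sub (B : MagneticField d) (x v w : Conf d) :
    fderiv ℝ B.potential x v w - fderiv ℝ B.potential x w v = B.form x v w := by
  have hdf : Differentiable ℝ B.form := B.form_hasTemperateGrowth.1.differentiable (by simp)
  have hcf : Continuous B.form := hdf.continuous
  have hcf' := B.form_hasTemperateGrowth.1.continuous_fderiv (by simp)
  -- Differentiate `A(x) w = ∫₀¹ s B(s x)(x, w) ds` under the integral sign.
  have key : ∀ v w : Conf d, fderiv ℝ B.potential x v w =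
      ∫ s in (0:ℝ)..1, (s * B.form (s • x) v w + s ^ 2 * fderiv ℝ B.form (s • x) v x w) := by
    intro v w
    have h1 : fderiv ℝ B.potential x v w = fderiv ℝ (fun y => B.potential y w) x v := by
      have hd : DifferentiableAt ℝ B.potential x :=
        B.potential_hasTemperateGrowth.1.differentiable (by simp) x
      rw [(hd.hasFDerivAt.clm_apply (hasFDerivAt_const w x)).fderiv]
      simp
    have ht1 : (fun p : ℝ × Conf d => p.1).HasTemperateGrowth :=
      (ContinuousLinearMap.fst ℝ ℝ (Conf d)).hasTemperateGrowth
    have ht2 : (fun p : ℝ × Conf d => p.2).HasTemperateGrowth :=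
      (ContinuousLinearMap.snd ℝ ℝ (Conf d)).hasTemperateGrowth
    have hG : (fun p : ℝ × Conf d => p.1 * B.form (p.1 • p.2) p.2 w).HasTemperateGrowth := by
      refine ht1.mul ?_
      simp only [B.form_apply]
      refine Function.HasTemperateGrowth.sum fun j _ =>
        Function.HasTemperateGrowth.sum fun k _ => ?_
      exact ((B.hasTemperateGrowth j k).comp (ht1.smul ht2)).mul
        ((((EuclideanSpace.proj (𝕜 := ℝ) j).hasTemperateGrowth).comp ht2).mul
          (Function.HasTemperateGrowth.const _))
    have h5 := hasFDerivAt_segmentIntegral hG x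
    rw [h1, funext fun y => B.potential_apply_eq_integral y w, h5.fderiv,
      ContinuousLinearMap.intervalIntegral_apply]
    · refine intervalIntegral.integral_congr fun s _ => ?_
      have e1 : HasFDerivAt (fun p : ℝ × Conf d => p.1) (ContinuousLinearMap.fst ℝ ℝ (Conf d))
          (s, x) := hasFDerivAt_fst
      have e2 : HasFDerivAt (fun p : ℝ × Conf d => p.2) (ContinuousLinearMap.snd ℝ ℝ (Conf d))
          (s, x) := hasFDerivAt_snd
      have e3 : HasFDerivAt (fun p : ℝ × Conf d => B.form (p.1 • p.2)) _ (s, x) :=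
        HasFDerivAt.comp (g := B.form) (s, x) (hdf (s • x)).hasFDerivAt (e1.smul e2)
      have e4 := e1.mul ((e3.clm_apply e2).clm_apply (hasFDerivAt_const w (s, x)))
      have e5 : fderiv ℝ (fun p : ℝ × Conf d => p.1 * B.form (p.1 • p.2) p.2 w) (s, x) = _ :=
        e4.fderiv
      simp only [ContinuousLinearMap.comp_apply, ContinuousLinearMap.inr_apply]
      rw [e5]
      simp
      ring
    · refine Continuous.intervalIntegrable ?_ _ _
      have h6 : Continuous (fderiv ℝ fun p : ℝ × Conf d => p.1 * B.form (p.1 • p.2) p.2 w) :=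
        hG.1.continuous_fderiv (by simp)
      exact (h6.comp (by fun_prop : Continuous fun s : ℝ => (s, x))).clm_comp continuous_const
  have hsx : Continuous fun s : ℝ => s • x := by fun_prop
  have hi : ∀ v w : Conf d, Continuous fun s : ℝ =>
      s * B.form (s • x) v w + s ^ 2 * fderiv ℝ B.form (s • x) v x w := by
    intro v w
    have h1 : Continuous fun s : ℝ => B.form (s • x) v w :=
      ((hcf.comp hsx).clm_apply continuous_const).clm_apply continuous_const
    have h2 : Continuous fun s : ℝ => fderiv ℝ B.form (s • x) v x w :=
      (((hcf'.comp hsx).clm_apply continuous_const).clm_apply continuous_const).clm_apply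
        continuous_const
    fun_prop
  rw [key v w, key w v, ← intervalIntegral.integral_sub ((hi v w).intervalIntegrable _ _)
    ((hi w v).intervalIntegrable _ _)]
  -- As `B` is closed, the difference of the integrands is `d/ds (s² B(s x)(v, w))`.
  have hd : ∀ s ∈ Set.uIcc (0:ℝ) 1, HasDerivAt (fun s : ℝ => s ^ 2 * B.form (s • x) v w)
      (s * B.form (s • x) v w + s ^ 2 * fderiv ℝ B.form (s • x) v x w -
        (s * B.form (s • x) w v + s ^ 2 * fderiv ℝ B.form (s • x) w x v)) s := by
    intro s _
    have h1 : HasDerivAt (fun s : ℝ => s • x) x s := by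
      simpa using (hasDerivAt_id s).smul_const x
    have h2 : HasDerivAt (fun s : ℝ => B.form (s • x)) (fderiv ℝ B.form (s • x) x) s :=
      HasFDerivAt.comp_hasDerivAt (l := B.form) s (hdf (s • x)).hasFDerivAt h1
    have h3 := (h2.clm_apply (hasDerivAt_const s v)).clm_apply (hasDerivAt_const s w)
    have h4 := (hasDerivAt_pow 2 s).mul h3
    refine h4.congr_deriv ?_
    have c1 := B.form_closed (s • x) v x w
    have anti : ∀ y p q r : Conf d, fderiv ℝ B.form y p q r = -fderiv ℝ B.form y p r q := by
      intro y p q r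
      have f1 : HasFDerivAt (fun y => B.form y q r) _ y :=
        ((hdf y).hasFDerivAt.clm_apply (hasFDerivAt_const q y)).clm_apply (hasFDerivAt_const r y)
      have f2 : HasFDerivAt (fun y => B.form y q r) _ y :=
        (((hdf y).hasFDerivAt.clm_apply (hasFDerivAt_const r y)).clm_apply
          (hasFDerivAt_const q y)).neg.congr_of_eventuallyEq
            (.of_forall fun y => B.form_antisymm y q r)
      have := congrArg (fun L => L p) (f1.unique f2)
      simpa using this
    rw [B.form_antisymm (s • x) w v]
    have a1 := anti (s • x) x w v
    have a2 := anti (s • x) w v x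
    simp only [Nat.cast_ofNat, Nat.add_one_sub_one, pow_one, map_zero, add_zero] at *
    simp
    linear_combination s ^ 2 * a1 + s ^ 2 * a2 - s ^ 2 * c1
  rw [intervalIntegral.integral_eq_sub_of_hasDerivAt hd
    (((hi v w).sub (hi w v)).intervalIntegrable _ _)]
  simp

theorem circulation_eq_curveIntegral (B : MagneticField d) (x y : Conf d) :
    circulation B x y = ∫ᶜ z in .segment y x, B.potential z := by
  rw [curveIntegral_segment, circulation]
  refine intervalIntegral.integral_congr fun s _ => ?_
  simp only [B.potential_apply, AffineMap.lineMap_apply, vsub_eq_sub, vadd_eq_add]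
  rw [add_comm]
  rfl

/-- The flux of the magnetic field through the triangle with vertices `x, z, y`, as the circulation
of the potential along its boundary. -/
def triangleFlux (B : MagneticField d) (x z y : Conf d) : ℝ :=
  circulation B x z + circulation B z y - circulation B x y

/-- The flux depends only on the field, not on its potential: moving the base point of the
transversal gauge changes the potential by a closed form, and the circulation of a closed form
along a triangle vanishes. -/
theorem triangleFlux_translate (B : MagneticField d) (c x z y : Conf d) :
    triangleFlux B (c + x) (c + z) (c + y) = triangleFlux (B.translate c) x z y := by
  have hd1 : Differentiable ℝ B.potential :=
    B.potential_hasTemperateGrowth.1.differentiable (by simp)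
  have hd2 : Differentiable ℝ (B.translate c).potential :=
    (B.translate c).potential_hasTemperateGrowth.1.differentiable (by simp)
  -- The difference `B.potential (c + ·) - (B.translate c).potential` is a closed form.
  have hω : ∀ p ∈ (Set.univ : Set (Conf d)), HasFDerivWithinAt
      (fun p => (B.potential (c + p) - (B.translate c).potential p : Conf d →L[ℝ] ℝ))
      (fderiv ℝ B.potential (c + p) - fderiv ℝ (B.translate c).potential p) Set.univ p := by
    intro p _
    have h1 : HasFDerivAt (fun p => B.potential (c + p)) (fderiv ℝ B.potential (c + p)) p := by
      rw [← fderiv_comp_add_left]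
      exact ((hd1.comp (differentiable_id.const_add c)) p).hasFDerivAt
    exact (h1.sub (hd2 p).hasFDerivAt).hasFDerivWithinAt
  have hsymm : ∀ a ∈ (Set.univ : Set (Conf d)), ∀ v ∈ tangentConeAt ℝ Set.univ a,
      ∀ w ∈ tangentConeAt ℝ Set.univ a,
      (fderiv ℝ B.potential (c + a) - fderiv ℝ (B.translate c).potential a) v w =
      (fderiv ℝ B.potential (c + a) - fderiv ℝ (B.translate c).potential a) w v := by
    intro a _ v _ w _
    have h1 := B.fderiv_potential_sub (c + a) v w
    have h2 := (B.translate c).fderiv_potential_sub a v w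
    have h3 : (B.translate c).form a v w = B.form (c + a) v w := rfl
    simp only [sub_apply]
    linarith
  have key := convex_univ.curveIntegral_segment_add_eq_of_hasFDerivWithinAt_symmetric hω hsymm
    (Set.mem_univ y) (Set.mem_univ z) (Set.mem_univ x)
  have hI : ∀ p q : Conf d, (∫ᶜ r in .segment q p,
      (B.potential (c + r) - (B.translate c).potential r : Conf d →L[ℝ] ℝ)) =
      circulation B (c + p) (c + q) - circulation (B.translate c) p q := by
    intro p q
    rw [curveIntegral_segment, circulation_eq_curveIntegral, circulation_eq_curveIntegral,
      curveIntegral_segment, curveIntegral_segment, ← intervalIntegral.integral_sub]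
    · refine intervalIntegral.integral_congr fun s _ => ?_
      simp only [sub_apply, AffineMap.lineMap_apply, vsub_eq_sub, vadd_eq_add,
        add_sub_add_left_eq_sub]
      congr 3
      abel
    · refine Continuous.intervalIntegrable ?_ _ _
      exact (hd1.continuous.comp (AffineMap.lineMap_continuous)).clm_apply continuous_const
    · refine Continuous.intervalIntegrable ?_ _ _
      exact (hd2.continuous.comp (AffineMap.lineMap_continuous)).clm_apply continuous_const
  rw [hI, hI, hI] at key
  unfold triangleFlux
  linarith

/-- The potential of the field translated by `c + m`, as a function of `m` and of the position:
boundedness of the derivatives of the field makes its growth independent of `c`. -/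
theorem isTemperateFamily_vectorPotential_translate (B : MagneticField d) (k : Fin d) :
    IsTemperateFamily fun (c : Conf d) (q : Conf d × Conf d) =>
      vectorPotential (B.translate (c + q.1)) k q.2 := by
  refine IsTemperateFamily.sum Finset.univ fun j _ => ?_
  refine IsTemperateFamily.segmentIntegral (E := Conf d × Conf d)
    (u := fun (c : Conf d) (p : ℝ × (Conf d × Conf d)) =>
      p.1 * p.2.2 j * B.comp j k (c + p.2.1 + p.1 • p.2.2)) ?_
  have hB : IsTemperateFamily fun (c : Conf d) (x : Conf d) => B.comp j k (c + x) :=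
    ⟨fun c => (B.smooth j k).comp (contDiff_const.add contDiff_id), fun n => by
      obtain ⟨C, h⟩ := B.bounded j k n
      exact ⟨0, C, fun c x => by rw [iteratedFDeriv_comp_add_left]; simpa using h _⟩⟩
  have h1 : (fun p : ℝ × (Conf d × Conf d) => p.1).HasTemperateGrowth :=
    (ContinuousLinearMap.fst ℝ ℝ (Conf d × Conf d)).hasTemperateGrowth
  have h2 : (fun p : ℝ × (Conf d × Conf d) => p.2.1).HasTemperateGrowth :=
    ((ContinuousLinearMap.fst ℝ _ _).comp
      (ContinuousLinearMap.snd ℝ ℝ (Conf d × Conf d))).hasTemperateGrowth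
  have h3 : (fun p : ℝ × (Conf d × Conf d) => p.2.2).HasTemperateGrowth :=
    ((ContinuousLinearMap.snd ℝ _ _).comp
      (ContinuousLinearMap.snd ℝ ℝ (Conf d × Conf d))).hasTemperateGrowth
  have hp : (fun x : Conf d => x j).HasTemperateGrowth :=
    (EuclideanSpace.proj (𝕜 := ℝ) j).hasTemperateGrowth
  have h4 := hB.comp (IsTemperateFamily.of_hasTemperateGrowth (h2.add (h1.smul h3)))
  have h5 := (IsTemperateFamily.of_hasTemperateGrowth (ι := Conf d)
    (h1.mul (hp.comp h3))).mul h4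
  refine Eq.mp (congrArg IsTemperateFamily ?_) h5
  ext c p
  simp [add_assoc]

theorem isTemperateFamily_circulation_translate (B : MagneticField d) :
    IsTemperateFamily fun (c : Conf d) (q : Conf d × (Conf d × Conf d)) =>
      circulation (B.translate (c + q.1)) q.2.1 q.2.2 := by
  refine IsTemperateFamily.segmentIntegral (E := Conf d × (Conf d × Conf d))
    (u := fun (c : Conf d) (p : ℝ × (Conf d × (Conf d × Conf d))) =>
      ∑ k, vectorPotential (B.translate (c + p.2.1)) k
        (p.2.2.2 + p.1 • (p.2.2.1 - p.2.2.2)) * (p.2.2.1 k - p.2.2.2 k)) ?_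
  have h1 : (fun p : ℝ × (Conf d × (Conf d × Conf d)) => p.1).HasTemperateGrowth :=
    (ContinuousLinearMap.fst ℝ ℝ (Conf d × (Conf d × Conf d))).hasTemperateGrowth
  have h0 : (fun p : ℝ × (Conf d × (Conf d × Conf d)) => p.2).HasTemperateGrowth :=
    (ContinuousLinearMap.snd ℝ ℝ (Conf d × (Conf d × Conf d))).hasTemperateGrowth
  have h2 : (fun p : ℝ × (Conf d × (Conf d × Conf d)) => p.2.1).HasTemperateGrowth :=
    (ContinuousLinearMap.fst ℝ (Conf d) (Conf d × Conf d)).hasTemperateGrowth.comp h0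
  have h0' : (fun p : ℝ × (Conf d × (Conf d × Conf d)) => p.2.2).HasTemperateGrowth :=
    (ContinuousLinearMap.snd ℝ (Conf d) (Conf d × Conf d)).hasTemperateGrowth.comp h0
  have h3 : (fun p : ℝ × (Conf d × (Conf d × Conf d)) => p.2.2.1).HasTemperateGrowth :=
    (ContinuousLinearMap.fst ℝ (Conf d) (Conf d)).hasTemperateGrowth.comp h0'
  have h4 : (fun p : ℝ × (Conf d × (Conf d × Conf d)) => p.2.2.2).HasTemperateGrowth :=
    (ContinuousLinearMap.snd ℝ (Conf d) (Conf d)).hasTemperateGrowth.comp h0'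
  refine IsTemperateFamily.sum Finset.univ fun k _ => ?_
  have hp : (fun x : Conf d => x k).HasTemperateGrowth :=
    (EuclideanSpace.proj (𝕜 := ℝ) k).hasTemperateGrowth
  have h5 : (fun p : ℝ × (Conf d × (Conf d × Conf d)) =>
      (p.2.1, p.2.2.2 + p.1 • (p.2.2.1 - p.2.2.2))).HasTemperateGrowth := by
    have a := (ContinuousLinearMap.inl ℝ (Conf d) (Conf d)).hasTemperateGrowth.comp h2
    have b := (ContinuousLinearMap.inr ℝ (Conf d) (Conf d)).hasTemperateGrowth.comp
      (h4.add (h1.smul (h3.sub h4)))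
    refine Eq.mp (congrArg Function.HasTemperateGrowth ?_) (a.add b)
    ext1 p
    simp
  exact ((isTemperateFamily_vectorPotential_translate B k).comp
    (IsTemperateFamily.of_hasTemperateGrowth h5)).mul
    (IsTemperateFamily.of_hasTemperateGrowth ((hp.comp h3).sub (hp.comp h4)))

/-- The flux through the triangle with vertices `m + (a + b) / 2`, `m + (b - a) / 2`,
`m - (a + b) / 2` has temperate growth in `a, b`, uniformly in `m`. -/
theorem isTemperateFamily_triangleFlux (B : MagneticField d) :
    IsTemperateFamily fun (c : Conf d) (q : Conf d × (Conf d × Conf d)) =>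
      triangleFlux B (c + q.1 + (1 / 2 : ℝ) • (q.2.1 + q.2.2))
        (c + q.1 + (1 / 2 : ℝ) • (q.2.2 - q.2.1)) (c + q.1 - (1 / 2 : ℝ) • (q.2.1 + q.2.2)) := by
  have hL : ∀ L L' : (Conf d × Conf d) →L[ℝ] Conf d, IsTemperateFamily
      fun (c : Conf d) (q : Conf d × (Conf d × Conf d)) =>
        circulation (B.translate (c + q.1)) (L q.2) (L' q.2) := by
    intro L L'
    exact (isTemperateFamily_circulation_translate B).comp_clm
      ((ContinuousLinearMap.id ℝ (Conf d)).prodMap (L.prod L'))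
  let S : (Conf d × Conf d) →L[ℝ] Conf d :=
    (1 / 2 : ℝ) • (ContinuousLinearMap.fst ℝ _ _ + ContinuousLinearMap.snd ℝ _ _)
  let D : (Conf d × Conf d) →L[ℝ] Conf d :=
    (1 / 2 : ℝ) • (ContinuousLinearMap.snd ℝ _ _ - ContinuousLinearMap.fst ℝ _ _)
  have h1 : IsTemperateFamily fun (_ : Conf d) (_ : Conf d × (Conf d × Conf d)) => (-1 : ℝ) :=
    IsTemperateFamily.of_hasTemperateGrowth (.const _)
  have h := ((hL S D).add (hL D (-S))).add (h1.mul (hL S (-S)))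
  refine Eq.mp (congrArg IsTemperateFamily ?_) h
  ext c q
  have e : c + q.1 - (1 / 2 : ℝ) • (q.2.1 + q.2.2) =
    c + q.1 + -((1 / 2 : ℝ) • (q.2.1 + q.2.2)) := sub_eq_add_neg _ _
  -- With the base point of the gauge at the centre `c + m`, only the sides occur in the potential.
  rw [e, triangleFlux_translate]
  simp only [triangleFlux, S, D, smul_apply, add_apply, sub_apply,
    neg_apply, ContinuousLinearMap.coe_fst', ContinuousLinearMap.coe_snd']
  ring
end Flux

section TrianglePhase

/-- The phase `conj u(x, y) u(x, z) u(z, y)` of the triangle with vertices `x = m + (a + b) / 2`,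
`z = m + (b - a) / 2`, `y = m - (a + b) / 2`, for which `x - z = a` and `z - y = b`. -/
def trianglePhase {E : Type} [NormedAddCommGroup E] [NormedSpace ℝ E] (u : E × E → ℂ)
    (m a b : E) : ℂ :=
  (starRingEnd ℂ) (u (m + (1 / 2 : ℝ) • (a + b), m - (1 / 2 : ℝ) • (a + b))) *
    u (m + (1 / 2 : ℝ) • (a + b), m + (1 / 2 : ℝ) • (b - a)) *
    u (m + (1 / 2 : ℝ) • (b - a), m - (1 / 2 : ℝ) • (a + b))

theorem trianglePhase_superPhaseFactor {d : ℕ} (B : MagneticField d) (m a b : Conf d × Conf d) :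
    trianglePhase (superPhaseFactor B) m a b = Complex.exp (((
      triangleFlux B (m.1 + (1 / 2 : ℝ) • (a.1 + b.1)) (m.1 + (1 / 2 : ℝ) • (b.1 - a.1))
        (m.1 - (1 / 2 : ℝ) • (a.1 + b.1)) + (-1) *
      triangleFlux B (m.2 + (1 / 2 : ℝ) • (a.2 + b.2)) (m.2 + (1 / 2 : ℝ) • (b.2 - a.2))
        (m.2 - (1 / 2 : ℝ) • (a.2 + b.2)) : ℝ) : ℂ) * Complex.I) := by
  simp only [trianglePhase, superPhaseFactor, ← Complex.exp_conj, ← Complex.exp_add]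
  congr 1
  simp only [triangleFlux, map_mul, Complex.conj_ofReal, Complex.conj_I, Prod.fst_add,
    Prod.snd_add, Prod.fst_sub, Prod.snd_sub, Prod.smul_fst, Prod.smul_snd]
  push_cast
  ring

theorem isTemperateFamily_triangleFlux_comp {d : ℕ} (B : MagneticField d)
    (π : Conf d × Conf d →L[ℝ] Conf d) :
    IsTemperateFamily fun (c : Conf d × Conf d)
      (q : (Conf d × Conf d) × ((Conf d × Conf d) × (Conf d × Conf d))) =>
      triangleFlux B (π (c + q.1) + (1 / 2 : ℝ) • (π q.2.1 + π q.2.2))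
        (π (c + q.1) + (1 / 2 : ℝ) • (π q.2.2 - π q.2.1))
        (π (c + q.1) - (1 / 2 : ℝ) • (π q.2.1 + π q.2.2)) := by
  simp only [map_add]
  exact ((isTemperateFamily_triangleFlux B).reindex π).comp_clm (π.prodMap (π.prodMap π))

theorem isTemperateFamily_trianglePhase {d : ℕ} (B : MagneticField d) :
    IsTemperateFamily fun (c : Conf d × Conf d)
      (q : (Conf d × Conf d) × ((Conf d × Conf d) × (Conf d × Conf d))) =>
      trianglePhase (superPhaseFactor B) (c + q.1) q.2.1 q.2.2 := by
  have h1 : IsTemperateFamily fun (_ : Conf d × Conf d)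
      (_ : (Conf d × Conf d) × ((Conf d × Conf d) × (Conf d × Conf d))) => (-1 : ℝ) :=
    IsTemperateFamily.of_hasTemperateGrowth (.const _)
  have h2 := (isTemperateFamily_triangleFlux_comp B (ContinuousLinearMap.fst ℝ _ _)).add
    (h1.mul (isTemperateFamily_triangleFlux_comp B (ContinuousLinearMap.snd ℝ _ _)))
  simp only [trianglePhase_superPhaseFactor]
  exact (IsTemperateFamily.of_hasTemperateGrowth (ι := Conf d × Conf d)
    hasTemperateGrowth_expI).comp h2
end TrianglePhase

/-! ### Schwartz functions: multipliers, slices, translations, integrals with parameters -/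

section SchwartzTools
variable {V W E F G : Type} [NormedAddCommGroup V] [NormedSpace ℝ V]
  [NormedAddCommGroup W] [NormedSpace ℝ W] [NormedAddCommGroup E] [NormedSpace ℝ E]
  [NormedAddCommGroup F] [NormedSpace ℝ F] [NormedAddCommGroup G] [NormedSpace ℝ G]

/-- The seminorms of a product `u φ`, with the dependence on the bounds of `u` made explicit. -/
theorem norm_iteratedFDeriv_mul_schwartz_le {u : E → ℂ} (hu : ContDiff ℝ ∞ u) {A : ℝ} (hA : 0 ≤ A)
    {k n : ℕ} (h : ∀ j ≤ n, ∀ x, ‖iteratedFDeriv ℝ j u x‖ ≤ A * (1 + ‖x‖) ^ k) (l : ℕ)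
    (φ : 𝓢(E, ℂ)) (x : E) :
    ‖x‖ ^ l * ‖iteratedFDeriv ℝ n (fun x => u x * φ x) x‖ ≤
      A * (2 ^ n * 2 ^ (l + k)) * (Finset.Iic (l + k, n)).sup (schwartzSeminormFamily ℂ E ℂ) φ := by
  set S := (Finset.Iic (l + k, n)).sup (schwartzSeminormFamily ℂ E ℂ) φ
  have h1 := norm_iteratedFDeriv_mul_le hu (φ.smooth ⊤) x (mod_cast le_top : (n : WithTop ℕ∞) ≤ ∞)
  calc _ ≤ (1 + ‖x‖) ^ l * ∑ i ∈ Finset.range (n + 1), (n.choose i : ℝ) *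
        ‖iteratedFDeriv ℝ i u x‖ * ‖iteratedFDeriv ℝ (n - i) φ x‖ := by
        gcongr
        simp
    _ ≤ (1 + ‖x‖) ^ l * ∑ i ∈ Finset.range (n + 1), (n.choose i : ℝ) *
        (A * (1 + ‖x‖) ^ k) * ‖iteratedFDeriv ℝ (n - i) φ x‖ := by
        gcongr with i hi
        exact h i (by grind) x
    _ = ∑ i ∈ Finset.range (n + 1), (n.choose i : ℝ) *
        (A * ((1 + ‖x‖) ^ (l + k) * ‖iteratedFDeriv ℝ (n - i) φ x‖)) := by
        rw [Finset.mul_sum, pow_add]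
        refine Finset.sum_congr rfl fun i _ => by ring
    _ ≤ ∑ i ∈ Finset.range (n + 1), (n.choose i : ℝ) * (A * (2 ^ (l + k) * S)) := by
        refine Finset.sum_le_sum fun i _ => mul_le_mul_of_nonneg_left
          (mul_le_mul_of_nonneg_left ?_ hA) (Nat.cast_nonneg _)
        exact one_add_le_sup_seminorm_apply (𝕜 := ℂ) (m := (l + k, n)) le_rfl (Nat.sub_le n i) φ x
    _ = _ := by
        rw [← Finset.sum_mul]
        have : ∑ j ∈ Finset.range (n + 1), (n.choose j : ℝ) = 2 ^ n := by
          exact_mod_cast Nat.sum_range_choose n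
        rw [this]; ring

/-- Multiplication by the members of a temperate family is uniformly continuous on Schwartz
functions. -/
theorem IsTemperateFamily.mul_schwartz_bound {ι : Type} {u : ι → E → ℂ} (hu : IsTemperateFamily u)
    (k n : ℕ) : ∃ (s : Finset (ℕ × ℕ)) (C : ℝ), 0 ≤ C ∧ ∀ i (φ : 𝓢(E, ℂ)) x,
      ‖x‖ ^ k * ‖iteratedFDeriv ℝ n (fun x => u i x * φ x) x‖ ≤
        C * s.sup (schwartzSeminormFamily ℂ E ℂ) φ := by
  obtain ⟨l, C, hC, h⟩ := hu.norm_iteratedFDeriv_le_uniform n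
  exact ⟨_, C * (2 ^ n * 2 ^ (k + l)), by positivity, fun i φ x =>
    norm_iteratedFDeriv_mul_schwartz_le (hu.1 i) hC (fun j hj x => h j hj i x) k φ x⟩

theorem iteratedFDeriv_slice (κ : 𝓢(V × W, ℂ)) (X : V) (n : ℕ) (y : W) :
    iteratedFDeriv ℝ n (slice κ X) y =
      (iteratedFDeriv ℝ n κ (X, y)).compContinuousLinearMap fun _ =>
        ContinuousLinearMap.inr ℝ V W := by
  have e : (slice κ X : W → ℂ) = (fun p => κ ((X, 0) + p)) ∘ ContinuousLinearMap.inr ℝ V W := by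
    ext y
    simp [slice_apply]
  have hs : ContDiff ℝ n (fun p => κ ((X, 0) + p)) :=
    (κ.smooth n).comp (contDiff_const.add contDiff_id)
  rw [e, (ContinuousLinearMap.inr ℝ V W).iteratedFDeriv_comp_right hs y le_rfl,
    iteratedFDeriv_comp_add_left]
  simp

theorem seminorm_slice_sub_le (κ : 𝓢(V × W, ℂ)) (X X₀ : V) (k n : ℕ) :
    SchwartzMap.seminorm ℝ k n (slice κ X - slice κ X₀) ≤
      ‖X - X₀‖ * SchwartzMap.seminorm ℝ k (n + 1) κ := by
  refine SchwartzMap.seminorm_le_bound ℝ k n _ (by positivity) fun y => ?_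
  have hd : ∀ Z : V, DifferentiableAt ℝ
      (fun Z : V => (‖y‖ ^ k) • iteratedFDeriv ℝ n κ (Z, y)) Z := fun Z => by
    have h1 := (κ.smooth (n + 1)).differentiable_iteratedFDeriv (m := n) (mod_cast Nat.lt_succ_self n)
    exact (((h1 (Z, y)).comp Z
      (by fun_prop : DifferentiableAt ℝ (fun Z : V => (Z, y)) Z)).const_smul (‖y‖ ^ k))
  have hb : ∀ Z ∈ (Set.univ : Set V), ‖fderiv ℝ
      (fun Z : V => (‖y‖ ^ k) • iteratedFDeriv ℝ n κ (Z, y)) Z‖ ≤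
        SchwartzMap.seminorm ℝ k (n + 1) κ := fun Z _ => by
    have h1 := (κ.smooth (n + 1)).differentiable_iteratedFDeriv (m := n)
      (mod_cast Nat.lt_succ_self n)
    have h2 : HasFDerivAt (fun Z : V => (‖y‖ ^ k) • iteratedFDeriv ℝ n κ (Z, y))
        ((‖y‖ ^ k) • (fderiv ℝ (iteratedFDeriv ℝ n κ) (Z, y)).comp
          (ContinuousLinearMap.inl ℝ V W)) Z := by
      have h0 : HasFDerivAt (fun Z : V => iteratedFDeriv ℝ n κ (Z, y)) _ Z :=
        (h1 (Z, y)).hasFDerivAt.comp Z (hasFDerivAt_prodMk_left Z y)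
      exact h0.const_smul (‖y‖ ^ k)
    have h4 : ∀ L : V →L[ℝ] (ContinuousMultilinearMap ℝ (fun _ : Fin n => V × W) ℂ),
        ‖(‖y‖ ^ k) • L‖ = ‖y‖ ^ k * ‖L‖ := fun L => by
      have := NormedSpace.toNormSMulClass (𝕜 := ℝ)
        (E := V →L[ℝ] (ContinuousMultilinearMap ℝ (fun _ : Fin n => V × W) ℂ))
      rw [norm_smul, norm_pow, norm_norm]
    rw [h2.fderiv, h4]
    have h3 := (ContinuousLinearMap.opNorm_comp_le (fderiv ℝ (iteratedFDeriv ℝ n κ) (Z, y))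
      (ContinuousLinearMap.inl ℝ V W)).trans (mul_le_of_le_one_right (norm_nonneg _)
        (ContinuousLinearMap.norm_inl_le_one ℝ V W))
    rw [norm_fderiv_iteratedFDeriv] at h3
    refine le_trans ?_ (κ.le_seminorm ℝ k (n + 1) (Z, y))
    gcongr
    exact norm_snd_le (Z, y)
  have key := convex_univ.norm_image_sub_le_of_norm_fderiv_le (fun Z _ => hd Z) hb
    (Set.mem_univ X₀) (Set.mem_univ X)
  have e : iteratedFDeriv ℝ n (slice κ X - slice κ X₀) y =
      (iteratedFDeriv ℝ n κ (X, y) - iteratedFDeriv ℝ n κ (X₀, y)).compContinuousLinearMap fun _ =>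
        ContinuousLinearMap.inr ℝ V W := by
    have : ((slice κ X - slice κ X₀ : 𝓢(W, ℂ)) : W → ℂ) =
      (slice κ X : W → ℂ) - (slice κ X₀ : W → ℂ) := rfl
    rw [this, iteratedFDeriv_sub_apply (((slice κ X).smooth n).contDiffAt)
      (((slice κ X₀).smooth n).contDiffAt), iteratedFDeriv_slice, iteratedFDeriv_slice]
    rfl
  rw [e]
  rw [← smul_sub, norm_smul, norm_pow, norm_norm] at key
  calc _ ≤ ‖y‖ ^ k * ‖iteratedFDeriv ℝ n κ (X, y) - iteratedFDeriv ℝ n κ (X₀, y)‖ := by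
        gcongr
        refine (ContinuousMultilinearMap.norm_compContinuousLinearMap_le _ _).trans ?_
        exact mul_le_of_le_one_right (norm_nonneg _) (Finset.prod_le_one
          (fun _ _ => norm_nonneg _) fun _ _ => ContinuousLinearMap.norm_inr_le_one ℝ V W)
    _ ≤ _ := by rw [mul_comm ‖X - X₀‖]; exact key

theorem continuous_slice (κ : 𝓢(V × W, ℂ)) : Continuous (slice κ) := by
  refine continuous_iff_continuousAt.2 fun X₀ => ?_
  refine ((schwartz_withSeminorms ℝ W ℂ).tendsto_nhds _ _).2 fun m ε hε => ?_
  have h : Continuous fun X => ‖X - X₀‖ * SchwartzMap.seminorm ℝ m.1 (m.2 + 1) κ := by fun_prop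
  filter_upwards [h.continuousAt.eventually_lt_const (by simpa using hε : _ < ε)] with X hX
  exact (seminorm_slice_sub_le κ X X₀ m.1 m.2).trans_lt hX

/-- Pointwise evaluation is jointly continuous. -/
theorem continuous_eval_schwartz {A : Type} [TopologicalSpace A] {Φ : A → 𝓢(E, F)}
    (hΦ : Continuous Φ) : Continuous fun p : A × E => Φ p.1 p.2 := by
  have h : Continuous fun a => toBoundedContinuousFunctionCLM ℝ E F (Φ a) :=
    (toBoundedContinuousFunctionCLM ℝ E F).continuous.comp hΦ
  exact (h.comp continuous_fst).eval continuous_snd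

theorem exists_schwartz_eventually_eq_one [FiniteDimensional ℝ E] (x₀ : E) :
    ∃ ρ : 𝓢(E, ℂ), ∀ᶠ x in nhds x₀, ρ x = 1 := by
  let f : ContDiffBump x₀ := ⟨1, 2, by norm_num, by norm_num⟩
  have hc : HasCompactSupport fun x => (f x : ℂ) := f.hasCompactSupport.comp_left (g := Complex.ofReal) rfl
  refine ⟨hc.toSchwartzMap (Complex.ofRealCLM.contDiff.comp f.contDiff), ?_⟩
  filter_upwards [f.eventuallyEq_one] with x hx
  change (f x : ℂ) = 1
  simp [hx]

/-- The linear change of variables `(a, x) ↦ (a, x - a)`. -/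
def shearEquiv (E : Type) [NormedAddCommGroup E] [NormedSpace ℝ E] : (E × E) ≃L[ℝ] E × E :=
  ContinuousLinearEquiv.equivOfInverse
    ((ContinuousLinearMap.fst ℝ E E).prod
      (ContinuousLinearMap.snd ℝ E E - ContinuousLinearMap.fst ℝ E E))
    ((ContinuousLinearMap.fst ℝ E E).prod
      (ContinuousLinearMap.snd ℝ E E + ContinuousLinearMap.fst ℝ E E))
    (fun p => by ext1 <;> simp) (fun p => by ext1 <;> simp)

/-- The translates of a Schwartz function depend continuously on the translation. -/
theorem continuous_translate [FiniteDimensional ℝ E] (γ : 𝓢(E, ℂ)) :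
    Continuous fun a => γ.compSubConstCLM ℂ a := by
  refine continuous_iff_continuousAt.2 fun a₀ => ?_
  obtain ⟨ρ, hρ⟩ := exists_schwartz_eventually_eq_one a₀
  have h := (continuous_slice (SchwartzMap.compCLMOfContinuousLinearEquiv ℂ (shearEquiv E)
    (tensor ρ γ))).continuousAt (x := a₀)
  refine h.congr ?_
  filter_upwards [hρ] with a ha
  ext x
  simp only [slice_apply, SchwartzMap.compCLMOfContinuousLinearEquiv_apply, Function.comp_apply]
  change ρ a * γ (x - a) = γ (x - a)
  rw [ha, one_mul]

/-- Composition of Schwartz functions with a linear map that does not decrease norms. -/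
def pullback (L : E →L[ℝ] F) (hL : ∀ x, ‖x‖ ≤ ‖L x‖) : 𝓢(F, ℂ) →L[ℂ] 𝓢(E, ℂ) :=
  SchwartzMap.compCLM ℂ L.hasTemperateGrowth ⟨1, 1, fun x => by
    have := hL x
    simp only [pow_one, one_mul]
    linarith⟩

/-- Multiplication by a function of temperate growth. -/
def mulCLM {u : E → ℂ} (hu : u.HasTemperateGrowth) : 𝓢(E, ℂ) →L[ℂ] 𝓢(E, ℂ) :=
  SchwartzMap.bilinLeftCLM (ContinuousLinearMap.mul ℂ ℂ) hu

theorem mulCLM_apply {u : E → ℂ} (hu : u.HasTemperateGrowth) (f : 𝓢(E, ℂ)) (x : E) :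
    mulCLM hu f x = f x * u x := rfl

section ParametricIntegral
variable {A : Type} [TopologicalSpace A] [SecondCountableTopology A] [MeasurableSpace A]
  [OpensMeasurableSpace A] {μ : Measure A}

theorem aestronglyMeasurable_eval_schwartz {Φ : A → 𝓢(E, F)} (hΦ : Continuous Φ) (x : E) :
    AEStronglyMeasurable (fun a => Φ a x) μ := by
  have h : Continuous fun a => Φ a x :=
    (continuous_eval_schwartz hΦ).comp (continuous_id.prodMk continuous_const)
  exact h.aestronglyMeasurable

/-- Differentiation under the integral sign, for an integral of Schwartz functions. -/
theorem contDiff_integral_schwartz (n : ℕ) : ∀ (F : Type) [NormedAddCommGroup F] [NormedSpace ℝ F]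
    [CompleteSpace F] (Φ : A → 𝓢(E, F)), Continuous Φ →
    (∀ (j : ℕ) (r : ℝ), ∃ b : A → ℝ, Integrable b μ ∧
      ∀ a x, ‖x‖ ≤ r → ‖iteratedFDeriv ℝ j (Φ a) x‖ ≤ b a) →
    ContDiff ℝ n (fun x => ∫ a, Φ a x ∂μ) ∧
      ∀ x, iteratedFDeriv ℝ n (fun x => ∫ a, Φ a x ∂μ) x = ∫ a, iteratedFDeriv ℝ n (Φ a) x ∂μ := by
  have hderiv : ∀ (F : Type) [NormedAddCommGroup F] [NormedSpace ℝ F] [CompleteSpace F]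
      (Φ : A → 𝓢(E, F)), Continuous Φ →
      (∀ (j : ℕ) (r : ℝ), ∃ b : A → ℝ, Integrable b μ ∧
        ∀ a x, ‖x‖ ≤ r → ‖iteratedFDeriv ℝ j (Φ a) x‖ ≤ b a) → ∀ x₀,
      HasFDerivAt (fun x => ∫ a, Φ a x ∂μ) (∫ a, SchwartzMap.fderivCLM ℝ E F (Φ a) x₀ ∂μ) x₀ := by
    intro F _ _ _ Φ hΦ hb x₀
    obtain ⟨b₀, hb₀, h₀⟩ := hb 0 ‖x₀‖
    obtain ⟨b₁, hb₁, h₁⟩ := hb 1 (‖x₀‖ + 1)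
    have hΦ' : Continuous fun a => SchwartzMap.fderivCLM ℝ E F (Φ a) :=
      (SchwartzMap.fderivCLM ℝ E F).continuous.comp hΦ
    refine hasFDerivAt_integral_of_dominated_of_fderiv_le (μ := μ)
      (F' := fun x a => SchwartzMap.fderivCLM ℝ E F (Φ a) x) (Metric.ball_mem_nhds x₀ one_pos)
      (.of_forall fun x => aestronglyMeasurable_eval_schwartz hΦ x) ?_
      (aestronglyMeasurable_eval_schwartz hΦ' x₀) (bound := b₁) ?_ hb₁ ?_
    · refine hb₀.mono' (aestronglyMeasurable_eval_schwartz hΦ x₀) (.of_forall fun a => ?_)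
      simpa using h₀ a x₀ le_rfl
    · refine .of_forall fun a x hx => ?_
      have hx' : ‖x‖ ≤ ‖x₀‖ + 1 := by
        have := norm_le_norm_add_norm_sub' x x₀
        rw [mem_ball_iff_norm] at hx
        linarith
      have := h₁ a x hx'
      rwa [← zero_add 1, ← norm_iteratedFDeriv_fderiv, norm_iteratedFDeriv_zero] at this
    · exact .of_forall fun a x _ => (Φ a).hasFDerivAt x
  induction n with
  | zero =>
    intro F _ _ _ Φ hΦ hb
    refine ⟨contDiff_zero.2 (continuous_iff_continuousAt.2 fun x =>
      (hderiv F Φ hΦ hb x).continuousAt), fun x => ?_⟩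
    simp only [iteratedFDeriv_zero_eq_comp, Function.comp_apply]
    exact ((continuousMultilinearCurryFin0 ℝ E F).symm.toContinuousLinearEquiv.integral_comp_comm
      (fun a => Φ a x)).symm
  | succ n ih =>
    intro F _ _ _ Φ hΦ hb
    have hΦ' : Continuous fun a => SchwartzMap.fderivCLM ℝ E F (Φ a) :=
      (SchwartzMap.fderivCLM ℝ E F).continuous.comp hΦ
    obtain ⟨h1, h2⟩ := ih (E →L[ℝ] F) (fun a => SchwartzMap.fderivCLM ℝ E F (Φ a)) hΦ'
      fun j r => by
        obtain ⟨b, hb, h⟩ := hb (j + 1) r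
        refine ⟨b, hb, fun a x hx => ?_⟩
        change ‖iteratedFDeriv ℝ j (fderiv ℝ (Φ a)) x‖ ≤ b a
        rw [norm_iteratedFDeriv_fderiv]
        exact h a x hx
    have hfd : fderiv ℝ (fun x => ∫ a, Φ a x ∂μ) =
        fun x => ∫ a, SchwartzMap.fderivCLM ℝ E F (Φ a) x ∂μ :=
      funext fun x => (hderiv F Φ hΦ hb x).fderiv
    refine ⟨?_, fun x => ?_⟩
    · push_cast
      refine contDiff_succ_iff_fderiv.2 ⟨fun x => (hderiv F Φ hΦ hb x).differentiableAt,
        by simp, ?_⟩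
      rw [hfd]; exact h1
    · simp only [iteratedFDeriv_succ_eq_comp_right, Function.comp_apply]
      rw [hfd, h2 x]
      exact ((continuousMultilinearCurryRightEquiv' ℝ n E F).symm.toContinuousLinearEquiv.integral_comp_comm
        (fun a => iteratedFDeriv ℝ n (fderiv ℝ (Φ a)) x)).symm
end ParametricIntegral

section IntegrateOut
variable [FiniteDimensional ℝ W] [MeasureSpace W] [BorelSpace W]
  [(volume : Measure W).IsAddHaarMeasure]

/-- The partial integral `v ↦ ∫ f(v, w) dw`, as the partial Fourier transform at frequency `0`. -/
def integrateOut (V : Type) [NormedAddCommGroup V] [NormedSpace ℝ V] (β : W →L[ℝ] W →L[ℝ] ℝ)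
    (hβ : ∀ η, ‖η‖ ≤ ‖β η‖) : 𝓢(V × W, ℂ) →L[ℂ] 𝓢(V, ℂ) :=
  (pullback (ContinuousLinearMap.inl ℝ V W) fun x => by simp).comp (partialFourier β hβ)

theorem integrateOut_apply (β : W →L[ℝ] W →L[ℝ] ℝ) (hβ : ∀ η, ‖η‖ ≤ ‖β η‖) (f : 𝓢(V × W, ℂ))
    (v : V) : integrateOut V β hβ f v = ∫ w, f (v, w) := by
  change partialFourier β hβ f (v, 0) = _
  rw [partialFourier_apply]
  simp
end IntegrateOut

end SchwartzTools

/-! ### Density of tensor products, and uniqueness of distributional kernels -/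

section Density
variable {V W E : Type} [NormedAddCommGroup V] [NormedSpace ℝ V]
  [NormedAddCommGroup W] [NormedSpace ℝ W] [NormedAddCommGroup E] [NormedSpace ℝ E]

theorem slice_decay (κ : 𝓢(V × W, ℂ)) (M k n : ℕ) : ∃ C : ℝ, 0 ≤ C ∧ ∀ X y,
    ‖y‖ ^ k * ‖iteratedFDeriv ℝ n (slice κ X) y‖ ≤ C * (1 + ‖X‖) ^ (-(M : ℝ)) := by
  refine ⟨2 ^ (M + k) * (Finset.Iic (M + k, n)).sup (schwartzSeminormFamily ℝ (V × W) ℂ) κ,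
    by positivity, fun X y => ?_⟩
  have h := one_add_le_sup_seminorm_apply (𝕜 := ℝ) (m := (M + k, n)) le_rfl le_rfl κ (X, y)
  have h1 : ‖iteratedFDeriv ℝ n (slice κ X) y‖ ≤ ‖iteratedFDeriv ℝ n κ (X, y)‖ := by
    rw [iteratedFDeriv_slice]
    refine (ContinuousMultilinearMap.norm_compContinuousLinearMap_le _ _).trans ?_
    exact mul_le_of_le_one_right (norm_nonneg _) (Finset.prod_le_one
      (fun _ _ => norm_nonneg _) fun _ _ => ContinuousLinearMap.norm_inr_le_one ℝ V W)
  rw [Real.rpow_neg (by positivity), Real.rpow_natCast, ← div_eq_mul_inv,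
    le_div_iff₀ (by positivity)]
  refine le_trans ?_ h
  have hX : ‖X‖ ≤ ‖(X, y)‖ := norm_fst_le (X, y)
  have hy : ‖y‖ ≤ 1 + ‖(X, y)‖ := (norm_snd_le (X, y)).trans (by simp)
  calc ‖y‖ ^ k * ‖iteratedFDeriv ℝ n (slice κ X) y‖ * (1 + ‖X‖) ^ M
      = ((1 + ‖X‖) ^ M * ‖y‖ ^ k) * ‖iteratedFDeriv ℝ n (slice κ X) y‖ := by ring
    _ ≤ ((1 + ‖(X, y)‖) ^ M * (1 + ‖(X, y)‖) ^ k) * ‖iteratedFDeriv ℝ n κ (X, y)‖ := by gcongr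
    _ = _ := by rw [← pow_add]

/-- A continuous function that integrates to zero against every Schwartz function vanishes. -/
theorem eq_zero_of_forall_integral_schwartz_mul [FiniteDimensional ℝ E] [MeasureSpace E]
    [BorelSpace E] [(volume : Measure E).IsAddHaarMeasure] {f : E → ℂ} (hf : Continuous f)
    (h : ∀ γ : 𝓢(E, ℂ), ∫ x, γ x * f x = 0) : f = 0 := by
  have h1 := ae_eq_zero_of_integral_contDiff_smul_eq_zero (μ := (volume : Measure E))
    hf.locallyIntegrable fun g hg hgc => by
      have hc : HasCompactSupport fun x => (g x : ℂ) := hgc.comp_left (g := Complex.ofReal) rfl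
      have := h (hc.toSchwartzMap (Complex.ofRealCLM.contDiff.comp hg))
      refine Eq.trans (integral_congr_ae (.of_forall fun x => ?_)) this
      exact Complex.real_smul
  exact (Continuous.ae_eq_iff_eq volume hf continuous_const).1 h1

/-- The Banach space of families of bounded continuous functions that receives the weighted
derivatives `‖y‖^k D^n φ(y)`, `(k, n) ∈ s`, of a Schwartz function `φ`. -/
def JetSpace (s : Finset (ℕ × ℕ)) (W : Type) [NormedAddCommGroup W] [NormedSpace ℝ W] : Type :=
  (i : s) → BoundedContinuousFunction W (ContinuousMultilinearMap ℝ (fun _ : Fin i.1.2 => W) ℂ)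

namespace JetSpace
variable (s : Finset (ℕ × ℕ))

instance : NormedAddCommGroup (JetSpace s W) := Pi.normedAddCommGroup
instance : NormedSpace ℂ (JetSpace s W) := Pi.normedSpace
instance : NormedSpace ℝ (JetSpace s W) := NormedSpace.complexToReal
instance : CompleteSpace (JetSpace s W) := inferInstanceAs (CompleteSpace ((i : s) →
  BoundedContinuousFunction W (ContinuousMultilinearMap ℝ (fun _ : Fin i.1.2 => W) ℂ)))

variable {s}

theorem norm_le_iff {z : JetSpace s W} {r : ℝ} (hr : 0 ≤ r) : ‖z‖ ≤ r ↔ ∀ i y, ‖z i y‖ ≤ r := by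
  have h1 : ‖z‖ ≤ r ↔ ∀ i, ‖z i‖ ≤ r := pi_norm_le_iff_of_nonneg hr
  simp only [h1, BoundedContinuousFunction.norm_le hr]

theorem ext {z z' : JetSpace s W} (h : ∀ i y, z i y = z' i y) : z = z' :=
  funext fun i => BoundedContinuousFunction.ext fun y => h i y

/-- Evaluation at a point, as a continuous linear map. -/
def eval (i : s) (y : W) :
    JetSpace s W →L[ℂ] ContinuousMultilinearMap ℝ (fun _ : Fin i.1.2 => W) ℂ :=
  LinearMap.mkContinuous
    { toFun := fun z => z i y
      map_add' := fun _ _ => rfl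
      map_smul' := fun _ _ => rfl } 1
    fun z => by
      rw [one_mul]
      exact (norm_le_iff (norm_nonneg z)).1 le_rfl i y

end JetSpace

/-- The embedding `φ ↦ (‖y‖^k D^n φ(y))_{(k, n) ∈ s}` of the Schwartz functions, for which the norm
is the maximum of the Schwartz seminorms with index in `s`. -/
def seminormEmbedding (s : Finset (ℕ × ℕ)) (W : Type) [NormedAddCommGroup W] [NormedSpace ℝ W] :
    𝓢(W, ℂ) →L[ℂ] JetSpace s W :=
  SchwartzMap.mkCLMtoNormedSpace (G := JetSpace s W)
    (fun φ i => BoundedContinuousFunction.ofNormedAddCommGroup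
      (fun y => (‖y‖ ^ i.1.1) • iteratedFDeriv ℝ i.1.2 φ y)
      ((continuous_norm.pow _).smul ((φ.smooth ⊤).continuous_iteratedFDeriv (mod_cast le_top)))
      (SchwartzMap.seminorm ℂ i.1.1 i.1.2 φ) fun y => by
        rw [norm_smul, norm_pow, norm_norm]
        exact φ.le_seminorm ℂ i.1.1 i.1.2 y)
    (fun φ ψ => by
      refine JetSpace.ext fun i y => ?_
      change (‖y‖ ^ i.1.1) • iteratedFDeriv ℝ i.1.2 ((φ : W → ℂ) + (ψ : W → ℂ)) y = _
      rw [iteratedFDeriv_add_apply (φ.smooth _).contDiffAt (ψ.smooth _).contDiffAt, smul_add]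
      rfl)
    (fun c φ => by
      refine JetSpace.ext fun i y => ?_
      change (‖y‖ ^ i.1.1) • iteratedFDeriv ℝ i.1.2 (c • (φ : W → ℂ)) y = _
      rw [iteratedFDeriv_const_smul_apply (φ.smooth _).contDiffAt, smul_comm]
      rfl)
    ⟨s, 1, zero_le_one, fun φ => by
      rw [one_mul]
      refine (JetSpace.norm_le_iff (apply_nonneg _ _)).2 fun i y => ?_
      change ‖(‖y‖ ^ i.1.1) • iteratedFDeriv ℝ i.1.2 φ y‖ ≤ _
      rw [norm_smul, norm_pow, norm_norm]
      exact (φ.le_seminorm ℂ i.1.1 i.1.2 y).trans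
        (Seminorm.le_def.1 (Finset.le_sup (f := schwartzSeminormFamily ℂ W ℂ) i.2) φ)⟩

theorem seminormEmbedding_apply (s : Finset (ℕ × ℕ)) (φ : 𝓢(W, ℂ)) (i : s) (y : W) :
    seminormEmbedding s W φ i y = (‖y‖ ^ i.1.1) • iteratedFDeriv ℝ i.1.2 φ y := rfl

/-- A tempered distribution factors through the Banach space of `seminormEmbedding`. -/
theorem exists_factor_seminormEmbedding (k : Dist W) : ∃ (s : Finset (ℕ × ℕ))
    (g : JetSpace s W →L[ℂ] ℂ),
    ∀ φ, k φ = g (seminormEmbedding s W φ) := by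
  obtain ⟨s, C, -, hC⟩ := Seminorm.bound_of_continuous (schwartz_withSeminorms ℂ W ℂ)
    (Seminorm.comp (normSeminorm ℂ ℂ) k.toLinearMap) (continuous_norm.comp k.continuous)
  have hJ : ∀ φ, (s.sup (schwartzSeminormFamily ℂ W ℂ)) φ ≤ ‖seminormEmbedding s W φ‖ := by
    intro φ
    refine Seminorm.finset_sup_apply_le (norm_nonneg _) fun i hi => ?_
    refine SchwartzMap.seminorm_le_bound ℂ i.1 i.2 φ (norm_nonneg _) fun y => ?_
    have h1 := (JetSpace.norm_le_iff (norm_nonneg _)).1 (le_refl ‖seminormEmbedding s W φ‖) ⟨i, hi⟩ y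
    rwa [seminormEmbedding_apply, norm_smul, norm_pow, norm_norm] at h1
  have hk : ∀ φ, ‖k φ‖ ≤ C * ‖seminormEmbedding s W φ‖ := fun φ =>
    (hC φ).trans (mul_le_mul_of_nonneg_left (hJ φ) C.coe_nonneg)
  set J := (seminormEmbedding s W).toLinearMap with hJdef
  -- Descend `k` to the range of the embedding, and extend it by the Hahn-Banach theorem.
  have hker : LinearMap.ker J ≤ LinearMap.ker k.toLinearMap := fun φ hφ => by
    have h0 : seminormEmbedding s W φ = 0 := hφ
    have := hk φ
    rw [h0, norm_zero, mul_zero] at this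
    exact norm_le_zero_iff.1 this
  let f₀ : LinearMap.range J →ₗ[ℂ] ℂ :=
    ((LinearMap.ker J).liftQ k.toLinearMap hker).comp J.quotKerEquivRange.symm.toLinearMap
  have hf₀ : ∀ φ, f₀ ⟨J φ, LinearMap.mem_range_self J φ⟩ = k φ := fun φ => by
    have : J.quotKerEquivRange.symm ⟨J φ, LinearMap.mem_range_self J φ⟩ =
        Submodule.Quotient.mk φ := by
      rw [LinearEquiv.symm_apply_eq]
      rfl
    simp only [f₀, LinearMap.comp_apply, LinearEquiv.coe_coe, this]
    rfl
  let f : LinearMap.range J →L[ℂ] ℂ := f₀.mkContinuous C (by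
    rintro ⟨_, φ, rfl⟩
    rw [hf₀]
    exact hk φ)
  obtain ⟨g, hg, -⟩ := exists_extension_norm_eq (LinearMap.range J) f
  refine ⟨s, g, fun φ => ?_⟩
  rw [← hf₀ φ]
  exact (hg ⟨J φ, LinearMap.mem_range_self J φ⟩).symm

/-- Tempered distributions commute with integrals of Schwartz functions over a parameter. -/
theorem dist_integral {A : Type} [TopologicalSpace A] [SecondCountableTopology A]
    [MeasurableSpace A] [OpensMeasurableSpace A] {μ : Measure A} (k : Dist W) {Φ : A → 𝓢(W, ℂ)}
    (hΦ : Continuous Φ) (hb : ∀ j n : ℕ, ∃ b : A → ℝ, Integrable b μ ∧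
      ∀ a y, ‖y‖ ^ j * ‖iteratedFDeriv ℝ n (Φ a) y‖ ≤ b a)
    {θ : 𝓢(W, ℂ)} (hθ : ∀ y, θ y = ∫ a, Φ a y ∂μ) : k θ = ∫ a, k (Φ a) ∂μ := by
  obtain ⟨s, g, hg⟩ := exists_factor_seminormEmbedding k
  have hcont : Continuous fun a => seminormEmbedding s W (Φ a) :=
    (seminormEmbedding s W).continuous.comp hΦ
  have hint : Integrable (fun a => seminormEmbedding s W (Φ a)) μ := by
    choose b hbi h using fun i : ℕ × ℕ => hb i.1 i.2
    refine (integrable_finsetSum s fun i _ => (hbi i).norm).mono' hcont.aestronglyMeasurable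
      (.of_forall fun a => ?_)
    refine (JetSpace.norm_le_iff (Finset.sum_nonneg fun i _ => norm_nonneg _)).2 fun i y => ?_
    rw [seminormEmbedding_apply, norm_smul, norm_pow, norm_norm]
    exact ((h i.1 a y).trans (Real.le_norm_self _)).trans
      (Finset.single_le_sum (f := fun i => ‖b i a‖) (fun i _ => norm_nonneg _) i.2)
  have hD := fun n => contDiff_integral_schwartz (μ := μ) n ℂ Φ hΦ fun j r => by
    obtain ⟨b, hbi, h⟩ := hb 0 j
    exact ⟨b, hbi, fun a y _ => by simpa using h a y⟩
  -- The Bochner integral of the embedded functions is the embedding of `θ`, by evaluation at points.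
  have key : seminormEmbedding s W θ = ∫ a, seminormEmbedding s W (Φ a) ∂μ := by
    refine JetSpace.ext fun i y => ?_
    have h1 := (JetSpace.eval i y).integral_comp_comm hint
    refine Eq.trans ?_ h1
    change _ = ∫ a, seminormEmbedding s W (Φ a) i y ∂μ
    simp only [seminormEmbedding_apply]
    rw [integral_smul, ← (hD i.1.2).2 y, ← funext hθ]
  rw [hg, key, ← g.integral_comp_comm hint]
  simp only [hg]

section Fubini
variable [FiniteDimensional ℝ V] [MeasureSpace V] [BorelSpace V]
  [(volume : Measure V).IsAddHaarMeasure]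

/-- The partial integral `y ↦ ∫ κ(X, y) dX` over the first variable. -/
def integrateFst (W : Type) [NormedAddCommGroup W] [NormedSpace ℝ W] (β : V →L[ℝ] V →L[ℝ] ℝ)
    (hβ : ∀ η, ‖η‖ ≤ ‖β η‖) : 𝓢(V × W, ℂ) →L[ℂ] 𝓢(W, ℂ) :=
  (integrateOut W β hβ).comp
    (SchwartzMap.compCLMOfContinuousLinearEquiv ℂ (ContinuousLinearEquiv.prodComm ℝ W V))

variable (β : V →L[ℝ] V →L[ℝ] ℝ) (hβ : ∀ η, ‖η‖ ≤ ‖β η‖)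

theorem integrateFst_apply (κ : 𝓢(V × W, ℂ)) (y : W) :
    integrateFst W β hβ κ y = ∫ X, κ (X, y) := integrateOut_apply β hβ _ y

theorem dist_integrateFst (k : Dist W) (κ : 𝓢(V × W, ℂ)) :
    k (integrateFst W β hβ κ) = ∫ X, k (slice κ X) := by
  refine dist_integral k (continuous_slice κ) (fun j n => ?_) (integrateFst_apply β hβ κ)
  obtain ⟨C, -, h⟩ := slice_decay κ (volume : Measure V).integrablePower j n
  exact ⟨_, (Measure.integrable_pow_neg_integrablePower (volume : Measure V)).const_mul C, h⟩

end Fubini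

variable [FiniteDimensional ℝ V] [MeasureSpace V] [BorelSpace V]
  [(volume : Measure V).IsAddHaarMeasure] [FiniteDimensional ℝ W]

/-- Tensor products of Schwartz functions are total: writing `κ_z(x, y) = κ(x - z, y)`, the integral
`∫ γ(z) κ_z dz` is also the integral of the tensor products `γ(· - p) ⊗ κ(p, ·)` over `p`, so that
a distribution `k` that kills these has `∫ γ(z) k(κ_z) dz = 0` for all `γ`, and `k(κ_0) = 0`. -/
theorem dist_eq_zero_of_tensor (β : V →L[ℝ] V →L[ℝ] ℝ) (hβ : ∀ η, ‖η‖ ≤ ‖β η‖)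
    (k : Dist (V × W)) (h : ∀ g f, k (tensor g f) = 0) : k = 0 := by
  ext κ
  have hc : Continuous fun z : V => k (κ.compSubConstCLM ℂ (z, 0)) :=
    k.continuous.comp ((continuous_translate κ).comp (by fun_prop))
  suffices hz : (fun z : V => k (κ.compSubConstCLM ℂ (z, 0))) = 0 by
    have h0 := congrFun hz 0
    have e : κ.compSubConstCLM ℂ ((0, 0) : V × W) = κ := by
      ext p
      rw [SchwartzMap.compSubConstCLM_apply]
      exact congrArg κ (sub_zero p)
    simpa [e] using h0
  refine eq_zero_of_forall_integral_schwartz_mul hc fun γ => ?_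
  -- `κ₁(z, (x, y)) = γ(z) κ(x - z, y)` and `κ₂(p, (x, y)) = κ(p, y) γ(x - p)` have the same integral
  -- over the first variable.
  let e₁ : (V × (V × W)) ≃L[ℝ] V × (V × W) := ContinuousLinearEquiv.equivOfInverse
    ((ContinuousLinearMap.fst ℝ V (V × W)).prod (ContinuousLinearMap.snd ℝ V (V × W) -
      (ContinuousLinearMap.inl ℝ V W).comp (ContinuousLinearMap.fst ℝ V (V × W))))
    ((ContinuousLinearMap.fst ℝ V (V × W)).prod (ContinuousLinearMap.snd ℝ V (V × W) +
      (ContinuousLinearMap.inl ℝ V W).comp (ContinuousLinearMap.fst ℝ V (V × W))))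
    (fun p => by ext1 <;> simp) (fun p => by ext1 <;> simp)
  let p₁ : (V × (V × W)) →L[ℝ] V := ContinuousLinearMap.fst ℝ V (V × W)
  let p₂ : (V × (V × W)) →L[ℝ] V :=
    (ContinuousLinearMap.fst ℝ V W).comp (ContinuousLinearMap.snd ℝ V (V × W))
  let p₃ : (V × (V × W)) →L[ℝ] W :=
    (ContinuousLinearMap.snd ℝ V W).comp (ContinuousLinearMap.snd ℝ V (V × W))
  let q₁ : ((V × W) × V) →L[ℝ] V :=
    (ContinuousLinearMap.fst ℝ V W).comp (ContinuousLinearMap.fst ℝ (V × W) V)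
  let q₂ : ((V × W) × V) →L[ℝ] W :=
    (ContinuousLinearMap.snd ℝ V W).comp (ContinuousLinearMap.fst ℝ (V × W) V)
  let q₃ : ((V × W) × V) →L[ℝ] V := ContinuousLinearMap.snd ℝ (V × W) V
  let e₂ : (V × (V × W)) ≃L[ℝ] (V × W) × V := ContinuousLinearEquiv.equivOfInverse
    ((p₁.prod p₃).prod (p₂ - p₁)) (q₁.prod ((q₃ + q₁).prod q₂))
    (fun p => by simp [p₁, p₂, p₃, q₁, q₂, q₃]) (fun p => by simp [p₁, p₂, p₃, q₁, q₂, q₃])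
  let κ₁ : 𝓢(V × (V × W), ℂ) := SchwartzMap.compCLMOfContinuousLinearEquiv ℂ e₁ (tensor γ κ)
  let κ₂ : 𝓢(V × (V × W), ℂ) := SchwartzMap.compCLMOfContinuousLinearEquiv ℂ e₂ (tensor κ γ)
  have hκ₁ : ∀ z x y, κ₁ (z, (x, y)) = γ z * κ (x - z, y) := fun z x y => by
    change γ z * κ ((x, y) - (z, 0)) = _
    simp
  have hκ₂ : ∀ p x y, κ₂ (p, (x, y)) = κ (p, y) * γ (x - p) := fun z x y => rfl
  have hω : integrateFst (V × W) β hβ κ₁ = integrateFst (V × W) β hβ κ₂ := by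
    ext ⟨x, y⟩
    rw [integrateFst_apply, integrateFst_apply, ← integral_sub_left_eq_self _ volume x]
    refine integral_congr_ae (.of_forall fun p => ?_)
    simp only [hκ₁, hκ₂, sub_sub_cancel]
    ring
  have h1 := dist_integrateFst β hβ k κ₁
  have h2 := dist_integrateFst β hβ k κ₂
  have hs₁ : ∀ z, slice κ₁ z = γ z • κ.compSubConstCLM ℂ (z, 0) := fun z => by
    ext ⟨x, y⟩
    rw [slice_apply, hκ₁, smul_apply, SchwartzMap.compSubConstCLM_apply]
    simp
  have hs₂ : ∀ p, slice κ₂ p = tensor (γ.compSubConstCLM ℂ p) (slice κ p) := fun p => by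
    ext ⟨x, y⟩
    rw [slice_apply, hκ₂, tensor_apply, SchwartzMap.compSubConstCLM_apply, slice_apply, mul_comm]
  -- Every slice of `κ₂` is a tensor product, so `k` vanishes on its integral.
  simp only [hs₂, h, integral_zero] at h2
  rw [hω, h2] at h1
  simp only [hs₁, map_smul, smul_eq_mul] at h1
  exact h1.symm

theorem kernelMap_injective (β : V →L[ℝ] V →L[ℝ] ℝ) (hβ : ∀ η, ‖η‖ ≤ ‖β η‖) :
    Function.Injective (fun k : Dist (V × W) => kernelMap k) := by
  intro k k' h
  rw [← sub_eq_zero]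
  refine dist_eq_zero_of_tensor β hβ _ fun g f => ?_
  have := congrArg (fun R => R f g) h
  simp only [kernelMap_apply] at this
  rw [sub_apply, this, sub_self]

theorem toDist_injective : Function.Injective (toDist : 𝓢(V, ℂ) → Dist V) := by
  intro f g h
  have h1 : (fun x => f x - g x) = 0 := by
    refine eq_zero_of_forall_integral_schwartz_mul (f.continuous.sub g.continuous) fun γ => ?_
    have h2 := congrArg (fun k => k γ) (sub_eq_zero.2 h)
    rw [← map_sub] at h2
    simp only [toDist_apply, zero_apply] at h2
    rw [← h2]
    refine integral_congr_ae (.of_forall fun x => ?_)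
    simp only [sub_apply]
    ring
  ext x
  exact sub_eq_zero.1 (congrFun h1 x)

end Density

/-! ### Smoothing operators with a given Schwartz kernel -/

section KernelOperators
variable {V W : Type} [NormedAddCommGroup V] [NormedSpace ℝ V]
  [NormedAddCommGroup W] [NormedSpace ℝ W]

/-- The derivative of `t(x, y)` in `x` in the direction `h`. -/
def fstDeriv (h : V) : 𝓢(V × W, ℂ) →L[ℝ] 𝓢(V × W, ℂ) :=
  (SchwartzMap.evalCLM ℝ (V × W) ℂ (h, (0 : W))).comp (SchwartzMap.fderivCLM ℝ (V × W) ℂ)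

theorem fstDeriv_apply (h : V) (t : 𝓢(V × W, ℂ)) (p : V × W) :
    fstDeriv h t p = fderiv ℝ t p (h, 0) := rfl

theorem slice_add (t t' : 𝓢(V × W, ℂ)) (x : V) : slice (t + t') x = slice t x + slice t' x := rfl

theorem slice_smul (c : ℝ) (t : 𝓢(V × W, ℂ)) (x : V) : slice (c • t) x = c • slice t x := rfl

theorem fstDeriv_add_left (h h' : V) (t : 𝓢(V × W, ℂ)) :
    fstDeriv (h + h') t = fstDeriv h t + fstDeriv h' t := by
  ext p
  rw [add_apply, fstDeriv_apply, fstDeriv_apply, fstDeriv_apply, ← map_add]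
  simp

theorem fstDeriv_smul_left (c : ℝ) (h : V) (t : 𝓢(V × W, ℂ)) :
    fstDeriv (c • h) t = c • fstDeriv h t := by
  ext p
  rw [smul_apply, fstDeriv_apply, fstDeriv_apply, ← map_smul]
  simp

theorem dist_slice_add_sub (u : Dist W) (t : 𝓢(V × W, ℂ)) (x h : V) :
    u (slice t (x + h)) - u (slice t x) =
      ∫ s in (0:ℝ)..1, u (slice (fstDeriv h t) (x + s • h)) := by
  rw [← map_sub, intervalIntegral.integral_of_le zero_le_one]
  refine dist_integral u ((continuous_slice _).comp (by fun_prop)) (fun j n => ?_) fun y => ?_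
  · obtain ⟨C, -, hC⟩ := slice_decay (fstDeriv h t) 0 j n
    exact ⟨fun _ => C, integrable_const C, fun s y => by simpa using hC (x + s • h) y⟩
  · rw [← intervalIntegral.integral_of_le zero_le_one]
    have hd : ∀ s : ℝ, HasDerivAt (fun s : ℝ => t (x + s • h, y))
        (fstDeriv h t (x + s • h, y)) s := fun s => by
      have h1 : HasDerivAt (fun s : ℝ => (x + s • h, y)) (h, (0 : W)) s := by
        have := ((hasDerivAt_id s).smul_const h).const_add x
        simpa using this.prodMk (hasDerivAt_const s y)
      exact (t.hasFDerivAt (x + s • h, y)).comp_hasDerivAt s h1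
    have hc : Continuous fun s : ℝ => fstDeriv h t (x + s • h, y) :=
      (fstDeriv h t).continuous.comp (by fun_prop)
    have := intervalIntegral.integral_eq_sub_of_hasDerivAt (fun s _ => hd s)
      (hc.intervalIntegrable 0 1)
    refine Eq.trans ?_ this.symm
    simp [slice_apply]

/-- A function whose increments are the integrals of `L` along segments has derivative `L`. -/
theorem hasFDerivAt_of_eq_segment_integral {q : V → ℂ} {L : V → V →L[ℝ] ℂ} (hL : Continuous L)
    (h : ∀ x v, q (x + v) - q x = ∫ s in (0:ℝ)..1, L (x + s • v) v) (x : V) :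
    HasFDerivAt q (L x) x := by
  rw [hasFDerivAt_iff_isLittleO_nhds_zero, Asymptotics.isLittleO_iff]
  intro ε hε
  obtain ⟨δ, hδ, hd⟩ := Metric.continuousAt_iff.1 hL.continuousAt ε hε
  filter_upwards [Metric.ball_mem_nhds (0 : V) hδ] with v hv
  have hv' : ‖v‖ < δ := by simpa using hv
  have hi : ∀ w : V, IntervalIntegrable (fun s : ℝ => L (x + s • v) v) volume 0 1 := fun w => by
    have : Continuous fun s : ℝ => L (x + s • v) v := (hL.comp (by fun_prop)).clm_apply continuous_const
    exact this.intervalIntegrable _ _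
  have e : q (x + v) - q x - L x v = ∫ s in (0:ℝ)..1, (L (x + s • v) v - L x v) := by
    rw [intervalIntegral.integral_sub (hi v) (by simp), ← h]
    simp
  rw [e]
  have := intervalIntegral.norm_integral_le_of_norm_le_const (a := (0:ℝ)) (b := 1) (C := ε * ‖v‖)
    (f := fun s : ℝ => L (x + s • v) v - L x v) fun s hs => by
      rw [Set.uIoc_of_le zero_le_one] at hs
      have h1 : dist (x + s • v) x < δ := by
        rw [dist_eq_norm, add_sub_cancel_left, norm_smul, Real.norm_of_nonneg hs.1.le]
        nlinarith [hs.2, norm_nonneg v]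
      have h2 := (hd h1).le
      rw [dist_eq_norm] at h2
      calc _ = ‖(L (x + s • v) - L x) v‖ := rfl
        _ ≤ _ := ((L (x + s • v) - L x).le_opNorm v).trans (by gcongr)
  simpa using this

variable [FiniteDimensional ℝ V]

/-- The derivative of `x ↦ u(t(x, ·))`. -/
def distSliceDeriv (u : Dist W) (t : 𝓢(V × W, ℂ)) (x : V) : V →L[ℝ] ℂ :=
  ∑ i, ((Module.finBasis ℝ V).coord i).toContinuousLinearMap.smulRight
    (u (slice (fstDeriv (Module.finBasis ℝ V i) t) x))

theorem distSliceDeriv_apply (u : Dist W) (t : 𝓢(V × W, ℂ)) (x h : V) :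
    distSliceDeriv u t x h = u (slice (fstDeriv h t) x) := by
  let F : V →ₗ[ℝ] ℂ :=
    { toFun := fun h => u (slice (fstDeriv h t) x)
      map_add' := fun h h' => by rw [fstDeriv_add_left, slice_add, map_add]
      map_smul' := fun c h => by
        rw [fstDeriv_smul_left, slice_smul, RingHom.id_apply]
        exact (u.restrictScalars ℝ).map_smul c _ }
  change _ = F h
  conv_rhs => rw [← (Module.finBasis ℝ V).sum_repr h, map_sum]
  rw [distSliceDeriv, sum_apply]
  refine Finset.sum_congr rfl fun i _ => ?_
  rw [map_smul]
  rfl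

theorem hasFDerivAt_dist_slice (u : Dist W) (t : 𝓢(V × W, ℂ)) (x : V) :
    HasFDerivAt (fun x => u (slice t x)) (distSliceDeriv u t x) x := by
  refine hasFDerivAt_of_eq_segment_integral (L := distSliceDeriv u t) ?_ (fun x v => ?_) x
  · refine continuous_finsetSum _ fun i _ => ?_
    exact ((ContinuousLinearMap.smulRightL ℝ V ℂ
      ((Module.finBasis ℝ V).coord i).toContinuousLinearMap).continuous).comp
        (u.continuous.comp (continuous_slice _))
  · simp only [distSliceDeriv_apply]
    exact dist_slice_add_sub u t x v

theorem contDiff_dist_slice (u : Dist W) (n : ℕ) : ∀ t : 𝓢(V × W, ℂ),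
    ContDiff ℝ n fun x => u (slice t x) := by
  induction n with
  | zero => exact fun t => contDiff_zero.2 (u.continuous.comp (continuous_slice t))
  | succ n ih =>
    intro t
    push_cast
    refine contDiff_succ_iff_fderiv.2 ⟨fun x => (hasFDerivAt_dist_slice u t x).differentiableAt,
      by simp, ?_⟩
    rw [funext fun x => (hasFDerivAt_dist_slice u t x).fderiv]
    exact ContDiff.sum fun i _ => contDiff_const.smulRight (ih _)

/-- The seminorms of `x ↦ u(t(x, ·))` are controlled by the values of `u` on a bounded set. -/
theorem exists_bounded_dist_slice (k n : ℕ) : ∀ t : 𝓢(V × W, ℂ), ∃ (S : Set 𝓢(W, ℂ)) (C : ℝ),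
    Bornology.IsVonNBounded ℂ S ∧ 0 ≤ C ∧ ∀ (u : Dist W) (ε : ℝ), 0 ≤ ε → (∀ b ∈ S, ‖u b‖ ≤ ε) →
      ∀ x, ‖x‖ ^ k * ‖iteratedFDeriv ℝ n (fun x => u (slice t x)) x‖ ≤ C * ε := by
  induction n with
  | zero =>
    intro t
    -- The functions `‖x‖^k t(x, ·)` form a bounded set.
    refine ⟨Set.range fun x => ((‖x‖ : ℂ) ^ k) • slice t x, 1, ?_, zero_le_one,
      fun u ε _ hu x => ?_⟩
    · rw [(schwartz_withSeminorms ℂ W ℂ).isVonNBounded_iff_seminorm_bounded]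
      rintro ⟨l, m⟩
      obtain ⟨C, hC, h⟩ := slice_decay t k l m
      refine ⟨C + 1, by positivity, ?_⟩
      rintro _ ⟨x, rfl⟩
      rw [map_smul_eq_mul]
      have h1 : SchwartzMap.seminorm ℂ l m (slice t x) ≤ C * (1 + ‖x‖) ^ (-(k : ℝ)) :=
        SchwartzMap.seminorm_le_bound ℂ l m _ (by positivity) (h x)
      rw [Real.rpow_neg (by positivity), Real.rpow_natCast] at h1
      have h2 : ‖x‖ ^ k * ((1 + ‖x‖) ^ k)⁻¹ ≤ 1 := by
        rw [← div_eq_mul_inv, div_le_one (by positivity)]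
        gcongr
        simp
      calc ‖(‖x‖ : ℂ) ^ k‖ * SchwartzMap.seminorm ℂ l m (slice t x)
          ≤ ‖x‖ ^ k * (C * ((1 + ‖x‖) ^ k)⁻¹) := by
            rw [norm_pow, Complex.norm_real, norm_norm]
            gcongr
        _ = C * (‖x‖ ^ k * ((1 + ‖x‖) ^ k)⁻¹) := by ring
        _ ≤ C * 1 := by gcongr
        _ < C + 1 := by linarith
    · have := hu _ ⟨x, rfl⟩
      rw [map_smul, norm_smul, norm_pow, Complex.norm_real, norm_norm] at this
      rwa [norm_iteratedFDeriv_zero, one_mul]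
  | succ n ih =>
    intro t
    choose S C hS hC h using fun i => ih (fstDeriv (Module.finBasis ℝ V i) t)
    -- The derivative of `x ↦ u(t(x, ·))` is assembled from the functions of the same kind for the
    -- partial derivatives of `t`.
    let J : Fin (Module.finrank ℝ V) → ℂ →L[ℝ] V →L[ℝ] ℂ := fun i =>
      ContinuousLinearMap.smulRightL ℝ V ℂ ((Module.finBasis ℝ V).coord i).toContinuousLinearMap
    refine ⟨⋃ i, S i, ∑ i, ‖J i‖ * C i, Bornology.isVonNBounded_iUnion.2 hS,
      Finset.sum_nonneg fun i _ => mul_nonneg (norm_nonneg (J i)) (hC i), fun u ε hε hu x => ?_⟩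
    let f : Fin (Module.finrank ℝ V) → V → ℂ := fun i x =>
      u (slice (fstDeriv (Module.finBasis ℝ V i) t) x)
    have hf : ∀ i, ContDiff ℝ n (f i) := fun i => contDiff_dist_slice u n _
    have hJ : ∀ i, ContDiff ℝ n fun x => J i (f i x) := fun i => (J i).contDiff.comp (hf i)
    have hfd : fderiv ℝ (fun x => u (slice t x)) = fun x => ∑ i, J i (f i x) :=
      funext fun x => (hasFDerivAt_dist_slice u t x).fderiv
    have h1 : ∀ i, ‖x‖ ^ k * ‖iteratedFDeriv ℝ n (fun x => J i (f i x)) x‖ ≤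
        ‖J i‖ * (C i * ε) := fun i => by
      have h2 := (J i).norm_iteratedFDeriv_comp_left (hf i).contDiffAt (x := x) (n := n) le_rfl
      have h3 : ‖x‖ ^ k * ‖iteratedFDeriv ℝ n (f i) x‖ ≤ C i * ε :=
        h i u ε hε (fun b hb => hu b (Set.mem_iUnion_of_mem i hb)) x
      calc _ ≤ ‖x‖ ^ k * (‖J i‖ * ‖iteratedFDeriv ℝ n (f i) x‖) := by gcongr; exact h2
        _ = ‖J i‖ * (‖x‖ ^ k * ‖iteratedFDeriv ℝ n (f i) x‖) := by ring
        _ ≤ _ := mul_le_mul_of_nonneg_left h3 (norm_nonneg (J i))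
    rw [← norm_iteratedFDeriv_fderiv, hfd, iteratedFDeriv_fun_sum_apply fun i _ => (hJ i).contDiffAt]
    calc _ ≤ ‖x‖ ^ k * ∑ i, ‖iteratedFDeriv ℝ n (fun x => J i (f i x)) x‖ := by
          gcongr
          exact norm_sum_le _ _
      _ ≤ ∑ i, ‖J i‖ * (C i * ε) := by
          rw [Finset.mul_sum]
          exact Finset.sum_le_sum fun i _ => h1 i
      _ = _ := by
          rw [Finset.sum_mul]
          exact Finset.sum_congr rfl fun i _ => by ring

/-- The Schwartz function `x ↦ u(t(x, ·))`. -/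
def distSlice (t : 𝓢(V × W, ℂ)) (u : Dist W) : 𝓢(V, ℂ) where
  toFun x := u (slice t x)
  smooth' := contDiff_infty.2 fun n => contDiff_dist_slice u n t
  decay' k n := by
    obtain ⟨S, C, hS, -, h⟩ := exists_bounded_dist_slice k n t
    obtain ⟨r, hr⟩ := (NormedSpace.isVonNBounded_iff ℂ).1 (hS.image u) |>.exists_norm_le
    refine ⟨C * max r 0, fun x => h u _ (le_max_right _ _) (fun b hb => ?_) x⟩
    exact (hr _ ⟨b, hb, rfl⟩).trans (le_max_left _ _)

/-- The operator `S' → S` with kernel `t`, `u ↦ (x ↦ u(t(x, ·)))`. -/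
def kernelOp (t : 𝓢(V × W, ℂ)) : Dist W →L[ℂ] 𝓢(V, ℂ) where
  toFun := distSlice t
  map_add' _ _ := rfl
  map_smul' _ _ := rfl
  cont := by
    let L : Dist W →ₗ[ℂ] 𝓢(V, ℂ) :=
      { toFun := distSlice t
        map_add' := fun _ _ => rfl
        map_smul' := fun _ _ => rfl }
    change Continuous L
    refine continuous_of_continuousAt_zero L ?_
    refine ((schwartz_withSeminorms ℂ V ℂ).tendsto_nhds _ _).2 fun m ε hε => ?_
    obtain ⟨S, C, hS, hC, h⟩ := exists_bounded_dist_slice m.1 m.2 t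
    have hmem := ContinuousLinearMap.hasBasis_nhds_zero (𝕜₁ := ℂ) (𝕜₂ := ℂ) (σ := RingHom.id ℂ)
      (E := 𝓢(W, ℂ)) (F := ℂ) |>.mem_of_mem
        (i := (S, Metric.closedBall 0 (ε / (2 * (C + 1)))))
        ⟨hS, Metric.closedBall_mem_nhds 0 (by positivity)⟩
    filter_upwards [hmem] with u hu
    rw [map_zero, sub_zero]
    have h1 : SchwartzMap.seminorm ℂ m.1 m.2 (L u) ≤ C * (ε / (2 * (C + 1))) :=
      SchwartzMap.seminorm_le_bound ℂ _ _ _ (by positivity)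
        (h u _ (by positivity) fun b hb => by simpa using hu b hb)
    refine h1.trans_lt ?_
    rw [← mul_div_assoc, div_lt_iff₀ (by positivity)]
    nlinarith

theorem kernelOp_apply (t : 𝓢(V × W, ℂ)) (u : Dist W) (x : V) :
    kernelOp t u x = u (slice t x) := rfl

theorem toDist_kernelOp [MeasureSpace V] [BorelSpace V] [MeasureSpace W] [BorelSpace W]
    [FiniteDimensional ℝ W] [(volume : Measure V).IsAddHaarMeasure]
    [(volume : Measure W).IsAddHaarMeasure] (t : 𝓢(V × W, ℂ)) (f : 𝓢(W, ℂ)) :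
    toDist (kernelOp t (toDist f)) = kernelMap (toDist t) f := by
  ext g
  rw [kernelMap_apply, toDist_apply, toDist_apply]
  have h := (SchwartzMap.pairing (ContinuousLinearMap.mul ℂ ℂ) t (tensor g f)).integrable
    (μ := (volume : Measure (V × W)))
  refine Eq.trans ?_ (integral_prod _ h).symm
  refine integral_congr_ae (.of_forall fun x => ?_)
  change (∫ y, f y * t (x, y)) * g x = ∫ y, t (x, y) * (g x * f y)
  rw [← integral_mul_const]
  exact integral_congr_ae (.of_forall fun y => by ring)

end KernelOperators

section Kernels
variable {d : ℕ}

theorem smoothingKernel_kernelOp (t : 𝓢(Conf d × Conf d, ℂ)) : smoothingKernel (kernelOp t) = t := by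
  have h : SmoothingOp.toTempered (kernelOp t) = kernelMap (toDist t) := by
    ext1 f
    exact toDist_kernelOp t f
  rw [smoothingKernel, h]
  refine Function.leftInverse_invFun (f := fun t : 𝓢(Conf d × Conf d, ℂ) =>
    (kernelMap (toDist t) : TemperedOp d)) ?_ t
  refine (kernelMap_injective (innerSL ℝ) fun η => (innerSL_apply_norm ℝ η).ge).comp ?_
  exact toDist_injective

theorem toTempered_kernelOp (t : 𝓢(Conf d × Conf d, ℂ)) :
    SmoothingOp.toTempered (kernelOp t) = kernelMap (toDist t) := by
  ext1 f
  exact toDist_kernelOp t f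

theorem operatorKernel_kernelMap (k : Dist (Conf d × Conf d)) : operatorKernel (kernelMap k) = k :=
  Function.leftInverse_invFun (f := fun k : Dist (Conf d × Conf d) =>
    (kernelMap k : TemperedOp d)) (kernelMap_injective (innerSL ℝ) fun η => (innerSL_apply_norm ℝ η).ge) k

end Kernels

/-! ### Magnetic Weyl quantization of Schwartz symbols -/

section MidpointIntegral
variable {E : Type} [NormedAddCommGroup E] [NormedSpace ℝ E] [FiniteDimensional ℝ E]
  [MeasureSpace E] [BorelSpace E] [(volume : Measure E).IsAddHaarMeasure]

/-- The change of variables to the midpoint and the difference preserves integrals. -/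
theorem integral_comp_midpointEquiv (f : 𝓢(E × E, ℂ)) :
    ∫ p, f (midpointEquiv E p) = ∫ p, f p := by
  let f₁ : 𝓢(E × E, ℂ) := SchwartzMap.compCLMOfContinuousLinearEquiv ℂ (midpointEquiv E) f
  let L : (E × E) ≃L[ℝ] E × E := ContinuousLinearEquiv.equivOfInverse
    ((ContinuousLinearMap.fst ℝ E E - (1 / 2 : ℝ) • ContinuousLinearMap.snd ℝ E E).prod
      (ContinuousLinearMap.snd ℝ E E))
    ((ContinuousLinearMap.fst ℝ E E + (1 / 2 : ℝ) • ContinuousLinearMap.snd ℝ E E).prod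
      (ContinuousLinearMap.snd ℝ E E))
    (fun p => by ext1 <;> simp) (fun p => by ext1 <;> simp)
  let f₂ : 𝓢(E × E, ℂ) := SchwartzMap.compCLMOfContinuousLinearEquiv ℂ L f
  calc ∫ p, f (midpointEquiv E p) = ∫ x, ∫ y, f₁ (x, y) :=
        integral_prod _ (f₁.integrable (μ := (volume : Measure (E × E))))
    _ = ∫ x, ∫ w, f₂ (x, w) := by
        refine integral_congr_ae (.of_forall fun x => ?_)
        change ∫ y, f₁ (x, y) = _
        rw [← integral_sub_left_eq_self _ volume x]
        refine integral_congr_ae (.of_forall fun w => ?_)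
        change f ((1 / 2 : ℝ) • (x + (x - w)), x - (x - w)) = f (x - (1 / 2 : ℝ) • w, w)
        congr 2
        · module
        · simp
    _ = ∫ w, ∫ x, f₂ (x, w) :=
        integral_integral_swap (f₂.integrable (μ := (volume : Measure (E × E))))
    _ = ∫ w, ∫ x, f (x, w) :=
        integral_congr_ae (.of_forall fun w =>
          integral_sub_right_eq_self (fun x => f (x, w)) ((1 / 2 : ℝ) • w))
    _ = ∫ p, f p := (integral_prod_symm _ (f.integrable (μ := (volume : Measure (E × E))))).symm

end MidpointIntegral

/-- The data of a magnetic Weyl calculus with configuration space `E`: a nondegenerate symmetric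
form on `E` for which the Fourier inversion formula holds, and a phase of modulus one, the
circulation phase of a vector potential, that enters only through the flux phases of triangles in
the product of symbols; these have to be temperate, uniformly in the position of the triangle. -/
structure WeylData (E : Type) [NormedAddCommGroup E] [NormedSpace ℝ E] [MeasureSpace E] where
  /-- the form in the exponent of the oscillatory integrals -/
  form : E →L[ℝ] E →L[ℝ] ℝ
  le_norm_form : ∀ η, ‖η‖ ≤ ‖form η‖
  form_symm : ∀ x y, form x y = form y x
  /-- the constant of the Fourier inversion formula -/
  const : ℂ
  const_ne_zero : const ≠ 0
  inversion : ∀ (f : 𝓢(E, ℂ)) (x : E), ∫ ξ, Complex.exp ((form x ξ : ℂ) * Complex.I) *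
    ∫ w, Complex.exp ((form (-ξ) w : ℂ) * Complex.I) * f w = const * f x
  /-- the circulation phase -/
  phase : E × E → ℂ
  phase_hasTemperateGrowth : phase.HasTemperateGrowth
  conj_phase_mul_phase : ∀ p, (starRingEnd ℂ) (phase p) * phase p = 1
  isTemperateFamily_trianglePhase : IsTemperateFamily fun (c : E) (q : E × (E × E)) =>
    trianglePhase phase (c + q.1) q.2.1 q.2.2

namespace WeylData
variable {E : Type} [NormedAddCommGroup E] [NormedSpace ℝ E] [FiniteDimensional ℝ E]
  [MeasureSpace E] [BorelSpace E] [(volume : Measure E).IsAddHaarMeasure] (D : WeylData E)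

theorem conj_phase_hasTemperateGrowth :
    (fun p => (starRingEnd ℂ) (D.phase p)).HasTemperateGrowth :=
  (Complex.conjCLE : ℂ →L[ℝ] ℂ).hasTemperateGrowth.comp D.phase_hasTemperateGrowth

/-- The Fourier integral in the momentum. -/
def fourier : 𝓢(E × E, ℂ) →L[ℂ] 𝓢(E × E, ℂ) := partialFourier D.form D.le_norm_form

theorem fourier_apply (f : 𝓢(E × E, ℂ)) (z η : E) :
    D.fourier f (z, η) = ∫ ξ, Complex.exp ((D.form η ξ : ℂ) * Complex.I) * f (z, ξ) := rfl

/-- The reflection `f(z, η) ↦ f(z, -η)`. -/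
def reflect : 𝓢(E × E, ℂ) →L[ℂ] 𝓢(E × E, ℂ) :=
  SchwartzMap.compCLMOfContinuousLinearEquiv ℂ
    ((ContinuousLinearEquiv.refl ℝ E).prodCongr (ContinuousLinearEquiv.neg ℝ))

theorem fourier_reflect_fourier (f : 𝓢(E × E, ℂ)) :
    D.fourier (reflect (D.fourier f)) = D.const • f := by
  ext ⟨z, x⟩
  exact D.inversion (slice f z) x

theorem fourier_integral_mul (f g : 𝓢(E × E, ℂ)) :
    ∫ p, D.fourier f p * g p = ∫ p, f p * D.fourier g p := by
  have h1 := (SchwartzMap.pairing (ContinuousLinearMap.mul ℂ ℂ) (D.fourier f) g).integrable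
    (μ := (volume : Measure (E × E)))
  have h2 := (SchwartzMap.pairing (ContinuousLinearMap.mul ℂ ℂ) f (D.fourier g)).integrable
    (μ := (volume : Measure (E × E)))
  refine (integral_prod _ h1).trans (Eq.trans ?_ (integral_prod _ h2).symm)
  refine integral_congr_ae (.of_forall fun z => ?_)
  change ∫ w, (∫ ξ, Complex.exp ((D.form w ξ : ℂ) * Complex.I) * f (z, ξ)) * g (z, w) =
    ∫ ξ, f (z, ξ) * ∫ w, Complex.exp ((D.form ξ w : ℂ) * Complex.I) * g (z, w)
  simp only [← integral_mul_const, ← integral_const_mul]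
  rw [integral_integral_swap]
  · refine integral_congr_ae (.of_forall fun ξ => integral_congr_ae (.of_forall fun w => ?_))
    simp only [D.form_symm w ξ]
    ring
  · have h3 := (tensor (slice g z) (slice f z)).integrable (μ := (volume : Measure (E × E)))
    refine h3.mono ?_ (.of_forall fun p => ?_)
    · have hc : Continuous fun p : E × E =>
          Complex.exp ((D.form p.1 p.2 : ℂ) * Complex.I) * f (z, p.2) * g (z, p.1) := by
        have := f.continuous
        have := g.continuous
        fun_prop
      exact hc.aestronglyMeasurable
    · simp only [Function.uncurry, norm_mul, Complex.norm_exp_ofReal_mul_I, one_mul, tensor_apply,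
        slice_apply]
      rw [mul_comm]

/-- The kernel `K f` of the Weyl quantization of the symbol `f`. -/
def weyl : 𝓢(E × E, ℂ) →L[ℂ] 𝓢(E × E, ℂ) :=
  D.const⁻¹ • (mulCLM D.phase_hasTemperateGrowth).comp
    ((SchwartzMap.compCLMOfContinuousLinearEquiv ℂ (midpointEquiv E)).comp D.fourier)

theorem weyl_apply (f : 𝓢(E × E, ℂ)) (p : E × E) :
    D.weyl f p = D.const⁻¹ * (D.fourier f (midpointEquiv E p) * D.phase p) := rfl

/-- The symbol of the operator with a given kernel. -/
def weylSymbol : 𝓢(E × E, ℂ) →L[ℂ] 𝓢(E × E, ℂ) :=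
  reflect.comp (D.fourier.comp ((SchwartzMap.compCLMOfContinuousLinearEquiv ℂ
    (midpointEquiv E).symm).comp (mulCLM D.conj_phase_hasTemperateGrowth)))

theorem weylSymbol_apply (κ : 𝓢(E × E, ℂ)) (m ξ : E) :
    D.weylSymbol κ (m, ξ) = ∫ w, Complex.exp ((D.form (-ξ) w : ℂ) * Complex.I) *
      (κ (m + (1 / 2 : ℝ) • w, m - (1 / 2 : ℝ) • w) *
        (starRingEnd ℂ) (D.phase (m + (1 / 2 : ℝ) • w, m - (1 / 2 : ℝ) • w))) := rfl

theorem weyl_weylSymbol (κ : 𝓢(E × E, ℂ)) : D.weyl (D.weylSymbol κ) = κ := by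
  ext p
  rw [weyl_apply, weylSymbol, ContinuousLinearMap.comp_apply, ContinuousLinearMap.comp_apply,
    fourier_reflect_fourier, smul_apply, ContinuousLinearMap.comp_apply,
    SchwartzMap.compCLMOfContinuousLinearEquiv_apply, Function.comp_apply,
    ContinuousLinearEquiv.symm_apply_apply, mulCLM_apply, smul_eq_mul, mul_assoc, mul_assoc,
    D.conj_phase_mul_phase, mul_one, inv_mul_cancel_left₀ D.const_ne_zero]

/-- The transpose of `weyl`. -/
def weylTranspose : 𝓢(E × E, ℂ) →L[ℂ] 𝓢(E × E, ℂ) :=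
  D.const⁻¹ • D.fourier.comp ((SchwartzMap.compCLMOfContinuousLinearEquiv ℂ
    (midpointEquiv E).symm).comp (mulCLM D.phase_hasTemperateGrowth))

theorem integral_weyl_mul (f χ : 𝓢(E × E, ℂ)) :
    ∫ p, D.weyl f p * χ p = ∫ p, f p * D.weylTranspose χ p := by
  set g : 𝓢(E × E, ℂ) := SchwartzMap.compCLMOfContinuousLinearEquiv ℂ (midpointEquiv E).symm
    (mulCLM D.phase_hasTemperateGrowth χ) with hg
  have h1 := D.fourier_integral_mul f g
  have h2 := integral_comp_midpointEquiv
    (SchwartzMap.pairing (ContinuousLinearMap.mul ℂ ℂ) (D.fourier f) g)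
  have e1 : ∀ p, D.weyl f p * χ p = D.const⁻¹ *
      SchwartzMap.pairing (ContinuousLinearMap.mul ℂ ℂ) (D.fourier f) g (midpointEquiv E p) :=
    fun p => by
      rw [SchwartzMap.pairing_apply_apply, hg, SchwartzMap.compCLMOfContinuousLinearEquiv_apply,
        Function.comp_apply, ContinuousLinearEquiv.symm_apply_apply, mulCLM_apply, weyl_apply,
        ContinuousLinearMap.mul_apply']
      ring
  have e2 : ∀ p, f p * D.weylTranspose χ p = D.const⁻¹ * (f p * D.fourier g p) := fun p => by
    change f p * (D.const⁻¹ * D.fourier g p) = _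
    ring
  simp only [e1, e2, integral_const_mul]
  rw [h2]
  exact congrArg _ h1

theorem weylTranspose_surjective : Function.Surjective D.weylTranspose := by
  intro ψ
  have hu := D.conj_phase_hasTemperateGrowth
  refine ⟨mulCLM hu (SchwartzMap.compCLMOfContinuousLinearEquiv ℂ (midpointEquiv E)
    (reflect (D.fourier ψ))), ?_⟩
  have e : SchwartzMap.compCLMOfContinuousLinearEquiv ℂ (midpointEquiv E).symm
      (mulCLM D.phase_hasTemperateGrowth (mulCLM hu
        (SchwartzMap.compCLMOfContinuousLinearEquiv ℂ (midpointEquiv E)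
          (reflect (D.fourier ψ))))) = reflect (D.fourier ψ) := by
    ext p
    rw [SchwartzMap.compCLMOfContinuousLinearEquiv_apply, Function.comp_apply, mulCLM_apply,
      mulCLM_apply, SchwartzMap.compCLMOfContinuousLinearEquiv_apply, Function.comp_apply,
      ContinuousLinearEquiv.apply_symm_apply, mul_assoc, D.conj_phase_mul_phase, mul_one]
  rw [weylTranspose, smul_apply, ContinuousLinearMap.comp_apply, ContinuousLinearMap.comp_apply, e,
    fourier_reflect_fourier, smul_smul, inv_mul_cancel₀ D.const_ne_zero, one_smul]

/-- The linear map behind the composition of kernels, `((x, y), z) ↦ ((x, z), (z, y))`. -/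
def composeMap (E : Type) [NormedAddCommGroup E] [NormedSpace ℝ E] :
    ((E × E) × E) →L[ℝ] (E × E) × (E × E) :=
  let x := (ContinuousLinearMap.fst ℝ E E).comp (ContinuousLinearMap.fst ℝ (E × E) E)
  let y := (ContinuousLinearMap.snd ℝ E E).comp (ContinuousLinearMap.fst ℝ (E × E) E)
  let z := ContinuousLinearMap.snd ℝ (E × E) E
  (x.prod z).prod (z.prod y)

theorem le_norm_composeMap (p : (E × E) × E) : ‖p‖ ≤ ‖composeMap E p‖ := by
  obtain ⟨⟨x, y⟩, z⟩ := p
  change max (max ‖x‖ ‖y‖) ‖z‖ ≤ max (max ‖x‖ ‖z‖) (max ‖z‖ ‖y‖)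
  grind

/-- The composition `(x, y) ↦ ∫ κ₁(x, z) κ₂(z, y) dz` of kernels. -/
def compose (κ₁ κ₂ : 𝓢(E × E, ℂ)) : 𝓢(E × E, ℂ) :=
  integrateOut (E × E) D.form D.le_norm_form
    (pullback (composeMap E) le_norm_composeMap (tensor κ₁ κ₂))

theorem compose_apply (κ₁ κ₂ : 𝓢(E × E, ℂ)) (x y : E) :
    D.compose κ₁ κ₂ (x, y) = ∫ z, κ₁ (x, z) * κ₂ (z, y) := integrateOut_apply _ _ _ _

theorem continuous_compose : Continuous fun p : 𝓢(E × E, ℂ) × 𝓢(E × E, ℂ) =>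
    D.compose p.1 p.2 := by
  have h1 : Continuous fun p : 𝓢(E × E, ℂ) × 𝓢(E × E, ℂ) => tensor p.1 p.2 :=
    continuous_tensor.comp continuous_swap
  have h2 : Continuous fun p : 𝓢(E × E, ℂ) × 𝓢(E × E, ℂ) =>
      pullback (composeMap E) le_norm_composeMap (tensor p.1 p.2) :=
    (pullback (composeMap E) le_norm_composeMap).continuous.comp h1
  exact (integrateOut (E × E) D.form D.le_norm_form).continuous.comp h2

/-- The magnetic Weyl product of Schwartz symbols. -/
def sharp (f g : 𝓢(E × E, ℂ)) : 𝓢(E × E, ℂ) := D.weylSymbol (D.compose (D.weyl f) (D.weyl g))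

theorem weyl_sharp (f g : 𝓢(E × E, ℂ)) :
    D.weyl (D.sharp f g) = D.compose (D.weyl f) (D.weyl g) := D.weyl_weylSymbol _

theorem continuous_sharp : Continuous fun p : 𝓢(E × E, ℂ) × 𝓢(E × E, ℂ) =>
    D.sharp p.1 p.2 := by
  have hK : Continuous fun f => D.weyl f := D.weyl.continuous
  have hS : Continuous fun κ => D.weylSymbol κ := D.weylSymbol.continuous
  have h1 : Continuous fun p : 𝓢(E × E, ℂ) × 𝓢(E × E, ℂ) => (D.weyl p.1, D.weyl p.2) :=
    (hK.comp continuous_fst).prodMk (hK.comp continuous_snd)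
  have h2 := Continuous.comp (f := fun p : 𝓢(E × E, ℂ) × 𝓢(E × E, ℂ) => (D.weyl p.1, D.weyl p.2))
    D.continuous_compose h1
  exact hS.comp h2

theorem sharp_add_left (f f' g : 𝓢(E × E, ℂ)) :
    D.sharp (f + f') g = D.sharp f g + D.sharp f' g := by
  simp only [sharp, compose, ← map_add]
  congr 3
  rw [map_add]
  ext p
  simp only [tensor_apply, add_apply]
  ring

theorem sharp_add_right (f g g' : 𝓢(E × E, ℂ)) :
    D.sharp f (g + g') = D.sharp f g + D.sharp f g' := by
  simp only [sharp, compose, ← map_add]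
  congr 3
  rw [map_add]
  ext p
  simp only [tensor_apply, add_apply]
  ring

theorem sharp_smul_left (c : ℂ) (f g : 𝓢(E × E, ℂ)) : D.sharp (c • f) g = c • D.sharp f g := by
  simp only [sharp, compose, ← map_smul]
  congr 3
  rw [map_smul]
  ext p
  simp only [tensor_apply, smul_apply, smul_eq_mul]
  ring

theorem sharp_smul_right (c : ℂ) (f g : 𝓢(E × E, ℂ)) : D.sharp f (c • g) = c • D.sharp f g := by
  simp only [sharp, compose, ← map_smul]
  congr 3
  rw [map_smul]
  ext p
  simp only [tensor_apply, smul_apply, smul_eq_mul]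
  ring

end WeylData

/-! ### The product of two localized symbols -/

section SupSeminorm
variable {D E F : Type} [NormedAddCommGroup D] [NormedSpace ℝ D] [NormedAddCommGroup E]
  [NormedSpace ℝ E] [NormedAddCommGroup F] [NormedSpace ℝ F]

/-- The maximum of finitely many Schwartz seminorms. -/
def supSeminorm (E : Type) [NormedAddCommGroup E] [NormedSpace ℝ E] (s : Finset (ℕ × ℕ)) :
    Seminorm ℂ 𝓢(E, ℂ) := s.sup (schwartzSeminormFamily ℂ E ℂ)

theorem supSeminorm_mono {s s' : Finset (ℕ × ℕ)} (h : s ⊆ s') (f : 𝓢(E, ℂ)) :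
    supSeminorm E s f ≤ supSeminorm E s' f :=
  Seminorm.le_def.1 (Finset.sup_mono h) f

theorem supSeminorm_le {s : Finset (ℕ × ℕ)} {f : 𝓢(E, ℂ)} {r : ℝ} (hr : 0 ≤ r)
    (h : ∀ i ∈ s, ∀ x, ‖x‖ ^ i.1 * ‖iteratedFDeriv ℝ i.2 f x‖ ≤ r) : supSeminorm E s f ≤ r :=
  Seminorm.finset_sup_apply_le hr fun i hi => SchwartzMap.seminorm_le_bound ℂ _ _ f hr (h i hi)

/-- A uniform bound of every seminorm of a family of maps gives one for finitely many seminorms. -/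
theorem exists_supSeminorm_le {ι : Type} {A : ι → 𝓢(E, ℂ)} {b : ι → Finset (ℕ × ℕ) → ℝ}
    (hb₀ : ∀ i s, 0 ≤ b i s) (hb : ∀ i s s', s ⊆ s' → b i s ≤ b i s')
    (h : ∀ k n : ℕ, ∃ (s : Finset (ℕ × ℕ)) (C : ℝ), 0 ≤ C ∧ ∀ i x,
      ‖x‖ ^ k * ‖iteratedFDeriv ℝ n (A i) x‖ ≤ C * b i s) (s : Finset (ℕ × ℕ)) :
    ∃ (s' : Finset (ℕ × ℕ)) (C : ℝ), 0 ≤ C ∧ ∀ i, supSeminorm E s (A i) ≤ C * b i s' := by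
  choose S C hC hS using fun m : ℕ × ℕ => h m.1 m.2
  refine ⟨s.biUnion S, ∑ m ∈ s, C m, Finset.sum_nonneg fun m _ => hC m, fun i => ?_⟩
  refine supSeminorm_le (mul_nonneg (Finset.sum_nonneg fun m _ => hC m) (hb₀ _ _)) fun m hm x => ?_
  refine (hS m i x).trans (mul_le_mul (Finset.single_le_sum (fun m _ => hC m) hm)
    (hb _ _ _ (Finset.subset_biUnion_of_mem S hm)) (hb₀ _ _) (Finset.sum_nonneg fun m _ => hC m))

theorem exists_supSeminorm_clm_le (T : 𝓢(E, ℂ) →L[ℂ] 𝓢(F, ℂ)) (s : Finset (ℕ × ℕ)) :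
    ∃ (s' : Finset (ℕ × ℕ)) (C : ℝ), 0 ≤ C ∧ ∀ f, supSeminorm F s (T f) ≤
      C * supSeminorm E s' f := by
  have hc : Continuous (supSeminorm F s) :=
    Finset.sup_induction (p := fun q : Seminorm ℂ _ => Continuous q) continuous_const
      (fun _ ha _ hb => ha.sup hb)
      fun i _ => (schwartz_withSeminorms ℂ F ℂ).continuous_seminorm i
  obtain ⟨s', C, -, h⟩ := Seminorm.bound_of_continuous (schwartz_withSeminorms ℂ E ℂ)
    (Seminorm.comp (supSeminorm F s) T.toLinearMap) (hc.comp T.continuous)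
  exact ⟨s', C, C.coe_nonneg, fun f => h f⟩

theorem exists_supSeminorm_tensor_le (s : Finset (ℕ × ℕ)) :
    ∃ (s' : Finset (ℕ × ℕ)) (C : ℝ), 0 ≤ C ∧ ∀ (f : 𝓢(E, ℂ)) (g : 𝓢(F, ℂ)),
      supSeminorm (E × F) s (tensor f g) ≤ C * (supSeminorm E s' f * supSeminorm F s' g) := by
  obtain ⟨s', C, hC, h⟩ := exists_supSeminorm_le (ι := 𝓢(E, ℂ) × 𝓢(F, ℂ))
    (A := fun p => tensor p.1 p.2)
    (b := fun p s => supSeminorm E s p.1 * supSeminorm F s p.2)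
    (fun p s => by positivity)
    (fun p s s' hs => mul_le_mul (supSeminorm_mono hs _) (supSeminorm_mono hs _)
      (apply_nonneg _ _) (apply_nonneg _ _))
    (fun k n => ⟨Finset.Iic (k, n), 2 ^ n * (2 ^ k * 2 ^ k), by positivity, fun p x =>
      (tensor_decay p.1 p.2 k n x).trans (le_of_eq (by rw [supSeminorm, supSeminorm]; ring))⟩) s
  exact ⟨s', C, hC, fun f g => h (f, g)⟩

theorem IsTemperateFamily.exists_supSeminorm_mul_le {ι : Type} {u : ι → E → ℂ}
    (hu : IsTemperateFamily u) (s : Finset (ℕ × ℕ)) :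
    ∃ (s' : Finset (ℕ × ℕ)) (C : ℝ), 0 ≤ C ∧ ∀ i (φ : 𝓢(E, ℂ)),
      supSeminorm E s (mulCLM (hu.hasTemperateGrowth i) φ) ≤ C * supSeminorm E s' φ := by
  obtain ⟨s', C, hC, h⟩ := exists_supSeminorm_le (ι := ι × 𝓢(E, ℂ))
    (A := fun p => mulCLM (hu.hasTemperateGrowth p.1) p.2)
    (b := fun p s => supSeminorm E s p.2)
    (fun p s => apply_nonneg _ _) (fun p s s' hs => supSeminorm_mono hs _)
    (fun k n => by
      obtain ⟨s, C, hC, h⟩ := hu.mul_schwartz_bound k n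
      refine ⟨s, C, hC, fun p x => ?_⟩
      have e : (mulCLM (hu.hasTemperateGrowth p.1) p.2 : E → ℂ) = fun x => u p.1 x * p.2 x :=
        funext fun x => mul_comm _ _
      rw [e]
      exact h p.1 p.2 x) s
  exact ⟨s', C, hC, fun i φ => h (i, φ)⟩

end SupSeminorm

namespace WeylData
variable {E : Type} [NormedAddCommGroup E] [NormedSpace ℝ E] [FiniteDimensional ℝ E]
  [MeasureSpace E] [BorelSpace E] [(volume : Measure E).IsAddHaarMeasure] (D : WeylData E)

/-- The direct sum of two copies of the form. -/
def pairForm : (E × E) →L[ℝ] (E × E) →L[ℝ] ℝ :=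
  D.form.bilinearComp (ContinuousLinearMap.fst ℝ E E) (ContinuousLinearMap.fst ℝ E E) +
    D.form.bilinearComp (ContinuousLinearMap.snd ℝ E E) (ContinuousLinearMap.snd ℝ E E)

theorem pairForm_apply (θ p : E × E) : D.pairForm θ p = D.form θ.1 p.1 + D.form θ.2 p.2 := rfl

theorem le_norm_pairForm (θ : E × E) : ‖θ‖ ≤ ‖D.pairForm θ‖ := by
  have h : ∀ (j : E →L[ℝ] E × E) (L : E →L[ℝ] ℝ), ‖j‖ ≤ 1 → (D.pairForm θ).comp j = L →
      ‖L‖ ≤ ‖D.pairForm θ‖ := fun j L hj e => by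
    rw [← e]
    exact (ContinuousLinearMap.opNorm_comp_le _ _).trans
      (mul_le_of_le_one_right (norm_nonneg _) hj)
  refine max_le ((D.le_norm_form θ.1).trans (h (ContinuousLinearMap.inl ℝ E E) _
    (ContinuousLinearMap.norm_inl_le_one ℝ E E) ?_)) ((D.le_norm_form θ.2).trans
    (h (ContinuousLinearMap.inr ℝ E E) _ (ContinuousLinearMap.norm_inr_le_one ℝ E E) ?_))
  · ext v
    simp [pairForm_apply]
  · ext v
    simp [pairForm_apply]

/-- The change of variables `((m, (p, p')), (a, b)) ↦ (m, ((p + b / 2, a), (p' - a / 2, b)))`. -/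
def cornerEquiv (E : Type) [NormedAddCommGroup E] [NormedSpace ℝ E] :
    ((E × (E × E)) × (E × E)) ≃L[ℝ] E × ((E × E) × (E × E)) :=
  let fst₁ := ContinuousLinearMap.fst ℝ (E × (E × E)) (E × E)
  let snd₁ := ContinuousLinearMap.snd ℝ (E × (E × E)) (E × E)
  let m := (ContinuousLinearMap.fst ℝ E (E × E)).comp fst₁
  let pp := (ContinuousLinearMap.snd ℝ E (E × E)).comp fst₁
  let p := (ContinuousLinearMap.fst ℝ E E).comp pp
  let p' := (ContinuousLinearMap.snd ℝ E E).comp pp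
  let a := (ContinuousLinearMap.fst ℝ E E).comp snd₁
  let b := (ContinuousLinearMap.snd ℝ E E).comp snd₁
  let m₂ := ContinuousLinearMap.fst ℝ E ((E × E) × (E × E))
  let qq := ContinuousLinearMap.snd ℝ E ((E × E) × (E × E))
  let q := (ContinuousLinearMap.fst ℝ (E × E) (E × E)).comp qq
  let q' := (ContinuousLinearMap.snd ℝ (E × E) (E × E)).comp qq
  let q₁ := (ContinuousLinearMap.fst ℝ E E).comp q
  let a₂ := (ContinuousLinearMap.snd ℝ E E).comp q
  let q₁' := (ContinuousLinearMap.fst ℝ E E).comp q'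
  let b₂ := (ContinuousLinearMap.snd ℝ E E).comp q'
  ContinuousLinearEquiv.equivOfInverse
    (m.prod (((p + (1 / 2 : ℝ) • b).prod a).prod ((p' - (1 / 2 : ℝ) • a).prod b)))
    ((m₂.prod ((q₁ - (1 / 2 : ℝ) • b₂).prod (q₁' + (1 / 2 : ℝ) • a₂))).prod (a₂.prod b₂))
    (fun x => by simp [m, pp, p, p', a, b, m₂, qq, q, q', q₁, q₁', a₂, b₂, fst₁, snd₁])
    (fun x => by simp [m, pp, p, p', a, b, m₂, qq, q, q', q₁, q₁', a₂, b₂, fst₁, snd₁])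

theorem isTemperateFamily_cornerPhase : IsTemperateFamily
    fun (c : E) (x : (E × (E × E)) × (E × E)) =>
      trianglePhase D.phase (c + x.1.1) x.2.1 x.2.2 :=
  D.isTemperateFamily_trianglePhase.comp_clm
    (((ContinuousLinearMap.fst ℝ E (E × E)).comp
      (ContinuousLinearMap.fst ℝ (E × (E × E)) (E × E))).prod
        (ContinuousLinearMap.snd ℝ (E × (E × E)) (E × E)))

/-- The amplitude of the oscillatory integral for the Weyl product of `f` and `g` near the
position `c`, as a function of the displacement `m` from `c`, the position arguments `p`, `p'` of
the factors, and the sides `a`, `b` of the triangle; `ρ` is a cutoff in `m`. Separating these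
variables makes the amplitude a Schwartz function, uniformly in `c`. -/
def corner (ρ : 𝓢(E, ℂ)) (c : E) (f g : 𝓢(E × E, ℂ)) : 𝓢((E × (E × E)) × (E × E), ℂ) :=
  mulCLM (D.isTemperateFamily_cornerPhase.hasTemperateGrowth c)
    (SchwartzMap.compCLMOfContinuousLinearEquiv ℂ (cornerEquiv E)
      (tensor ρ (tensor (D.fourier f) (D.fourier g))))

theorem corner_apply (ρ : 𝓢(E, ℂ)) (c : E) (f g : 𝓢(E × E, ℂ)) (m p p' a b : E) :
    D.corner ρ c f g ((m, (p, p')), (a, b)) =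
      ρ m * (D.fourier f (p + (1 / 2 : ℝ) • b, a) * D.fourier g (p' - (1 / 2 : ℝ) • a, b)) *
        trianglePhase D.phase (c + m) a b := rfl

/-- The partial Fourier transform of `corner` in the sides of the triangle. -/
def cornerTransform (ρ : 𝓢(E, ℂ)) (c : E) (f g : 𝓢(E × E, ℂ)) :
    𝓢((E × (E × E)) × (E × E), ℂ) :=
  partialFourier D.pairForm D.le_norm_pairForm (D.corner ρ c f g)

theorem exists_supSeminorm_cornerTransform_le (ρ : 𝓢(E, ℂ)) (s : Finset (ℕ × ℕ)) :
    ∃ (s' : Finset (ℕ × ℕ)) (C : ℝ), 0 ≤ C ∧ ∀ c f g,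
      supSeminorm _ s (D.cornerTransform ρ c f g) ≤
        C * (supSeminorm _ s' f * supSeminorm _ s' g) := by
  obtain ⟨s₁, C₁, hC₁, h₁⟩ := exists_supSeminorm_clm_le
    (partialFourier (V := E × (E × E)) D.pairForm D.le_norm_pairForm) s
  obtain ⟨s₂, C₂, hC₂, h₂⟩ := D.isTemperateFamily_cornerPhase.exists_supSeminorm_mul_le s₁
  obtain ⟨s₃, C₃, hC₃, h₃⟩ := exists_supSeminorm_clm_le
    (SchwartzMap.compCLMOfContinuousLinearEquiv ℂ (F := ℂ) (cornerEquiv E)) s₂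
  obtain ⟨s₄, C₄, hC₄, h₄⟩ := exists_supSeminorm_tensor_le (E := E) (F := (E × E) × (E × E)) s₃
  obtain ⟨s₅, C₅, hC₅, h₅⟩ := exists_supSeminorm_tensor_le (E := E × E) (F := E × E) s₄
  obtain ⟨s₆, C₆, hC₆, h₆⟩ := exists_supSeminorm_clm_le D.fourier s₅
  refine ⟨s₆, C₁ * (C₂ * (C₃ * (C₄ * (supSeminorm E s₄ ρ * (C₅ * (C₆ * C₆)))))), by positivity,
    fun c f g => ?_⟩
  calc _ ≤ C₁ * (C₂ * (C₃ * (C₄ * (supSeminorm E s₄ ρ *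
        (C₅ * (supSeminorm _ s₅ (D.fourier f) * supSeminorm _ s₅ (D.fourier g))))))) := by
        refine (h₁ _).trans (mul_le_mul_of_nonneg_left ?_ hC₁)
        refine (h₂ c _).trans (mul_le_mul_of_nonneg_left ?_ hC₂)
        refine (h₃ _).trans (mul_le_mul_of_nonneg_left ?_ hC₃)
        refine (h₄ _ _).trans (mul_le_mul_of_nonneg_left ?_ hC₄)
        exact mul_le_mul_of_nonneg_left (h₅ _ _) (apply_nonneg _ _)
    _ ≤ C₁ * (C₂ * (C₃ * (C₄ * (supSeminorm E s₄ ρ *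
        (C₅ * ((C₆ * supSeminorm _ s₆ f) * (C₆ * supSeminorm _ s₆ g))))))) := by
        gcongr
        · exact h₆ f
        · exact h₆ g
    _ = _ := by ring

theorem fourier_compSubConstCLM (f : 𝓢(E × E, ℂ)) (Y : E × E) (z a : E) :
    D.fourier (f.compSubConstCLM ℂ (-Y)) (z, a) =
      Complex.exp (((-D.form a Y.2 : ℝ) : ℂ) * Complex.I) * D.fourier f (z + Y.1, a) := by
  rw [fourier_apply, fourier_apply, ← integral_const_mul,
    ← integral_add_right_eq_self (fun ξ => Complex.exp (((-D.form a Y.2 : ℝ) : ℂ) * Complex.I) *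
      (Complex.exp ((D.form a ξ : ℂ) * Complex.I) * f (z + Y.1, ξ))) Y.2]
  refine integral_congr_ae (.of_forall fun w => ?_)
  simp only [SchwartzMap.compSubConstCLM_apply]
  rw [← mul_assoc, ← Complex.exp_add]
  congr 2
  · rw [map_add]
    push_cast
    ring
  · rw [sub_neg_eq_add]
    rfl

/-- An integral over the sides `a = x - z`, `b = z - y` of the triangles, as an integral over the
long side `w = x - y` and the vertex `z`. -/
theorem integral_sides {J : E × E → ℂ} (hJ : Integrable J) (m : E) :
    ∫ q, J q = ∫ w, ∫ z, J (m + (1 / 2 : ℝ) • w - z, z - (m - (1 / 2 : ℝ) • w)) := by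
  have hmp : MeasurePreserving (fun q : E × E => (q.1, q.2 - q.1)) :=
    measurePreserving_prod_sub (volume : Measure E) volume
  have hJ' : Integrable fun q : E × E => J (q.1, q.2 - q.1) := hmp.integrable_comp_of_integrable hJ
  calc ∫ q, J q = ∫ q : E × E, J (q.1, q.2 - q.1) :=
        (hmp.integral_comp (shearEquiv E).toHomeomorph.measurableEmbedding J).symm
    _ = ∫ w, ∫ a, J (a, w - a) := integral_prod_symm _ hJ'
    _ = _ := by
        refine integral_congr_ae (.of_forall fun w => ?_)
        change ∫ a, J (a, w - a) = _
        rw [← integral_sub_left_eq_self _ volume (m + (1 / 2 : ℝ) • w)]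
        refine integral_congr_ae (.of_forall fun z => ?_)
        change J (_, _) = J (_, _)
        congr 2
        module

/-- The product of the symbols `f`, `g` near the position `c`, in terms of their translates to the
origin from `Y` and `Y'`. -/
theorem sharp_eq_cornerTransform (ρ : 𝓢(E, ℂ)) (f g : 𝓢(E × E, ℂ)) (Y Y' : E × E) (c m ξ : E)
    (hρ : ρ m = 1) :
    D.sharp f g (c + m, ξ) = D.const⁻¹ * D.const⁻¹ * D.cornerTransform ρ c
      (f.compSubConstCLM ℂ (-Y)) (g.compSubConstCLM ℂ (-Y'))
        ((m, (c + m - Y.1, c + m - Y'.1)), (Y.2 - ξ, Y'.2 - ξ)) := by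
  have hi := integrable_osc D.pairForm
    (D.corner ρ c (f.compSubConstCLM ℂ (-Y)) (g.compSubConstCLM ℂ (-Y')))
    ((m, (c + m - Y.1, c + m - Y'.1)), (Y.2 - ξ, Y'.2 - ξ))
  rw [cornerTransform, partialFourier_apply]
  simp only [smul_eq_mul] at hi
  rw [integral_sides hi (c + m), sharp, weylSymbol_apply, ← integral_const_mul]
  refine integral_congr_ae (.of_forall fun w => ?_)
  simp only [compose_apply]
  rw [← integral_mul_const, ← integral_const_mul, ← integral_const_mul]
  refine integral_congr_ae (.of_forall fun z => ?_)
  set M := c + m with hM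
  simp only [corner_apply, hρ, one_mul, fourier_compSubConstCLM, weyl_apply, pairForm_apply]
  have e1 : midpointEquiv E (M + (1 / 2 : ℝ) • w, z) =
      (M - Y.1 + (1 / 2 : ℝ) • (z - (M - (1 / 2 : ℝ) • w)) + Y.1, M + (1 / 2 : ℝ) • w - z) := by
    change ((1 / 2 : ℝ) • (M + (1 / 2 : ℝ) • w + z), M + (1 / 2 : ℝ) • w - z) = _
    congr 1
    module
  have e2 : midpointEquiv E (z, M - (1 / 2 : ℝ) • w) =
      (M - Y'.1 - (1 / 2 : ℝ) • (M + (1 / 2 : ℝ) • w - z) + Y'.1, z - (M - (1 / 2 : ℝ) • w)) := by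
    change ((1 / 2 : ℝ) • (z + (M - (1 / 2 : ℝ) • w)), z - (M - (1 / 2 : ℝ) • w)) = _
    congr 1
    module
  have e3 : trianglePhase D.phase M (M + (1 / 2 : ℝ) • w - z) (z - (M - (1 / 2 : ℝ) • w)) =
      (starRingEnd ℂ) (D.phase (M + (1 / 2 : ℝ) • w, M - (1 / 2 : ℝ) • w)) *
        D.phase (M + (1 / 2 : ℝ) • w, z) * D.phase (z, M - (1 / 2 : ℝ) • w) := by
    have h1 : M + (1 / 2 : ℝ) • w - z + (z - (M - (1 / 2 : ℝ) • w)) = w := by module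
    have h2 : M + (1 / 2 : ℝ) • (z - (M - (1 / 2 : ℝ) • w) - (M + (1 / 2 : ℝ) • w - z)) = z := by
      module
    rw [trianglePhase, h1, h2]
  rw [e1, e2, e3]
  set a := M + (1 / 2 : ℝ) • w - z with ha
  set b := z - (M - (1 / 2 : ℝ) • w) with hb
  -- The momenta `Y.2`, `Y'.2` of the translations combine with `ξ`, as `w = a + b`.
  have e4 : Complex.exp (((D.form (-ξ) w : ℝ) : ℂ) * Complex.I) =
      Complex.exp (((D.form (Y.2 - ξ) a + D.form (Y'.2 - ξ) b : ℝ) : ℂ) * Complex.I) *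
        Complex.exp (((-D.form a Y.2 : ℝ) : ℂ) * Complex.I) *
        Complex.exp (((-D.form b Y'.2 : ℝ) : ℂ) * Complex.I) := by
    rw [← Complex.exp_add, ← Complex.exp_add]
    congr 1
    have h1 : w = a + b := by rw [ha, hb]; module
    rw [D.form_symm a, D.form_symm b]
    conv_lhs => rw [h1]
    simp only [map_add, map_sub, map_neg, neg_apply, sub_apply]
    push_cast
    ring
  rw [e4]
  ring

/-- The product of symbols localized at `Y` and `Y'` decays rapidly in the distances to `Y` and
`Y'`, with constants that do not depend on `Y` and `Y'`. -/
theorem exists_sharp_localized_le (n N : ℕ) : ∃ (s : Finset (ℕ × ℕ)) (C : ℝ), 0 ≤ C ∧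
    ∀ (f g : 𝓢(E × E, ℂ)) (Y Y' X : E × E),
      (1 + ‖X - Y‖) ^ N * (1 + ‖X - Y'‖) ^ N * ‖iteratedFDeriv ℝ n (D.sharp f g) X‖ ≤
        C * (supSeminorm _ s (f.compSubConstCLM ℂ (-Y)) *
          supSeminorm _ s (g.compSubConstCLM ℂ (-Y'))) := by
  obtain ⟨ρ, hρ⟩ := exists_schwartz_eventually_eq_one (0 : E)
  obtain ⟨s, C, hC, h⟩ := D.exists_supSeminorm_cornerTransform_le ρ (Finset.Iic (N + N, n))
  refine ⟨s, ‖D.const⁻¹ * D.const⁻¹‖ * (2 ^ (N + N) * C), by positivity,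
    fun f g Y Y' X₀ => ?_⟩
  -- Near `X₀` the product is the function `H` of `sharp_eq_cornerTransform` with `c` the position of
  -- `X₀`, along the affine map `q₀ + L`.
  set H := D.cornerTransform ρ X₀.1 (f.compSubConstCLM ℂ (-Y)) (g.compSubConstCLM ℂ (-Y')) with hH
  let x := ContinuousLinearMap.fst ℝ E E
  let L : (E × E) →L[ℝ] (E × (E × E)) × (E × E) :=
    (x.prod (x.prod x)).prod
      ((-ContinuousLinearMap.snd ℝ E E).prod (-ContinuousLinearMap.snd ℝ E E))
  have hL : ‖L‖ ≤ 1 := L.opNorm_le_bound zero_le_one fun p => by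
    rw [one_mul]
    change max (max ‖p.1‖ (max ‖p.1‖ ‖p.1‖)) (max ‖-p.2‖ ‖-p.2‖) ≤ max ‖p.1‖ ‖p.2‖
    simp
  let q₀ : (E × (E × E)) × (E × E) := ((-X₀.1, (-Y.1, -Y'.1)), (Y.2, Y'.2))
  have hloc : (D.sharp f g : E × E → ℂ) =ᶠ[nhds X₀]
      (D.const⁻¹ * D.const⁻¹) • ((fun q => H (q₀ + q)) ∘ L) := by
    have ht : Filter.Tendsto (fun X : E × E => X.1 - X₀.1) (nhds X₀) (nhds 0) := by
      have : Continuous fun X : E × E => X.1 - X₀.1 := by fun_prop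
      simpa using this.tendsto X₀
    filter_upwards [ht.eventually hρ] with X hX
    have := D.sharp_eq_cornerTransform ρ f g Y Y' X₀.1 (X.1 - X₀.1) X.2 hX
    rw [add_sub_cancel] at this
    refine this.trans ?_
    change _ = D.const⁻¹ * D.const⁻¹ * H ((-X₀.1 + X.1, (-Y.1 + X.1, -Y'.1 + X.1)),
      (Y.2 + -X.2, Y'.2 + -X.2))
    simp only [sub_eq_add_neg, add_comm, hH]
  have hs : ContDiff ℝ n fun q => H (q₀ + q) := (H.smooth n).comp (contDiff_const.add contDiff_id)
  have hd : ‖iteratedFDeriv ℝ n (D.sharp f g) X₀‖ ≤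
      ‖D.const⁻¹ * D.const⁻¹‖ * ‖iteratedFDeriv ℝ n H (q₀ + L X₀)‖ := by
    rw [(hloc.iteratedFDeriv ℝ n).eq_of_nhds, iteratedFDeriv_const_smul_apply
      (hs.comp L.contDiff).contDiffAt, norm_smul, L.iteratedFDeriv_comp_right hs X₀ le_rfl,
      iteratedFDeriv_comp_add_left]
    refine mul_le_mul_of_nonneg_left ?_ (norm_nonneg _)
    refine (ContinuousMultilinearMap.norm_compContinuousLinearMap_le _ _).trans ?_
    exact mul_le_of_le_one_right (norm_nonneg _) (Finset.prod_le_one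
      (fun _ _ => norm_nonneg _) fun _ _ => hL)
  have hq : q₀ + L X₀ = ((0, (X₀.1 - Y.1, X₀.1 - Y'.1)), (Y.2 - X₀.2, Y'.2 - X₀.2)) := by
    change ((-X₀.1 + X₀.1, (-Y.1 + X₀.1, -Y'.1 + X₀.1)), (Y.2 + -X₀.2, Y'.2 + -X₀.2)) = _
    simp only [sub_eq_add_neg, add_comm, add_neg_cancel]
  have hn : ‖X₀ - Y‖ ≤ ‖q₀ + L X₀‖ ∧ ‖X₀ - Y'‖ ≤ ‖q₀ + L X₀‖ := by
    rw [hq]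
    simp only [Prod.norm_def, Prod.fst_sub, Prod.snd_sub, norm_zero, norm_sub_rev X₀.2]
    constructor <;> grind
  have hfin := one_add_le_sup_seminorm_apply (𝕜 := ℂ) (m := (N + N, n)) le_rfl le_rfl H
    (q₀ + L X₀)
  have hsup := h X₀.1 (f.compSubConstCLM ℂ (-Y)) (g.compSubConstCLM ℂ (-Y'))
  calc _ ≤ (1 + ‖q₀ + L X₀‖) ^ N * (1 + ‖q₀ + L X₀‖) ^ N *
        (‖D.const⁻¹ * D.const⁻¹‖ * ‖iteratedFDeriv ℝ n H (q₀ + L X₀)‖) := by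
        gcongr
        · exact hn.1
        · exact hn.2
    _ = ‖D.const⁻¹ * D.const⁻¹‖ *
        ((1 + ‖q₀ + L X₀‖) ^ (N + N) * ‖iteratedFDeriv ℝ n H (q₀ + L X₀)‖) := by
        rw [pow_add]; ring
    _ ≤ ‖D.const⁻¹ * D.const⁻¹‖ * (2 ^ (N + N) * (C * (supSeminorm _ s
          (f.compSubConstCLM ℂ (-Y)) * supSeminorm _ s (g.compSubConstCLM ℂ (-Y'))))) := by
        refine mul_le_mul_of_nonneg_left (hfin.trans ?_) (norm_nonneg _)
        exact mul_le_mul_of_nonneg_left hsup (by positivity)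
    _ = _ := by ring

end WeylData

/-! ### Symbols of tempered weight and their localizations -/

section Symbols
variable {V : Type} [NormedAddCommGroup V] [NormedSpace ℝ V]

/-- A positive function of temperate variation. -/
structure IsWeight (M : V → ℝ) : Prop where
  pos : ∀ X, 0 < M X
  temperate : ∃ (k : ℕ) (C : ℝ), 0 ≤ C ∧ ∀ X Y, M (X + Y) ≤ C * M X * (1 + ‖Y‖) ^ k

/-- The derivatives of `f` of order at most `J` are bounded by `A M`. -/
def SymbolBound (M : V → ℝ) (f : V → ℂ) (J : ℕ) (A : ℝ) : Prop :=
  ∀ j ≤ J, ∀ X, ‖iteratedFDeriv ℝ j f X‖ ≤ A * M X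

theorem SymbolBound.mono {M : V → ℝ} {f : V → ℂ} {J J' : ℕ} {A : ℝ} (h : SymbolBound M f J A)
    (hJ : J' ≤ J) : SymbolBound M f J' A := fun j hj => h j (hj.trans hJ)

/-- The smooth functions all of whose derivatives are `O(M)`. -/
structure IsSymbol (M : V → ℝ) (f : V → ℂ) : Prop where
  smooth : ContDiff ℝ ∞ f
  bound : ∀ J : ℕ, ∃ A : ℝ, 0 ≤ A ∧ SymbolBound M f J A

theorem IsWeight.le_pow {M : V → ℝ} (hM : IsWeight M) :
    ∃ (k : ℕ) (C : ℝ), 0 ≤ C ∧ ∀ X, M X ≤ C * (1 + ‖X‖) ^ k := by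
  obtain ⟨k, C, hC, h⟩ := hM.temperate
  exact ⟨k, C * M 0, mul_nonneg hC (hM.pos 0).le, fun X => by simpa using h 0 X⟩

theorem isWeight_inv_pow (N : ℕ) : IsWeight fun X : V => ((1 + ‖X‖) ^ N)⁻¹ where
  pos X := by positivity
  temperate := by
    refine ⟨N, 1, zero_le_one, fun X Y => ?_⟩
    rw [one_mul, inv_mul_eq_div, inv_eq_one_div, div_le_div_iff₀ (by positivity) (by positivity),
      one_mul, ← mul_pow]
    gcongr
    have h1 := norm_sub_le (X + Y) Y
    rw [add_sub_cancel_right] at h1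
    nlinarith [norm_nonneg (X + Y), norm_nonneg Y]

theorem IsSymbol.hasTemperateGrowth {M : V → ℝ} {f : V → ℂ} (hM : IsWeight M)
    (hf : IsSymbol M f) : f.HasTemperateGrowth := by
  refine ⟨hf.smooth, fun n => ?_⟩
  obtain ⟨A, hA, h⟩ := hf.bound n
  obtain ⟨k, C, -, hk⟩ := hM.le_pow
  refine ⟨k, A * C, fun X => (h n le_rfl X).trans ?_⟩
  rw [mul_assoc]
  exact mul_le_mul_of_nonneg_left (hk X) hA

theorem isSymbol_of_forall {M : V → ℝ} {f : V → ℂ} (hM : IsWeight M) (hf : ContDiff ℝ ∞ f)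
    (h : ∀ n : ℕ, ∃ A : ℝ, ∀ X, ‖iteratedFDeriv ℝ n f X‖ ≤ A * M X) : IsSymbol M f := by
  choose A hA using h
  refine ⟨hf, fun J => ⟨∑ j ∈ Finset.range (J + 1), |A j|,
    Finset.sum_nonneg fun _ _ => abs_nonneg _, fun j hj X => (hA j X).trans ?_⟩⟩
  refine mul_le_mul_of_nonneg_right ((le_abs_self _).trans ?_) (hM.pos X).le
  exact Finset.single_le_sum (f := fun j => |A j|) (fun _ _ => abs_nonneg _)
    (Finset.mem_range.2 (Nat.lt_succ_of_le hj))

theorem isSymbol_schwartz (f : 𝓢(V, ℂ)) (N : ℕ) :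
    IsSymbol (fun X : V => ((1 + ‖X‖) ^ N)⁻¹) f := by
  refine isSymbol_of_forall (isWeight_inv_pow N) (f.smooth ⊤) fun n => ?_
  refine ⟨2 ^ N * (Finset.Iic (N, n)).sup (schwartzSeminormFamily ℂ V ℂ) f, fun X => ?_⟩
  rw [← div_eq_mul_inv, le_div_iff₀ (by positivity), mul_comm]
  exact one_add_le_sup_seminorm_apply (𝕜 := ℂ) (m := (N, n)) le_rfl le_rfl f X

/-- The localization `γ(· - Y) f` of `f` at the point `Y`. -/
def localize (γ : 𝓢(V, ℂ)) (f : V → ℂ) (Y : V) : 𝓢(V, ℂ) :=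
  SchwartzMap.smulLeftCLM ℂ f (γ.compSubConstCLM ℂ Y)

theorem localize_apply (γ : 𝓢(V, ℂ)) {f : V → ℂ} (hf : f.HasTemperateGrowth) (Y X : V) :
    localize γ f Y X = f X * γ (X - Y) := by
  rw [localize, SchwartzMap.smulLeftCLM_apply_apply hf, SchwartzMap.compSubConstCLM_apply,
    smul_eq_mul]

theorem continuous_localize [FiniteDimensional ℝ V] (γ : 𝓢(V, ℂ)) (f : V → ℂ) :
    Continuous (localize γ f) :=
  (SchwartzMap.smulLeftCLM ℂ f).continuous.comp (continuous_translate γ)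

/-- The localization at `Y` of a symbol, translated to the origin, has seminorms `O(M(Y))`. -/
theorem exists_supSeminorm_localize_le (γ : 𝓢(V, ℂ)) {M : V → ℝ} (hM : IsWeight M)
    (s : Finset (ℕ × ℕ)) : ∃ (J : ℕ) (C : ℝ), 0 ≤ C ∧ ∀ f : V → ℂ, f.HasTemperateGrowth →
      ∀ A : ℝ, 0 ≤ A → SymbolBound M f J A → ∀ Y,
        supSeminorm V s ((localize γ f Y).compSubConstCLM ℂ (-Y)) ≤ C * (A * M Y) := by
  obtain ⟨k, C, hC, h⟩ := hM.temperate
  let c : ℕ × ℕ → ℝ := fun i => C * ((2 ^ i.2 * 2 ^ (i.1 + k)) *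
    (Finset.Iic (i.1 + k, i.2)).sup (schwartzSeminormFamily ℂ V ℂ) γ)
  have hc : ∀ i, 0 ≤ c i := fun i => by positivity
  have hs : 0 ≤ ∑ i ∈ s, c i := Finset.sum_nonneg fun i _ => hc i
  refine ⟨s.sup Prod.snd, ∑ i ∈ s, c i, hs, fun f hf A hA hb Y => ?_⟩
  have hAM : 0 ≤ A * M Y := mul_nonneg hA (hM.pos Y).le
  refine supSeminorm_le (mul_nonneg hs hAM) fun i hi x => ?_
  have hu : ContDiff ℝ ∞ fun x => f (x + Y) := hf.1.comp (contDiff_id.add contDiff_const)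
  have e : ((localize γ f Y).compSubConstCLM ℂ (-Y) : V → ℂ) = fun x => f (x + Y) * γ x :=
    funext fun x => by
      rw [SchwartzMap.compSubConstCLM_apply, localize_apply γ hf, sub_neg_eq_add,
        add_sub_cancel_right]
  have h1 := norm_iteratedFDeriv_mul_schwartz_le hu (A := A * (C * M Y)) (k := k) (n := i.2)
    (mul_nonneg hA (mul_nonneg hC (hM.pos Y).le)) (fun j hj x => by
      rw [iteratedFDeriv_comp_add_right]
      refine (hb j (hj.trans (Finset.le_sup (f := Prod.snd) hi)) (x + Y)).trans ?_
      rw [mul_assoc, add_comm x Y]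
      exact mul_le_mul_of_nonneg_left (h Y x) hA) i.1 γ x
  rw [e]
  calc _ ≤ _ := h1
    _ = c i * (A * M Y) := by simp only [c]; ring
    _ ≤ _ := mul_le_mul_of_nonneg_right (Finset.single_le_sum (fun i _ => hc i) hi) hAM

variable [FiniteDimensional ℝ V] [MeasureSpace V] [BorelSpace V]
  [(volume : Measure V).IsAddHaarMeasure]

theorem exists_schwartz_integral_eq_one (V : Type) [NormedAddCommGroup V] [NormedSpace ℝ V]
    [FiniteDimensional ℝ V] [MeasureSpace V] [BorelSpace V]
    [(volume : Measure V).IsAddHaarMeasure] : ∃ γ : 𝓢(V, ℂ), ∫ x, γ x = 1 := by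
  by_contra! h
  have h0 : ∀ γ : 𝓢(V, ℂ), ∫ x, γ x = 0 := fun γ => by
    by_contra hγ
    refine h ((∫ x, γ x)⁻¹ • γ) ?_
    simp only [smul_apply, smul_eq_mul, integral_const_mul]
    exact inv_mul_cancel₀ hγ
  have h1 := eq_zero_of_forall_integral_schwartz_mul (f := fun _ : V => (1 : ℂ)) continuous_const
    fun γ => by simpa using h0 γ
  exact one_ne_zero (congrFun h1 0)

theorem exists_schwartz_integral_mul_eq_one (V : Type) [NormedAddCommGroup V] [NormedSpace ℝ V]
    [FiniteDimensional ℝ V] [MeasureSpace V] [BorelSpace V]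
    [(volume : Measure V).IsAddHaarMeasure] : ∃ s s' : 𝓢(V, ℂ), ∫ x, s x * s' x = 1 := by
  obtain ⟨γ, hγ⟩ := exists_schwartz_integral_eq_one V
  by_contra! h
  have h0 : ∀ s : 𝓢(V, ℂ), ∫ x, s x * γ x = 0 := fun s => by
    by_contra hs
    refine h ((∫ x, s x * γ x)⁻¹ • s) γ ?_
    simp only [smul_apply, smul_eq_mul, mul_assoc, integral_const_mul]
    exact inv_mul_cancel₀ hs
  have h1 := eq_zero_of_forall_integral_schwartz_mul γ.continuous h0
  rw [h1] at hγ
  simp at hγ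

/-- Integration against a Schwartz function, by localization of the symbol. -/
theorem integral_localize_mul {γ : 𝓢(V, ℂ)} (hγ : ∫ x, γ x = 1) {f : V → ℂ}
    (hf : f.HasTemperateGrowth) (ψ : 𝓢(V, ℂ)) :
    ∫ Y, ∫ X, localize γ f Y X * ψ X = ∫ X, f X * ψ X := by
  let L : (V × V) ≃L[ℝ] V × V := ContinuousLinearEquiv.equivOfInverse
    ((ContinuousLinearMap.snd ℝ V V).prod
      (ContinuousLinearMap.snd ℝ V V - ContinuousLinearMap.fst ℝ V V))
    ((ContinuousLinearMap.fst ℝ V V - ContinuousLinearMap.snd ℝ V V).prod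
      (ContinuousLinearMap.fst ℝ V V))
    (fun p => by ext1 <;> simp) (fun p => by ext1 <;> simp)
  have hi := (SchwartzMap.compCLMOfContinuousLinearEquiv ℂ L
    (tensor (mulCLM hf ψ) γ)).integrable (μ := (volume : Measure (V × V)))
  have e : ∀ Y X, SchwartzMap.compCLMOfContinuousLinearEquiv ℂ L (tensor (mulCLM hf ψ) γ) (Y, X) =
      localize γ f Y X * ψ X := fun Y X => by
    change ψ X * f X * γ (X - Y) = _
    rw [localize_apply γ hf]
    ring
  have hsw := integral_integral_swap (f := fun Y X => localize γ f Y X * ψ X)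
    (hi.congr (.of_forall fun p => e p.1 p.2))
  rw [hsw]
  refine integral_congr_ae (.of_forall fun X => ?_)
  simp only [localize_apply γ hf]
  have e2 : ∀ Y, f X * γ (X - Y) * ψ X = f X * ψ X * γ (X - Y) := fun Y => by ring
  simp only [e2, integral_const_mul]
  rw [integral_sub_left_eq_self (fun Y => γ Y) volume X, hγ, mul_one]

end Symbols

/-! ### The Weyl product of symbols -/

namespace WeylData
variable {E : Type} [NormedAddCommGroup E] [NormedSpace ℝ E] [FiniteDimensional ℝ E]
  [MeasureSpace E] [BorelSpace E] [(volume : Measure E).IsAddHaarMeasure] (D : WeylData E)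

/-- The integrable power weight on phase space. -/
def decay (E : Type) [NormedAddCommGroup E] [MeasureSpace E] (X : E × E) : ℝ :=
  ((1 + ‖X‖) ^ (volume : Measure (E × E)).integrablePower)⁻¹

theorem decay_pos (X : E × E) : 0 < decay E X := by
  unfold decay
  positivity

theorem integrable_decay : Integrable (decay E) := by
  refine (Measure.integrable_pow_neg_integrablePower (volume : Measure (E × E))).congr
    (.of_forall fun X => ?_)
  simp only [decay]
  rw [Real.rpow_neg (by positivity), Real.rpow_natCast]

theorem decay_sub_le (X Y : E × E) : decay E (X - Y) ≤
    (1 + ‖X‖) ^ (volume : Measure (E × E)).integrablePower * decay E Y := by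
  obtain h := norm_sub_rev X Y
  unfold decay
  rw [← div_eq_mul_inv, inv_eq_one_div, div_le_div_iff₀ (by positivity) (by positivity), one_mul,
    ← mul_pow]
  gcongr
  have h1 := norm_sub_le X (X - Y)
  rw [sub_sub_cancel] at h1
  nlinarith [norm_nonneg X, norm_nonneg (X - Y)]

/-- The product of the localizations of two symbols, near the point `X`. The polynomial factors from
comparing the weights at `Y` and `Y'` with those at `X` are absorbed by the rapid decay. -/
theorem exists_sharp_localize_le (γ : 𝓢(E × E, ℂ)) {M₁ M₂ : E × E → ℝ} (hM₁ : IsWeight M₁)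
    (hM₂ : IsWeight M₂) (n : ℕ) : ∃ (J : ℕ) (C : ℝ), 0 ≤ C ∧ ∀ f g : E × E → ℂ,
      f.HasTemperateGrowth → g.HasTemperateGrowth → ∀ A₁ A₂ : ℝ, 0 ≤ A₁ → 0 ≤ A₂ →
        SymbolBound M₁ f J A₁ → SymbolBound M₂ g J A₂ → ∀ Y Y' X,
          ‖iteratedFDeriv ℝ n (D.sharp (localize γ f Y) (localize γ g Y')) X‖ ≤
            C * (A₁ * A₂) * (M₁ X * M₂ X) * (decay E (X - Y) * decay E (X - Y')) := by
  obtain ⟨k₁, C₁, hC₁, h₁⟩ := hM₁.temperate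
  obtain ⟨k₂, C₂, hC₂, h₂⟩ := hM₂.temperate
  set N := (volume : Measure (E × E)).integrablePower with hN
  obtain ⟨s, C, hC, h⟩ := D.exists_sharp_localized_le n (N + (k₁ + k₂))
  obtain ⟨J₁, C₁', hC₁', hl₁⟩ := exists_supSeminorm_localize_le γ hM₁ s
  obtain ⟨J₂, C₂', hC₂', hl₂⟩ := exists_supSeminorm_localize_le γ hM₂ s
  refine ⟨max J₁ J₂, C * (C₁' * C₂' * (C₁ * C₂)), by positivity,
    fun f g hf hg A₁ A₂ hA₁ hA₂ hb₁ hb₂ Y Y' X => ?_⟩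
  have hX₁ := hM₁.pos X
  have hX₂ := hM₂.pos X
  have hw : ∀ (M : E × E → ℝ) (k : ℕ) (K : ℝ), k ≤ k₁ + k₂ → 0 ≤ K → 0 < M X →
      (∀ X Y, M (X + Y) ≤ K * M X * (1 + ‖Y‖) ^ k) → ∀ Z : E × E,
        M Z ≤ K * M X * (1 + ‖X - Z‖) ^ (k₁ + k₂) := fun M k K hk hK hMX hM Z => by
    have := hM X (Z - X)
    rw [add_sub_cancel, norm_sub_rev] at this
    refine this.trans ?_
    gcongr
    simp
  have e₁ := (hl₁ f hf A₁ hA₁ (hb₁.mono (le_max_left _ _)) Y).trans (mul_le_mul_of_nonneg_left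
    (mul_le_mul_of_nonneg_left (hw M₁ k₁ C₁ (by omega) hC₁ hX₁ h₁ Y) hA₁) hC₁')
  have e₂ := (hl₂ g hg A₂ hA₂ (hb₂.mono (le_max_right _ _)) Y').trans (mul_le_mul_of_nonneg_left
    (mul_le_mul_of_nonneg_left (hw M₂ k₂ C₂ (by omega) hC₂ hX₂ h₂ Y') hA₂) hC₂')
  have e := (h (localize γ f Y) (localize γ g Y') Y Y' X).trans (mul_le_mul_of_nonneg_left
    (mul_le_mul e₁ e₂ (apply_nonneg _ _) (by positivity)) hC)
  rw [pow_add, pow_add] at e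
  set D₁ := 1 + ‖X - Y‖ with hD₁
  set D₂ := 1 + ‖X - Y'‖ with hD₂
  have p₁ : 0 < D₁ := by positivity
  have p₂ : 0 < D₂ := by positivity
  change _ ≤ _ * ((D₁ ^ N)⁻¹ * (D₂ ^ N)⁻¹)
  rw [← mul_inv, ← div_eq_mul_inv, le_div_iff₀ (by positivity)]
  have q : 0 < D₁ ^ (k₁ + k₂) * D₂ ^ (k₁ + k₂) := by positivity
  refine le_of_mul_le_mul_right ?_ q
  refine le_trans (le_of_eq ?_) (e.trans (le_of_eq ?_)) <;> ring

/-- The estimate of the product of localizations with the point `X` separated from the centres, at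
the price of polynomial growth in `X`: it dominates the integrands locally uniformly in `X`. -/
theorem exists_sharp_localize_le_separated (γ : 𝓢(E × E, ℂ)) {M₁ M₂ : E × E → ℝ}
    (hM₁ : IsWeight M₁) (hM₂ : IsWeight M₂) {f g : E × E → ℂ} (hf : IsSymbol M₁ f)
    (hg : IsSymbol M₂ g) (n : ℕ) : ∃ (K : ℕ) (C : ℝ), 0 ≤ C ∧ ∀ (p : (E × E) × (E × E)) X,
      ‖iteratedFDeriv ℝ n (D.sharp (localize γ f p.1) (localize γ g p.2)) X‖ ≤
        C * (1 + ‖X‖) ^ K * (decay E p.1 * decay E p.2) := by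
  obtain ⟨J, C, hC, h⟩ := D.exists_sharp_localize_le γ hM₁ hM₂ n
  obtain ⟨A₁, hA₁, hb₁⟩ := hf.bound J
  obtain ⟨A₂, hA₂, hb₂⟩ := hg.bound J
  obtain ⟨k₁, C₁, hC₁, h₁⟩ := hM₁.le_pow
  obtain ⟨k₂, C₂, hC₂, h₂⟩ := hM₂.le_pow
  set N := (volume : Measure (E × E)).integrablePower with hN
  refine ⟨k₁ + k₂ + (N + N), C * (A₁ * A₂) * (C₁ * C₂), by positivity, fun p X => ?_⟩
  have d₁ := decay_pos p.1
  have d₂ := decay_pos p.2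
  refine (h f g (hf.hasTemperateGrowth hM₁) (hg.hasTemperateGrowth hM₂) A₁ A₂ hA₁ hA₂ hb₁ hb₂
    p.1 p.2 X).trans ?_
  calc _ ≤ C * (A₁ * A₂) * ((C₁ * (1 + ‖X‖) ^ k₁) * (C₂ * (1 + ‖X‖) ^ k₂)) *
        (((1 + ‖X‖) ^ N * decay E p.1) * ((1 + ‖X‖) ^ N * decay E p.2)) := by
        have := hM₁.pos X
        have := hM₂.pos X
        have := decay_pos (X - p.1)
        have := decay_pos (X - p.2)
        gcongr
        · exact h₁ X
        · exact h₂ X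
        · exact decay_sub_le X p.1
        · exact decay_sub_le X p.2
    _ = _ := by rw [pow_add, pow_add, pow_add]; ring

/-- The Weyl product of two symbols: the symbols are decomposed into localized pieces by means of
the translates of `γ`, and the products of the pieces are integrated. -/
def symbolProduct (γ : 𝓢(E × E, ℂ)) (f g : E × E → ℂ) (X : E × E) : ℂ :=
  ∫ p : (E × E) × (E × E), D.sharp (localize γ f p.1) (localize γ g p.2) X

theorem continuous_sharp_localize (γ : 𝓢(E × E, ℂ)) (f g : E × E → ℂ) :
    Continuous fun p : (E × E) × (E × E) => D.sharp (localize γ f p.1) (localize γ g p.2) := by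
  have h : Continuous fun p : (E × E) × (E × E) => (localize γ f p.1, localize γ g p.2) :=
    ((continuous_localize γ f).comp continuous_fst).prodMk
      ((continuous_localize γ g).comp continuous_snd)
  exact Continuous.comp (f := fun p : (E × E) × (E × E) => (localize γ f p.1, localize γ g p.2))
    D.continuous_sharp h

theorem integrable_decay_mul_decay :
    Integrable fun p : (E × E) × (E × E) => decay E p.1 * decay E p.2 :=
  integrable_decay.mul_prod integrable_decay

theorem contDiff_symbolProduct (γ : 𝓢(E × E, ℂ)) {M₁ M₂ : E × E → ℝ} (hM₁ : IsWeight M₁)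
    (hM₂ : IsWeight M₂) {f g : E × E → ℂ} (hf : IsSymbol M₁ f) (hg : IsSymbol M₂ g)
    (n : ℕ) : ContDiff ℝ n (D.symbolProduct γ f g) ∧
    ∀ X, iteratedFDeriv ℝ n (D.symbolProduct γ f g) X =
      ∫ p : (E × E) × (E × E),
        iteratedFDeriv ℝ n (D.sharp (localize γ f p.1) (localize γ g p.2)) X := by
  refine contDiff_integral_schwartz n ℂ _ (D.continuous_sharp_localize γ f g) fun j r => ?_
  obtain ⟨K, C, hC, h⟩ := D.exists_sharp_localize_le_separated γ hM₁ hM₂ hf hg j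
  refine ⟨_, integrable_decay_mul_decay.const_mul (C * (1 + |r|) ^ K), fun p X hX => ?_⟩
  refine (h p X).trans ?_
  have d₁ := decay_pos p.1
  have d₂ := decay_pos p.2
  gcongr
  exact hX.trans (le_abs_self r)

theorem integrable_sharp_localize (γ : 𝓢(E × E, ℂ)) {M₁ M₂ : E × E → ℝ} (hM₁ : IsWeight M₁)
    (hM₂ : IsWeight M₂) {f g : E × E → ℂ} (hf : IsSymbol M₁ f) (hg : IsSymbol M₂ g)
    (X : E × E) :
    Integrable fun p : (E × E) × (E × E) => D.sharp (localize γ f p.1) (localize γ g p.2) X := by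
  obtain ⟨K, C, hC, h⟩ := D.exists_sharp_localize_le_separated γ hM₁ hM₂ hf hg 0
  refine (integrable_decay_mul_decay.const_mul (C * (1 + ‖X‖) ^ K)).mono'
    (aestronglyMeasurable_eval_schwartz (D.continuous_sharp_localize γ f g) X)
    (.of_forall fun p => ?_)
  simpa using h p X

theorem integrable_sharp_localize_mul (γ : 𝓢(E × E, ℂ)) {M₁ M₂ : E × E → ℝ} (hM₁ : IsWeight M₁)
    (hM₂ : IsWeight M₂) {f g : E × E → ℂ} (hf : IsSymbol M₁ f) (hg : IsSymbol M₂ g)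
    (ψ : 𝓢(E × E, ℂ)) :
    Integrable (fun q : ((E × E) × (E × E)) × (E × E) =>
      D.sharp (localize γ f q.1.1) (localize γ g q.1.2) q.2 * ψ q.2) := by
  obtain ⟨K, C, hC, h⟩ := D.exists_sharp_localize_le_separated γ hM₁ hM₂ hf hg 0
  have hψ : Integrable fun X : E × E => C * (1 + ‖X‖) ^ K * ‖ψ X‖ := by
    have h1 : ∀ X : E × E, C * (1 + ‖X‖) ^ K * ‖ψ X‖ ≤
        C * 2 ^ (K - 1) * (‖X‖ ^ 0 * ‖ψ X‖ + ‖X‖ ^ K * ‖ψ X‖) := fun X => by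
      have := add_pow_le zero_le_one (norm_nonneg X) K
      calc _ ≤ C * (2 ^ (K - 1) * (1 ^ K + ‖X‖ ^ K)) * ‖ψ X‖ := by gcongr
        _ = _ := by ring
    refine Integrable.mono' (((ψ.integrable_pow_mul volume 0).add
      (ψ.integrable_pow_mul volume K)).const_mul (C * 2 ^ (K - 1))) ?_ (.of_forall fun X => ?_)
    · have hc : Continuous fun X : E × E => C * (1 + ‖X‖) ^ K * ‖ψ X‖ := by
        have := ψ.continuous
        fun_prop
      exact hc.aestronglyMeasurable
    · rw [Real.norm_of_nonneg (by positivity)]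
      exact h1 X
  refine (integrable_decay_mul_decay.mul_prod hψ).mono' ?_ (.of_forall fun q => ?_)
  · have hc : Continuous fun q : ((E × E) × (E × E)) × (E × E) =>
        D.sharp (localize γ f q.1.1) (localize γ g q.1.2) q.2 * ψ q.2 :=
      (continuous_eval_schwartz (D.continuous_sharp_localize γ f g)).mul
        (ψ.continuous.comp continuous_snd)
    exact hc.aestronglyMeasurable
  · have := h q.1 q.2
    rw [norm_iteratedFDeriv_zero] at this
    rw [norm_mul]
    calc _ ≤ (C * (1 + ‖q.2‖) ^ K * (decay E q.1.1 * decay E q.1.2)) * ‖ψ q.2‖ := by gcongr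
      _ = _ := by ring

/-- The estimate that makes the product of symbols continuous. -/
theorem exists_symbolProduct_le (γ : 𝓢(E × E, ℂ)) {M₁ M₂ : E × E → ℝ} (hM₁ : IsWeight M₁)
    (hM₂ : IsWeight M₂) (n : ℕ) : ∃ (J : ℕ) (C : ℝ), 0 ≤ C ∧ ∀ f g : E × E → ℂ,
      IsSymbol M₁ f → IsSymbol M₂ g → ∀ A₁ A₂ : ℝ, 0 ≤ A₁ → 0 ≤ A₂ →
        SymbolBound M₁ f J A₁ → SymbolBound M₂ g J A₂ → ∀ X,
          ‖iteratedFDeriv ℝ n (D.symbolProduct γ f g) X‖ ≤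
            C * (A₁ * A₂) * (M₁ X * M₂ X) := by
  obtain ⟨J, C, hC, h⟩ := D.exists_sharp_localize_le γ hM₁ hM₂ n
  set I := ∫ Y, decay E Y with hI
  have hI0 : 0 ≤ I := integral_nonneg fun Y => (decay_pos Y).le
  refine ⟨J, C * (I * I), by positivity, fun f g hf hg A₁ A₂ hA₁ hA₂ hb₁ hb₂ X => ?_⟩
  rw [(D.contDiff_symbolProduct γ hM₁ hM₂ hf hg n).2 X]
  have hd : Integrable fun Y => decay E (X - Y) := integrable_decay.comp_sub_left X
  have hdd : Integrable fun p : (E × E) × (E × E) => decay E (X - p.1) * decay E (X - p.2) :=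
    hd.mul_prod hd
  have e : ∫ p : (E × E) × (E × E), decay E (X - p.1) * decay E (X - p.2) = I * I := by
    refine (integral_prod_mul (fun Y => decay E (X - Y)) fun Y => decay E (X - Y)).trans ?_
    rw [integral_sub_left_eq_self (decay E) volume X]
  refine (norm_integral_le_of_norm_le (hdd.const_mul (C * (A₁ * A₂) * (M₁ X * M₂ X)))
    (.of_forall fun p => h f g (hf.hasTemperateGrowth hM₁) (hg.hasTemperateGrowth hM₂) A₁ A₂ hA₁
      hA₂ hb₁ hb₂ p.1 p.2 X)).trans (le_of_eq ?_)
  rw [integral_const_mul, e]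
  ring

theorem isWeight_mul {V : Type} [NormedAddCommGroup V] [NormedSpace ℝ V] {M₁ M₂ : V → ℝ}
    (hM₁ : IsWeight M₁) (hM₂ : IsWeight M₂) : IsWeight fun X => M₁ X * M₂ X where
  pos X := mul_pos (hM₁.pos X) (hM₂.pos X)
  temperate := by
    obtain ⟨k₁, C₁, hC₁, h₁⟩ := hM₁.temperate
    obtain ⟨k₂, C₂, hC₂, h₂⟩ := hM₂.temperate
    refine ⟨k₁ + k₂, C₁ * C₂, by positivity, fun X Y => ?_⟩
    have := hM₁.pos X
    calc _ ≤ (C₁ * M₁ X * (1 + ‖Y‖) ^ k₁) * (C₂ * M₂ X * (1 + ‖Y‖) ^ k₂) :=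
          mul_le_mul (h₁ X Y) (h₂ X Y) (hM₂.pos _).le (by positivity)
      _ = _ := by rw [pow_add]; ring

theorem isSymbol_symbolProduct (γ : 𝓢(E × E, ℂ)) {M₁ M₂ : E × E → ℝ} (hM₁ : IsWeight M₁)
    (hM₂ : IsWeight M₂) {f g : E × E → ℂ} (hf : IsSymbol M₁ f) (hg : IsSymbol M₂ g) :
    IsSymbol (fun X => M₁ X * M₂ X) (D.symbolProduct γ f g) := by
  refine isSymbol_of_forall (isWeight_mul hM₁ hM₂)
    (contDiff_infty.2 fun n => (D.contDiff_symbolProduct γ hM₁ hM₂ hf hg n).1) fun n => ?_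
  obtain ⟨J, C, hC, h⟩ := D.exists_symbolProduct_le γ hM₁ hM₂ n
  obtain ⟨A₁, hA₁, hb₁⟩ := hf.bound J
  obtain ⟨A₂, hA₂, hb₂⟩ := hg.bound J
  exact ⟨_, h f g hf hg A₁ A₂ hA₁ hA₂ hb₁ hb₂⟩

end WeylData

/-! ### The operators of a product of symbols -/

namespace WeylData
variable {E : Type} [NormedAddCommGroup E] [NormedSpace ℝ E] [FiniteDimensional ℝ E]
  [MeasureSpace E] [BorelSpace E] [(volume : Measure E).IsAddHaarMeasure] (D : WeylData E)

/-- The exchange of the variables of a kernel. -/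
def flipKernel : 𝓢(E × E, ℂ) →L[ℂ] 𝓢(E × E, ℂ) :=
  SchwartzMap.compCLMOfContinuousLinearEquiv ℂ (ContinuousLinearEquiv.prodComm ℝ E E)

theorem flipKernel_apply (κ : 𝓢(E × E, ℂ)) (x y : E) : flipKernel κ (x, y) = κ (y, x) := rfl

/-- The transposed operator `z ↦ ∫ κ(x, z) χ(x) dx` of a Schwartz kernel. -/
def transposeApply (κ : 𝓢(E × E, ℂ)) (χ : 𝓢(E, ℂ)) : 𝓢(E, ℂ) :=
  kernelOp (flipKernel κ) (toDist χ)

theorem transposeApply_apply (κ : 𝓢(E × E, ℂ)) (χ : 𝓢(E, ℂ)) (z : E) :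
    transposeApply κ χ z = ∫ x, χ x * κ (x, z) := by
  rw [transposeApply, kernelOp_apply, toDist_apply]
  rfl

theorem integral_transposeApply_mul (κ : 𝓢(E × E, ℂ)) (χ r : 𝓢(E, ℂ)) :
    ∫ z, transposeApply κ χ z * r z = ∫ p, κ p * tensor χ r p := by
  have h := (SchwartzMap.pairing (ContinuousLinearMap.mul ℂ ℂ) κ (tensor χ r)).integrable
    (μ := (volume : Measure (E × E)))
  refine Eq.trans ?_ (integral_prod_symm _ h).symm
  refine integral_congr_ae (.of_forall fun z => ?_)
  change transposeApply κ χ z * r z = ∫ x, κ (x, z) * (χ x * r z)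
  rw [transposeApply_apply, ← integral_mul_const]
  exact integral_congr_ae (.of_forall fun x => by ring)

theorem integral_compose_mul_tensor (κ₁ κ₂ : 𝓢(E × E, ℂ)) (χ t : 𝓢(E, ℂ)) :
    ∫ p, D.compose κ₁ κ₂ p * tensor χ t p = ∫ p, κ₂ p * tensor (transposeApply κ₁ χ) t p := by
  have h₁ := (SchwartzMap.pairing (ContinuousLinearMap.mul ℂ ℂ) (D.compose κ₁ κ₂)
    (tensor χ t)).integrable (μ := (volume : Measure (E × E)))
  have h₂ := (SchwartzMap.pairing (ContinuousLinearMap.mul ℂ ℂ) κ₂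
    (tensor (transposeApply κ₁ χ) t)).integrable (μ := (volume : Measure (E × E)))
  refine (integral_prod_symm _ h₁).trans (Eq.trans ?_ (integral_prod_symm _ h₂).symm)
  refine integral_congr_ae (.of_forall fun y => ?_)
  change ∫ x, D.compose κ₁ κ₂ (x, y) * (χ x * t y) =
    ∫ z, κ₂ (z, y) * (transposeApply κ₁ χ z * t y)
  have h₃ := (SchwartzMap.pairing (ContinuousLinearMap.mul ℂ ℂ) κ₁
    (tensor χ (slice (flipKernel κ₂) y))).integrable (μ := (volume : Measure (E × E)))
  have hsw := integral_integral_swap (f := fun x z => κ₁ (x, z) * (χ x * κ₂ (z, y))) h₃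
  have e₁ : ∀ x, D.compose κ₁ κ₂ (x, y) * (χ x * t y) =
      (∫ z, κ₁ (x, z) * (χ x * κ₂ (z, y))) * t y := fun x => by
    rw [compose_apply, ← mul_assoc, ← integral_mul_const]
    congr 1
    exact integral_congr_ae (.of_forall fun z => by ring)
  have e₂ : ∀ z, κ₂ (z, y) * (transposeApply κ₁ χ z * t y) =
      (∫ x, κ₁ (x, z) * (χ x * κ₂ (z, y))) * t y := fun z => by
    rw [transposeApply_apply, ← mul_assoc, ← integral_const_mul]
    congr 1
    exact integral_congr_ae (.of_forall fun x => by ring)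
  simp only [e₁, e₂, integral_mul_const]
  rw [hsw]

theorem integral_sharp_mul (f g : 𝓢(E × E, ℂ)) (χ t : 𝓢(E, ℂ)) :
    ∫ p, D.sharp f g p * D.weylTranspose (tensor χ t) p =
      ∫ p, g p * D.weylTranspose (tensor (transposeApply (D.weyl f) χ) t) p := by
  rw [← integral_weyl_mul, ← integral_weyl_mul, weyl_sharp, integral_compose_mul_tensor]

/-- The operator of a product of symbols is the product of the operators: if `r` is the image of
`t` under the operator of `g`, then the operator of the product maps `t` to the image of `r` under
the operator of `f`. -/
theorem integral_symbolProduct_mul {γ : 𝓢(E × E, ℂ)} (hγ : ∫ x, γ x = 1) {M₁ M₂ : E × E → ℝ}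
    (hM₁ : IsWeight M₁) (hM₂ : IsWeight M₂) {f g : E × E → ℂ} (hf : IsSymbol M₁ f)
    (hg : IsSymbol M₂ g) {t r : 𝓢(E, ℂ)}
    (h : ∀ χ, ∫ p, g p * D.weylTranspose (tensor χ t) p = ∫ x, χ x * r x) (χ : 𝓢(E, ℂ)) :
    ∫ p, D.symbolProduct γ f g p * D.weylTranspose (tensor χ t) p =
      ∫ p, f p * D.weylTranspose (tensor χ r) p := by
  have hi := D.integrable_sharp_localize_mul γ hM₁ hM₂ hf hg (D.weylTranspose (tensor χ t))
  have hf' := hf.hasTemperateGrowth hM₁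
  have hg' := hg.hasTemperateGrowth hM₂
  calc ∫ X, D.symbolProduct γ f g X * D.weylTranspose (tensor χ t) X
      = ∫ X, ∫ p : (E × E) × (E × E), D.sharp (localize γ f p.1) (localize γ g p.2) X *
          D.weylTranspose (tensor χ t) X := by
        refine integral_congr_ae (.of_forall fun X => ?_)
        simp only [symbolProduct]
        rw [integral_mul_const]
    _ = ∫ p : (E × E) × (E × E), ∫ X, D.sharp (localize γ f p.1) (localize γ g p.2) X *
          D.weylTranspose (tensor χ t) X := (integral_integral_swap hi).symm
    _ = ∫ Y, ∫ Y', ∫ X, D.sharp (localize γ f Y) (localize γ g Y') X *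
          D.weylTranspose (tensor χ t) X := integral_prod _ hi.integral_prod_left
    _ = ∫ Y, ∫ X, localize γ f Y X * D.weylTranspose (tensor χ r) X := by
        refine integral_congr_ae (.of_forall fun Y => ?_)
        simp only [integral_sharp_mul]
        rw [integral_localize_mul hγ hg', h, integral_transposeApply_mul, integral_weyl_mul]
    _ = _ := integral_localize_mul hγ hf' _

/-- A function all of whose derivatives decay faster than every power is a Schwartz function. -/
theorem exists_schwartz_of_isSymbol {V : Type} [NormedAddCommGroup V] [NormedSpace ℝ V] {f : V → ℂ}
    {M : V → ℝ} (hM : IsWeight M)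
    (h : ∀ N : ℕ, IsSymbol (fun X => M X * ((1 + ‖X‖) ^ N)⁻¹) f) :
    ∃ φ : 𝓢(V, ℂ), ∀ X, φ X = f X := by
  obtain ⟨k, C, hC, hk⟩ := hM.le_pow
  refine ⟨⟨f, (h 0).smooth, fun l n => ?_⟩, fun X => rfl⟩
  obtain ⟨A, hA, hb⟩ := (h (l + k)).bound n
  refine ⟨A * C, fun X => ?_⟩
  have h1 : M X * ((1 + ‖X‖) ^ (l + k))⁻¹ ≤ C * ((1 + ‖X‖) ^ l)⁻¹ := by
    rw [pow_add, mul_inv, mul_comm ((1 + ‖X‖) ^ l)⁻¹, ← mul_assoc]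
    refine mul_le_mul_of_nonneg_right ?_ (by positivity)
    rw [← div_eq_mul_inv, div_le_iff₀ (by positivity)]
    exact hk X
  calc ‖X‖ ^ l * ‖iteratedFDeriv ℝ n f X‖
      ≤ (1 + ‖X‖) ^ l * (A * (C * ((1 + ‖X‖) ^ l)⁻¹)) := by
        gcongr
        · simp
        · exact (hb n le_rfl X).trans (mul_le_mul_of_nonneg_left h1 hA)
    _ = A * C := by
        have : (1 + ‖X‖) ^ l ≠ 0 := by positivity
        field_simp

theorem exists_schwartz_symbolProduct_right (γ : 𝓢(E × E, ℂ)) {M : E × E → ℝ} (hM : IsWeight M)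
    {f : E × E → ℂ} (hf : IsSymbol M f) (g : 𝓢(E × E, ℂ)) :
    ∃ φ : 𝓢(E × E, ℂ), ∀ X, φ X = D.symbolProduct γ f g X :=
  exists_schwartz_of_isSymbol hM fun N =>
    D.isSymbol_symbolProduct γ hM (isWeight_inv_pow N) hf (isSymbol_schwartz g N)

theorem exists_schwartz_symbolProduct_left (γ : 𝓢(E × E, ℂ)) {M : E × E → ℝ} (hM : IsWeight M)
    {f : E × E → ℂ} (hf : IsSymbol M f) (g : 𝓢(E × E, ℂ)) :
    ∃ φ : 𝓢(E × E, ℂ), ∀ X, φ X = D.symbolProduct γ g f X :=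
  exists_schwartz_of_isSymbol hM fun N => by
    have h := D.isSymbol_symbolProduct γ (isWeight_inv_pow N) hM (isSymbol_schwartz g N) hf
    simpa only [mul_comm] using h

/-- The operator of a symbol maps Schwartz functions to Schwartz functions. A Schwartz function `t`
is the image of a Schwartz function under the operator with kernel `t ⊗ s`, which has a Schwartz
symbol; and so is its product with the given symbol. -/
theorem exists_image {M : E × E → ℝ} (hM : IsWeight M) {f : E × E → ℂ} (hf : IsSymbol M f)
    (t : 𝓢(E, ℂ)) :
    ∃ r : 𝓢(E, ℂ), ∀ χ, ∫ p, f p * D.weylTranspose (tensor χ t) p = ∫ x, χ x * r x := by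
  obtain ⟨γ, hγ⟩ := exists_schwartz_integral_eq_one (E × E)
  obtain ⟨s, s', hs⟩ := exists_schwartz_integral_mul_eq_one E
  set τ := D.weylSymbol (tensor t s) with hτ
  obtain ⟨π, hπ⟩ := D.exists_schwartz_symbolProduct_right γ hM hf τ
  refine ⟨transposeApply (flipKernel (D.weyl π)) s', fun χ => ?_⟩
  -- The operator of `τ` has the kernel `t ⊗ s`, and maps `s'` to `t`.
  have h : ∀ χ, ∫ p, τ p * D.weylTranspose (tensor χ s') p = ∫ x, χ x * t x := fun χ => by
    rw [← integral_weyl_mul, hτ, weyl_weylSymbol]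
    have e : ∀ p : E × E, tensor t s p * tensor χ s' p =
        (χ p.1 * t p.1) * (s p.2 * s' p.2) := fun p => by
      simp only [tensor_apply]
      ring
    simp only [e]
    refine (integral_prod_mul (fun x => χ x * t x) fun y => s y * s' y).trans ?_
    rw [hs, mul_one]
  rw [← D.integral_symbolProduct_mul hγ hM (isWeight_inv_pow 0) hf (isSymbol_schwartz τ 0) h χ]
  simp only [← hπ]
  rw [← integral_weyl_mul, ← integral_transposeApply_mul]
  have e := integral_transposeApply_mul (flipKernel (D.weyl π)) s' χ
  have e2 := integral_transposeApply_mul (D.weyl π) χ s'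
  rw [e2]
  simp only [mul_comm (χ _)]
  rw [e]
  exact (integral_prod_swap (μ := (volume : Measure E)) (ν := (volume : Measure E))
    fun p => D.weyl π p * tensor χ s' p).symm.trans
      (integral_congr_ae (.of_forall fun p => by
        simp only [tensor_apply, Prod.fst_swap, Prod.snd_swap]
        change D.weyl π p.swap * _ = flipKernel (D.weyl π) (p.1, p.2) * _
        rw [flipKernel_apply, mul_comm (χ _)]
        rfl))

theorem symbolProduct_add_left (γ : 𝓢(E × E, ℂ)) {M₁ M₂ : E × E → ℝ} (hM₁ : IsWeight M₁)
    (hM₂ : IsWeight M₂) {f f' g : E × E → ℂ} (hf : IsSymbol M₁ f) (hf' : IsSymbol M₁ f')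
    (hg : IsSymbol M₂ g) :
    D.symbolProduct γ (f + f') g = D.symbolProduct γ f g + D.symbolProduct γ f' g := by
  funext X
  have e : ∀ Y, localize γ (f + f') Y = localize γ f Y + localize γ f' Y := fun Y => by
    have h := hf.hasTemperateGrowth hM₁
    have h' := hf'.hasTemperateGrowth hM₁
    ext X
    rw [add_apply, localize_apply γ h, localize_apply γ h', localize_apply γ (h.add h'),
      Pi.add_apply, add_mul]
  simp only [symbolProduct, e, sharp_add_left, add_apply, Pi.add_apply]
  exact integral_add (D.integrable_sharp_localize γ hM₁ hM₂ hf hg X)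
    (D.integrable_sharp_localize γ hM₁ hM₂ hf' hg X)

theorem symbolProduct_add_right (γ : 𝓢(E × E, ℂ)) {M₁ M₂ : E × E → ℝ} (hM₁ : IsWeight M₁)
    (hM₂ : IsWeight M₂) {f g g' : E × E → ℂ} (hf : IsSymbol M₁ f) (hg : IsSymbol M₂ g)
    (hg' : IsSymbol M₂ g') :
    D.symbolProduct γ f (g + g') = D.symbolProduct γ f g + D.symbolProduct γ f g' := by
  funext X
  have e : ∀ Y, localize γ (g + g') Y = localize γ g Y + localize γ g' Y := fun Y => by
    have h := hg.hasTemperateGrowth hM₂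
    have h' := hg'.hasTemperateGrowth hM₂
    ext X
    rw [add_apply, localize_apply γ h, localize_apply γ h', localize_apply γ (h.add h'),
      Pi.add_apply, add_mul]
  simp only [symbolProduct, e, sharp_add_right, add_apply, Pi.add_apply]
  exact integral_add (D.integrable_sharp_localize γ hM₁ hM₂ hf hg X)
    (D.integrable_sharp_localize γ hM₁ hM₂ hf hg' X)

theorem localize_smul {V : Type} [NormedAddCommGroup V] [NormedSpace ℝ V] (γ : 𝓢(V, ℂ))
    {f : V → ℂ} (hf : f.HasTemperateGrowth) (c : ℂ) (Y : V) :
    localize γ (c • f) Y = c • localize γ f Y := by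
  have h : (c • f).HasTemperateGrowth := (Function.HasTemperateGrowth.const c).mul hf
  ext X
  rw [smul_apply, localize_apply γ hf, localize_apply γ h, Pi.smul_apply, smul_eq_mul,
    smul_eq_mul, mul_assoc]

theorem symbolProduct_smul_left (γ : 𝓢(E × E, ℂ)) {f : E × E → ℂ} (hf : f.HasTemperateGrowth)
    (g : E × E → ℂ) (c : ℂ) : D.symbolProduct γ (c • f) g = c • D.symbolProduct γ f g := by
  funext X
  simp only [symbolProduct, localize_smul γ hf, sharp_smul_left, smul_apply, Pi.smul_apply]
  exact integral_smul _ _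

theorem symbolProduct_smul_right (γ : 𝓢(E × E, ℂ)) (f : E × E → ℂ) {g : E × E → ℂ}
    (hg : g.HasTemperateGrowth) (c : ℂ) :
    D.symbolProduct γ f (c • g) = c • D.symbolProduct γ f g := by
  funext X
  simp only [symbolProduct, localize_smul γ hg, sharp_smul_right, smul_apply, Pi.smul_apply]
  exact integral_smul _ _

end WeylData

/-! ### The Weyl calculus of the magnetic super symbols -/

section FourierInversion
variable {d : ℕ}

theorem integral_withLp_prod (g : WithLp 2 (Conf d × Conf d) → ℂ) :
    ∫ v, g v = ∫ p : Conf d × Conf d, g (WithLp.toLp 2 p) :=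
  ((WithLp.volume_preserving_toLp (Conf d) (Conf d)).integral_comp
    (MeasurableEquiv.toLp 2 (Conf d × Conf d)).measurableEmbedding g).symm

theorem fourier_inversion_prod (f : 𝓢(Conf d × Conf d, ℂ)) (x : Conf d × Conf d) :
    ∫ η : Conf d × Conf d,
      Complex.exp (((2 * Real.pi * (inner ℝ η.1 x.1 + inner ℝ η.2 x.2) : ℝ) : ℂ) * Complex.I) *
        ∫ w : Conf d × Conf d, Complex.exp (((-2 * Real.pi *
          (inner ℝ w.1 η.1 + inner ℝ w.2 η.2) : ℝ) : ℂ) * Complex.I) * f w = f x := by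
  let F : 𝓢(WithLp 2 (Conf d × Conf d), ℂ) := SchwartzMap.compCLMOfContinuousLinearEquiv ℂ
    (WithLp.prodContinuousLinearEquiv 2 ℝ (Conf d) (Conf d)) f
  have h := congrFun (F.continuous.fourierInv_fourier_eq F.integrable
    (FourierTransform.fourier F).integrable) (WithLp.toLp 2 x)
  rw [Real.fourierInv_eq', integral_withLp_prod] at h
  refine Eq.trans (integral_congr_ae (.of_forall fun η => ?_)) h
  simp only [Real.fourier_eq', smul_eq_mul]
  rw [integral_withLp_prod]
  simp only [WithLp.prod_inner_apply]
  rfl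

theorem measurePreserving_conj : MeasurePreserving
    (fun p : Conf d × Conf d => (p.1, -p.2)) :=
  (MeasurePreserving.id (volume : Measure (Conf d))).prod
    (Measure.measurePreserving_neg (volume : Measure (Conf d)))

/-- The Fourier inversion formula for the form of the left and right momenta. -/
theorem leftRightForm_inversion (f : 𝓢(Conf d × Conf d, ℂ)) (x : Conf d × Conf d) :
    ∫ ξ, Complex.exp ((leftRightForm d x ξ : ℂ) * Complex.I) *
      ∫ w, Complex.exp ((leftRightForm d (-ξ) w : ℂ) * Complex.I) * f w =
        ((2 * Real.pi) ^ (2 * d) : ℂ) * f x := by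
  set k : Conf d × Conf d → ℂ := fun ξ => Complex.exp ((leftRightForm d x ξ : ℂ) * Complex.I) *
      ∫ w, Complex.exp ((leftRightForm d (-ξ) w : ℂ) * Complex.I) * f w with hk
  -- Substituting `ξ = 2π (η_L, -η_R)` turns the inner integral into Mathlib's Fourier transform.
  have h1 : ∫ ξ : Conf d × Conf d, k (ξ.1, -ξ.2) = ∫ ξ, k ξ :=
    measurePreserving_conj.integral_comp
      ((ContinuousLinearEquiv.refl ℝ (Conf d)).prodCongr
        (ContinuousLinearEquiv.neg ℝ)).toHomeomorph.measurableEmbedding k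
  have h2 := Measure.integral_comp_smul (volume : Measure (Conf d × Conf d))
    (fun ξ => k (ξ.1, -ξ.2)) (2 * Real.pi)
  have h3 : ∀ η : Conf d × Conf d, k (((2 * Real.pi) • η).1, -((2 * Real.pi) • η).2) =
      Complex.exp (((2 * Real.pi * (inner ℝ η.1 x.1 + inner ℝ η.2 x.2) : ℝ) : ℂ) * Complex.I) *
        ∫ w : Conf d × Conf d, Complex.exp (((-2 * Real.pi *
          (inner ℝ w.1 η.1 + inner ℝ w.2 η.2) : ℝ) : ℂ) * Complex.I) * f w := fun η => by
    simp only [hk, leftRightForm_apply, Prod.smul_fst, Prod.smul_snd, Prod.fst_neg, Prod.snd_neg,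
      inner_neg_left, inner_neg_right, real_inner_smul_left, real_inner_smul_right,
      real_inner_comm x.1, real_inner_comm x.2]
    congr 1
    · congr 3
      ring
    · refine integral_congr_ae (.of_forall fun w => ?_)
      simp only [real_inner_comm w.1, real_inner_comm w.2]
      congr 4
      ring
  have hr : Module.finrank ℝ (Conf d × Conf d) = 2 * d := by
    rw [Module.finrank_prod, finrank_euclideanSpace_fin, two_mul]
  have hp : 0 < (2 * Real.pi) ^ (2 * d) := by positivity
  simp only [h3] at h2
  rw [fourier_inversion_prod, h1, hr, abs_of_pos (inv_pos.2 hp)] at h2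
  rw [h2, Complex.real_smul]
  have : ((2 * Real.pi) ^ (2 * d) : ℂ) ≠ 0 := by exact_mod_cast hp.ne'
  push_cast
  field_simp

theorem leftRightForm_symm (ξ w : Conf d × Conf d) :
    leftRightForm d ξ w = leftRightForm d w ξ := by
  rw [leftRightForm_apply, leftRightForm_apply, real_inner_comm ξ.1, real_inner_comm ξ.2]

end FourierInversion

section Model
variable {d : ℕ}

/-- The Weyl calculus with configuration space `ℝ^{2d}` to which the super Weyl transform belongs. -/
def superWeylData (B : MagneticField d) : WeylData (Conf d × Conf d) where
  form := leftRightForm d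
  le_norm_form := le_norm_leftRightForm
  form_symm := leftRightForm_symm
  const := ((2 * Real.pi) ^ (2 * d) : ℂ)
  const_ne_zero := by
    have : (2 * Real.pi) ^ (2 * d) ≠ 0 := by positivity
    exact_mod_cast this
  inversion := leftRightForm_inversion
  phase := superPhaseFactor B
  phase_hasTemperateGrowth := superPhaseFactor_hasTemperateGrowth B
  conj_phase_mul_phase p := by
    rw [superPhaseFactor, ← Complex.exp_conj, ← Complex.exp_add, map_mul, Complex.conj_ofReal,
      Complex.conj_I]
    simp
  isTemperateFamily_trianglePhase := isTemperateFamily_trianglePhase B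

/-- The exchange `((x_L, ξ_L), (x_R, ξ_R)) ↦ ((x_L, x_R), (ξ_L, ξ_R))` of the two orderings of the
coordinates of `ℝ^{4d}`; it is its own inverse. -/
def reorder (d : ℕ) : SuperPhase d ≃ₗᵢ[ℝ] SuperPhase d where
  toLinearEquiv := (ContinuousLinearEquiv.prodProdProdComm ℝ (Conf d) (Conf d) (Conf d)
    (Conf d)).toLinearEquiv
  norm_map' X := by
    change max (max ‖X.1.1‖ ‖X.2.1‖) (max ‖X.1.2‖ ‖X.2.2‖) =
      max (max ‖X.1.1‖ ‖X.1.2‖) (max ‖X.2.1‖ ‖X.2.2‖)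
    grind

theorem reorder_reorder (X : SuperPhase d) : reorder d (reorder d X) = X := rfl

theorem measurePreserving_reorder : MeasurePreserving (reorder d) := by
  refine ⟨(reorder d).continuous.measurable, ?_⟩
  have h1 : LinearMap.det ((reorder d).toLinearEquiv : SuperPhase d →ₗ[ℝ] SuperPhase d) *
      LinearMap.det ((reorder d).toLinearEquiv : SuperPhase d →ₗ[ℝ] SuperPhase d) = 1 := by
    rw [← LinearMap.det_comp]
    exact LinearMap.det_id
  have h0 := left_ne_zero_of_mul_eq_one h1
  have h2 := Measure.map_linearMap_addHaar_eq_smul_addHaar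
    (volume : Measure (SuperPhase d)) h0
  have h3 : |(LinearMap.det ((reorder d).toLinearEquiv : SuperPhase d →ₗ[ℝ] SuperPhase d))⁻¹| = 1 := by
    rcases mul_self_eq_one_iff.1 h1 with h | h <;> rw [h] <;> norm_num
  rw [h3, ENNReal.ofReal_one, one_smul] at h2
  exact h2

theorem integral_comp_reorder (g : SuperPhase d → ℂ) : ∫ X, g (reorder d X) = ∫ X, g X :=
  measurePreserving_reorder.integral_comp (reorder d).toHomeomorph.measurableEmbedding g

theorem superWeylTranspose_eq (B : MagneticField d) (χ : 𝓢(SuperPhase d, ℂ)) (X : SuperPhase d) :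
    superWeylTranspose B χ X = (superWeylData B).weylTranspose χ (reorder d X) := rfl

/-- A Schwartz symbol in the reordered coordinates. -/
def reorderSchwartz (Ψ : 𝓢(SuperPhase d, ℂ)) : 𝓢(SuperPhase d, ℂ) :=
  SchwartzMap.compCLMOfContinuousLinearEquiv ℂ (reorder d).toContinuousLinearEquiv Ψ

theorem reorderSchwartz_apply (Ψ : 𝓢(SuperPhase d, ℂ)) (X : SuperPhase d) :
    reorderSchwartz Ψ X = Ψ (reorder d X) := rfl

theorem superWeylSchwartz_eq (B : MagneticField d) (Ψ : 𝓢(SuperPhase d, ℂ)) :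
    superWeylSchwartz B Ψ = (superWeylData B).weyl (reorderSchwartz Ψ) := rfl

theorem superWeylTranspose_surjective (B : MagneticField d) :
    Function.Surjective (superWeylTranspose B) := by
  intro ψ
  obtain ⟨χ, hχ⟩ := (superWeylData B).weylTranspose_surjective (reorderSchwartz ψ)
  refine ⟨χ, ?_⟩
  ext X
  rw [superWeylTranspose_eq, hχ, reorderSchwartz_apply, reorder_reorder]

/-- The tempered distribution `Φ` is given by the function `f` of the reordered coordinates. -/
def IsGivenBy (B : MagneticField d) (Φ : Dist (SuperPhase d)) (f : SuperPhase d → ℂ) : Prop :=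
  ∀ χ, Φ (superWeylTranspose B χ) = ∫ p, f p * (superWeylData B).weylTranspose χ p

theorem isGivenBy_toDist (B : MagneticField d) (Ψ : 𝓢(SuperPhase d, ℂ)) :
    IsGivenBy B (toDist Ψ) (reorderSchwartz Ψ) := fun χ => by
  rw [toDist_apply, ← integral_comp_reorder]
  rfl

theorem SuperClass.isGivenBy_toDist (B : MagneticField d) {M : TemperedWeight d}
    (Φ : SuperClass M) : IsGivenBy B Φ.toDist fun X => Φ.fn (reorder d X) := fun χ => by
  rw [SuperClass.toDist_apply, ← integral_comp_reorder]
  refine integral_congr_ae (.of_forall fun X => ?_)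
  exact mul_comm _ _

/-- The weight in the reordered coordinates. -/
theorem TemperedWeight.isWeight (M : TemperedWeight d) :
    IsWeight fun X => M.toFun (reorder d X) where
  pos X := M.pos _
  temperate := by
    obtain ⟨a, C, ha, hC, h⟩ := M.tempered
    refine ⟨⌈a⌉₊, C * 2 ^ ⌈a⌉₊, by positivity, fun X Y => ?_⟩
    have h3 : bracket (reorder d Y) ^ a ≤ 2 ^ ⌈a⌉₊ * (1 + ‖Y‖) ^ ⌈a⌉₊ := by
      have h4 := bracket_le (reorder d Y)
      rw [LinearIsometryEquiv.norm_map] at h4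
      rw [← mul_pow, ← Real.rpow_natCast]
      exact (Real.rpow_le_rpow (bracket_pos _).le h4 ha.le).trans
        (Real.rpow_le_rpow_of_exponent_le (by nlinarith [norm_nonneg Y]) (Nat.le_ceil a))
    rw [map_add]
    have := M.pos (reorder d X)
    calc _ ≤ C * M.toFun (reorder d X) * bracket (reorder d Y) ^ a := h _ _
      _ ≤ C * M.toFun (reorder d X) * (2 ^ ⌈a⌉₊ * (1 + ‖Y‖) ^ ⌈a⌉₊) := by gcongr
      _ = _ := by ring

theorem norm_iteratedFDeriv_comp_reorder (f : SuperPhase d → ℂ) (n : ℕ) (X : SuperPhase d) :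
    ‖iteratedFDeriv ℝ n (fun X => f (reorder d X)) X‖ = ‖iteratedFDeriv ℝ n f (reorder d X)‖ :=
  (reorder d).norm_iteratedFDeriv_comp_right f X n

theorem SuperClass.symbolBound {M : TemperedWeight d} (Φ : SuperClass M) (J : ℕ) :
    SymbolBound (fun X => M.toFun (reorder d X)) (fun X => Φ.fn (reorder d X)) J
      ((Finset.range (J + 1)).sup (SuperClass.seminorm M) Φ) := fun j hj X => by
  rw [norm_iteratedFDeriv_comp_reorder]
  have h1 := Φ.le_iSup j (reorder d X)
  rw [← SuperClass.seminorm_apply, inv_mul_le_iff₀ (M.pos _), mul_comm] at h1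
  refine h1.trans (mul_le_mul_of_nonneg_right ?_ (M.pos _).le)
  exact Seminorm.le_def.1 (Finset.le_sup (f := SuperClass.seminorm M)
    (Finset.mem_range.2 (Nat.lt_succ_of_le hj))) Φ

theorem SuperClass.isSymbol {M : TemperedWeight d} (Φ : SuperClass M) :
    IsSymbol (fun X => M.toFun (reorder d X)) fun X => Φ.fn (reorder d X) where
  smooth := Φ.fn_smooth.comp (reorder d).contDiff
  bound J := ⟨_, apply_nonneg _ _, Φ.symbolBound J⟩

/-! ### The super Weyl product -/

theorem smoothingKernel_congr {R R' : SmoothingOp d} (h : R.toTempered = R'.toTempered) :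
    smoothingKernel R = smoothingKernel R' := by
  rw [smoothingKernel, smoothingKernel, h]

section Product
variable (B : MagneticField d) {γ : 𝓢(SuperPhase d, ℂ)} {M₁ M₂ : SuperPhase d → ℝ}
  {f g : SuperPhase d → ℂ} {Φ Ψ Θ : Dist (SuperPhase d)}

/-- The super operator of a symbol maps smoothing operators to smoothing operators, in terms of
kernels. -/
theorem exists_kernelMap_eq_toDist (hM₂ : IsWeight M₂) (hg : IsSymbol M₂ g)
    (hΨ : IsGivenBy B Ψ g) (t : 𝓢(Conf d × Conf d, ℂ)) : ∃ r : 𝓢(Conf d × Conf d, ℂ),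
      (∀ χ, ∫ p, g p * (superWeylData B).weylTranspose (tensor χ t) p = ∫ x, χ x * r x) ∧
        kernelMap (superWeylTransform B Ψ) t = toDist r := by
  obtain ⟨r, hr⟩ := (superWeylData B).exists_image hM₂ hg t
  refine ⟨r, hr, ?_⟩
  ext χ
  rw [kernelMap_apply, superWeylTransform_apply, hΨ, hr, toDist_apply]
  exact integral_congr_ae (.of_forall fun x => mul_comm _ _)

/-- The super operator of a product of symbols is the composition, in terms of kernels. -/
theorem kernelMap_product_eq (hγ : ∫ X, γ X = 1) (hM₁ : IsWeight M₁) (hM₂ : IsWeight M₂)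
    (hf : IsSymbol M₁ f) (hg : IsSymbol M₂ g) (hΦ : IsGivenBy B Φ f)
    (hΘ : IsGivenBy B Θ ((superWeylData B).symbolProduct γ f g)) {t r : 𝓢(Conf d × Conf d, ℂ)}
    (h : ∀ χ, ∫ p, g p * (superWeylData B).weylTranspose (tensor χ t) p = ∫ x, χ x * r x) :
    kernelMap (superWeylTransform B Θ) t = kernelMap (superWeylTransform B Φ) r := by
  ext χ
  rw [kernelMap_apply, kernelMap_apply, superWeylTransform_apply, superWeylTransform_apply, hΘ, hΦ]
  exact (superWeylData B).integral_symbolProduct_mul hγ hM₁ hM₂ hf hg h χ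

theorem isSuperWeylProduct_of_isGivenBy (hγ : ∫ X, γ X = 1) (hM₁ : IsWeight M₁)
    (hM₂ : IsWeight M₂) (hf : IsSymbol M₁ f) (hg : IsSymbol M₂ g) (hΦ : IsGivenBy B Φ f)
    (hΨ : IsGivenBy B Ψ g) (hΘ : IsGivenBy B Θ ((superWeylData B).symbolProduct γ f g)) :
    IsSuperWeylProduct B Φ Ψ Θ := by
  intro T
  obtain ⟨r, hr, hrΨ⟩ := exists_kernelMap_eq_toDist B hM₂ hg hΨ (smoothingKernel T)
  refine ⟨kernelOp r, ?_, ?_⟩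
  · rw [superOp, hrΨ, toTempered_kernelOp]
  · rw [superOp, superOp, smoothingKernel_kernelOp,
      kernelMap_product_eq B hγ hM₁ hM₂ hf hg hΦ hΘ hr]

/-- The super Weyl product is unique: the operators determine the super kernel, and the super kernel
determines the symbol. -/
theorem IsSuperWeylProduct.eq {Θ' : Dist (SuperPhase d)} (h : IsSuperWeylProduct B Φ Ψ Θ)
    (h' : IsSuperWeylProduct B Φ Ψ Θ') : Θ = Θ' := by
  have hinj := kernelMap_injective (V := Conf d) (W := Conf d) (innerSL ℝ)
    fun η => (innerSL_apply_norm ℝ η).ge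
  have hinj' := kernelMap_injective (V := Conf d × Conf d) (W := Conf d × Conf d)
    (leftRightForm d) le_norm_leftRightForm
  have key : superWeylTransform B Θ = superWeylTransform B Θ' := by
    refine hinj' ?_
    ext1 t
    refine hinj ?_
    obtain ⟨R, hR, hRΘ⟩ := h (kernelOp t)
    obtain ⟨R', hR', hRΘ'⟩ := h' (kernelOp t)
    have e : smoothingKernel R = smoothingKernel R' := smoothingKernel_congr (hR.symm.trans hR')
    have e2 : superOp B Θ (kernelOp t) = superOp B Θ' (kernelOp t) := by
      rw [hRΘ, hRΘ', superOp, superOp, e]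
    simpa only [superOp, smoothingKernel_kernelOp] using e2
  ext ψ
  obtain ⟨χ, rfl⟩ := superWeylTranspose_surjective B ψ
  exact congrArg (fun k => k χ) key

theorem isSchwartzSuperWeylProduct_of_isGivenBy (hγ : ∫ X, γ X = 1) (hM₂ : IsWeight M₂)
    (hg : IsSymbol M₂ g) (Ψ₀ : 𝓢(SuperPhase d, ℂ)) (hΨ : IsGivenBy B Ψ g)
    (hΘ : IsGivenBy B Θ ((superWeylData B).symbolProduct γ (reorderSchwartz Ψ₀) g)) :
    IsSchwartzSuperWeylProduct B Ψ₀ Ψ Θ := by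
  intro T
  obtain ⟨r, hr, hrΨ⟩ := exists_kernelMap_eq_toDist B hM₂ hg hΨ (smoothingKernel T)
  refine ⟨kernelOp (kernelOp (superWeylSchwartz B Ψ₀) (toDist r)), fun X => ?_, ?_⟩
  · rw [smoothingKernel_kernelOp, superOp, operatorKernel_kernelMap, hrΨ, kernelOp_apply]
  · rw [superOp, toTempered_kernelOp, toDist_kernelOp]
    congr 1
    rw [kernelMap_product_eq B hγ (isWeight_inv_pow 0) hM₂ (isSymbol_schwartz _ 0) hg
      (isGivenBy_toDist B Ψ₀) hΘ hr]
    ext χ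
    rw [kernelMap_apply, kernelMap_apply, superWeylTransform_apply, isGivenBy_toDist B Ψ₀,
      toDist_apply, superWeylSchwartz_eq]
    exact ((superWeylData B).integral_weyl_mul _ _).symm

end Product

theorem superClassInfty_subset_superMoyalAlgebra (B : MagneticField d) :
    superClassInfty d ⊆ superMoyalAlgebra B := by
  intro Φ hΦ
  obtain ⟨M, Φ, rfl⟩ := Set.mem_iUnion.1 hΦ
  intro Ψ
  obtain ⟨γ, hγ⟩ := exists_schwartz_integral_eq_one (SuperPhase d)
  obtain ⟨φ, hφ⟩ := (superWeylData B).exists_schwartz_symbolProduct_right γ M.isWeight Φ.isSymbol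
    (reorderSchwartz Ψ)
  obtain ⟨φ', hφ'⟩ := (superWeylData B).exists_schwartz_symbolProduct_left γ M.isWeight Φ.isSymbol
    (reorderSchwartz Ψ)
  refine ⟨⟨reorderSchwartz φ, ?_⟩, ⟨reorderSchwartz φ', ?_⟩⟩
  · refine isSuperWeylProduct_of_isGivenBy B hγ M.isWeight (isWeight_inv_pow 0) Φ.isSymbol
      (isSymbol_schwartz (reorderSchwartz Ψ) 0) (SuperClass.isGivenBy_toDist B Φ)
      (isGivenBy_toDist B Ψ) ?_
    rw [← funext hφ]
    exact isGivenBy_toDist B (reorderSchwartz φ)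
  · refine isSchwartzSuperWeylProduct_of_isGivenBy B hγ M.isWeight Φ.isSymbol Ψ
      (SuperClass.isGivenBy_toDist B Φ) ?_
    rw [← funext hφ']
    exact isGivenBy_toDist B (reorderSchwartz φ')

/-- The super Weyl product of two elements of Hörmander classes. -/
def SuperClass.product (B : MagneticField d) (γ : 𝓢(SuperPhase d, ℂ)) {M₁ M₂ : TemperedWeight d}
    (Φ : SuperClass M₁) (Ψ : SuperClass M₂) : SuperClass (M₁.mul M₂) :=
  ⟨fun X => (superWeylData B).symbolProduct γ (fun X => Φ.fn (reorder d X))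
      (fun X => Ψ.fn (reorder d X)) (reorder d X), by
    have h := (superWeylData B).isSymbol_symbolProduct γ M₁.isWeight M₂.isWeight Φ.isSymbol
      Ψ.isSymbol
    refine ⟨h.smooth.comp (reorder d).contDiff, fun n => ?_⟩
    obtain ⟨A, -, hA⟩ := h.bound n
    refine ⟨A, ?_⟩
    rintro _ ⟨X, rfl⟩
    simp only [norm_iteratedFDeriv_comp_reorder]
    rw [inv_mul_le_iff₀ ((M₁.mul M₂).pos X), mul_comm]
    exact hA n le_rfl (reorder d X)⟩

theorem SuperClass.isGivenBy_product (B : MagneticField d) (γ : 𝓢(SuperPhase d, ℂ))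
    {M₁ M₂ : TemperedWeight d} (Φ : SuperClass M₁) (Ψ : SuperClass M₂) :
    IsGivenBy B (SuperClass.product B γ Φ Ψ).toDist ((superWeylData B).symbolProduct γ
      (fun X => Φ.fn (reorder d X)) (fun X => Ψ.fn (reorder d X))) :=
  SuperClass.isGivenBy_toDist B (SuperClass.product B γ Φ Ψ)

theorem SuperClass.exists_seminorm_product_le (B : MagneticField d) (γ : 𝓢(SuperPhase d, ℂ))
    (M₁ M₂ : TemperedWeight d) (n : ℕ) : ∃ (s : Finset ℕ) (C : ℝ), 0 ≤ C ∧
      ∀ (Φ : SuperClass M₁) (Ψ : SuperClass M₂),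
        SuperClass.seminorm (M₁.mul M₂) n (SuperClass.product B γ Φ Ψ) ≤
          C * (s.sup (SuperClass.seminorm M₁) Φ * s.sup (SuperClass.seminorm M₂) Ψ) := by
  obtain ⟨J, C, hC, h⟩ := (superWeylData B).exists_symbolProduct_le γ M₁.isWeight M₂.isWeight n
  refine ⟨Finset.range (J + 1), C, hC, fun Φ Ψ => ?_⟩
  rw [SuperClass.seminorm_apply]
  refine ciSup_le fun X => ?_
  have h1 := h _ _ Φ.isSymbol Ψ.isSymbol _ _ (apply_nonneg _ _) (apply_nonneg _ _)
    (Φ.symbolBound J) (Ψ.symbolBound J) (reorder d X)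
  rw [← norm_iteratedFDeriv_comp_reorder] at h1
  rw [inv_mul_le_iff₀ ((M₁.mul M₂).pos X), mul_comm]
  exact h1

/-- The super Weyl product of Hörmander classes, as a bilinear map. -/
def SuperClass.productLM (B : MagneticField d) (γ : 𝓢(SuperPhase d, ℂ))
    (M₁ M₂ : TemperedWeight d) :
    SuperClass M₁ →ₗ[ℂ] SuperClass M₂ →ₗ[ℂ] SuperClass (M₁.mul M₂) :=
  LinearMap.mk₂ ℂ (SuperClass.product B γ)
    (fun Φ Φ' Ψ => Subtype.ext (funext fun X => congrFun
      ((superWeylData B).symbolProduct_add_left γ M₁.isWeight M₂.isWeight Φ.isSymbol Φ'.isSymbol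
        Ψ.isSymbol) (reorder d X)))
    (fun c Φ _ => Subtype.ext (funext fun X => congrFun
      ((superWeylData B).symbolProduct_smul_left γ (Φ.isSymbol.hasTemperateGrowth M₁.isWeight) _ c)
        (reorder d X)))
    (fun Φ Ψ Ψ' => Subtype.ext (funext fun X => congrFun
      ((superWeylData B).symbolProduct_add_right γ M₁.isWeight M₂.isWeight Φ.isSymbol Ψ.isSymbol
        Ψ'.isSymbol) (reorder d X)))
    (fun c _ Ψ => Subtype.ext (funext fun X => congrFun
      ((superWeylData B).symbolProduct_smul_right γ _ (Ψ.isSymbol.hasTemperateGrowth M₂.isWeight) c)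
        (reorder d X)))

/-- A bilinear map that is bounded with respect to families of seminorms is jointly continuous. -/
theorem continuous_of_seminorm_le {ι₁ ι₂ ι₃ X Y Z : Type} [AddCommGroup X] [Module ℂ X]
    [TopologicalSpace X] [AddCommGroup Y] [Module ℂ Y] [TopologicalSpace Y] [AddCommGroup Z]
    [Module ℂ Z] [TopologicalSpace Z] {p : ι₁ → Seminorm ℂ X} {q : ι₂ → Seminorm ℂ Y}
    {r : ι₃ → Seminorm ℂ Z} (hp : WithSeminorms p) (hq : WithSeminorms q)
    (hr : WithSeminorms r) (L : X →ₗ[ℂ] Y →ₗ[ℂ] Z)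
    (h : ∀ i, ∃ (s : Finset ι₁) (s' : Finset ι₂) (C : ℝ), 0 ≤ C ∧
      ∀ x y, r i (L x y) ≤ C * (s.sup p x * s'.sup q y)) :
    Continuous fun z : X × Y => L z.1 z.2 := by
  have := hp.topologicalAddGroup
  have := hq.topologicalAddGroup
  rw [continuous_iff_continuousAt]
  rintro ⟨x₀, y₀⟩
  refine (hr.tendsto_nhds _ _).2 fun i ε hε => ?_
  obtain ⟨s, s', C, hC, hb⟩ := h i
  have hsc : ∀ s : Finset ι₁, Continuous ⇑(s.sup p : Seminorm ℂ X) := fun s =>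
    Finset.sup_induction (p := fun q : Seminorm ℂ X => Continuous q) continuous_const
      (fun _ ha _ hb => ha.sup hb) fun i _ => hp.continuous_seminorm i
  have hsc' : ∀ s : Finset ι₂, Continuous ⇑(s.sup q : Seminorm ℂ Y) := fun s =>
    Finset.sup_induction (p := fun q : Seminorm ℂ Y => Continuous q) continuous_const
      (fun _ ha _ hb => ha.sup hb) fun i _ => hq.continuous_seminorm i
  let F : X × Y → ℝ := fun z => C * (s.sup p (z.1 - x₀) * s'.sup q (z.2 - y₀)) +
    C * (s.sup p x₀ * s'.sup q (z.2 - y₀)) + C * (s.sup p (z.1 - x₀) * s'.sup q y₀)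
  have hF : Continuous F := by
    have h1 : Continuous fun z : X × Y => s.sup p (z.1 - x₀) :=
      (hsc s).comp (continuous_fst.sub continuous_const)
    have h2 : Continuous fun z : X × Y => s'.sup q (z.2 - y₀) :=
      (hsc' s').comp (continuous_snd.sub continuous_const)
    fun_prop
  have hF0 : F (x₀, y₀) < ε := by simpa [F] using hε
  filter_upwards [hF.continuousAt.eventually_lt_const hF0] with z hz
  refine lt_of_le_of_lt ?_ hz
  have hdec : L z.1 z.2 - L x₀ y₀ = L (z.1 - x₀) (z.2 - y₀) + L x₀ (z.2 - y₀) +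
      L (z.1 - x₀) y₀ := by
    simp only [map_sub, LinearMap.sub_apply]
    abel
  rw [hdec]
  exact (map_add_le_add _ _ _).trans (add_le_add ((map_add_le_add _ _ _).trans
    (add_le_add (hb _ _) (hb _ _))) (hb _ _))

theorem SuperClass.continuous_productLM (B : MagneticField d) (γ : 𝓢(SuperPhase d, ℂ))
    (M₁ M₂ : TemperedWeight d) : Continuous fun p : SuperClass M₁ × SuperClass M₂ =>
      SuperClass.productLM B γ M₁ M₂ p.1 p.2 :=
  continuous_of_seminorm_le SuperClass.withSeminorms SuperClass.withSeminorms
    SuperClass.withSeminorms _ fun n => by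
      obtain ⟨s, C, hC, h⟩ := SuperClass.exists_seminorm_product_le B γ M₁ M₂ n
      exact ⟨s, s, C, hC, h⟩

end Model

end MagneticSuper
end

theorem proposition4p3 (d : ℕ) (B : MagneticSuper.MagneticField d) :
    MagneticSuper.superClassInfty d ⊆ MagneticSuper.superMoyalAlgebra B ∧
    ∀ M₁ M₂ : MagneticSuper.TemperedWeight d,
      ∃ P : MagneticSuper.SuperClass M₁ →ₗ[ℂ] MagneticSuper.SuperClass M₂ →ₗ[ℂ]
          MagneticSuper.SuperClass (M₁.mul M₂),
        Continuous (fun p : MagneticSuper.SuperClass M₁ × MagneticSuper.SuperClass M₂ =>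
          P p.1 p.2) ∧
        ∀ (Φ : MagneticSuper.SuperClass M₁) (Ψ : MagneticSuper.SuperClass M₂)
          (Θ : MagneticSuper.Dist (MagneticSuper.SuperPhase d)),
          MagneticSuper.IsSuperWeylProduct B Φ.toDist Ψ.toDist Θ ↔ Θ = (P Φ Ψ).toDist := by
  refine ⟨MagneticSuper.superClassInfty_subset_superMoyalAlgebra B, fun M₁ M₂ => ?_⟩
  obtain ⟨γ, hγ⟩ := MagneticSuper.exists_schwartz_integral_eq_one (MagneticSuper.SuperPhase d)
  refine ⟨MagneticSuper.SuperClass.productLM B γ M₁ M₂,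
    MagneticSuper.SuperClass.continuous_productLM B γ M₁ M₂, fun Φ Ψ Θ => ?_⟩
  have h := MagneticSuper.isSuperWeylProduct_of_isGivenBy B hγ M₁.isWeight M₂.isWeight Φ.isSymbol
    Ψ.isSymbol (Φ.isGivenBy_toDist B) (Ψ.isGivenBy_toDist B)
    (MagneticSuper.SuperClass.isGivenBy_product B γ Φ Ψ)
  refine ⟨fun hΘ => ?_, fun hΘ => hΘ ▸ h⟩
  exact hΘ.eq B h
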